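/- Let $\Bbbk$ be a field of characteristic $0$ and $n\ge 3$. **Conventions.** A *Nambu-Poisson algebra* is a commutative $\Bbbk$-algebra $A$ with a skew-symmetric $\Bbbk$-multilinear bracket $\{-,\dots,-\}\colon A^n\to A$ that is a derivation in each argument and satisfies $$\{\{u_1,\dots,u_n\},v_1,\dots,v_{n-1}\}=\sum_{s=1}^n\{u_1,\dots,\{u_s,v_1,\dots,v_{n-1}\},\dots,u_n\}.$$ If $A$ is a domain, the bracket extends uniquely to its fraction field; the resulting Nambu-Poisson field is denoted $Q(A)$. For $\Omega\in\Bbbk[t_1,\dots,t_{n+1}]$, let $A_\Omega$ be the polynomial ring $\Bbbk[t_1,\dots,t_{n+1}]$ with the bracket that sends $(f_1,\dots,f_n)$ to the Jacobian determinant of $(f_1,\dots,f_n,\Omega)$ with respect to $t_1,\dots,t_{n+1}$. For $\xi\in\Bbbk$ let $P_{\Omega-\xi}=A_\Omega/(\Omega-\xi)$, with the induced bracket, and write $P_\Omega$ for $P_{\Omega-0}$. A *$0$-valuation* on a Nambu-Poisson field $N$ is a map $\nu\colon N\to\mathbb Z\cup\{\infty\}$ such that for all $a,b,b_1,\dots,b_n\in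 N$: $\nu(a)=\infty$ if and only if $a=0$; $\nu=0$ on $\Bbbk\setminus\{0\}$; $\nu(ab)=\nu(a)+\nu(b)$; $\nu(a+b)\ge\min\{\nu(a),\nu(b)\}$, with equality if $\nu(a)\ne\nu(b)$; and $\nu(\{b_1,\dots,b_n\})\ge\sum_s\nu(b_s)$. It is *nontrivial* if $\nu(a)\neq 0$ for some $a\ne0$. Two $0$-valuations $\nu,\nu'$ are *equivalent* if $a\nu=b\nu'$ for some positive integers $a,b$. With $F_i^\nu=\{a\in N\mid\nu(a)\ge i\}$, the domain $\operatorname{gr}_\nu(N)=\bigoplus_{i\in\mathbb Z}F_i^\nu/F_{i+1}^\nu$ has an induced Nambu-Poisson bracket. The $0$-valuation $\nu$ is *faithful* if its image is $\mathbb Z\cup\{\infty\}$, the bracket of $\operatorname{gr}_\nu(N)$ is nonzero, and $\operatorname{gr}_\nu(N)$ and $N$ have the same Gelfand-Kirillov dimension over $\Bbbk$. Write $N\to_\nu N'$ if the Nambu-Poisson field $N'$ is isomorphic to $Q(\operatorname{gr}_\nu(N))$. The *depth* $\mathbf d(N)$ is the supremum of the lengths $l$ of chains $N=N_0\to_{\nu_1}N_1\to_{\nu_2}\cdots\to_{\nu_l}N_l$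 with all $\nu_i$ faithful and $N_i\not\cong N_j$ for $i\ne j$. The *width* $\mathbf w(N)$ is the number of isomorphism classes of Nambu-Poisson fields $N'$ such that $N\to_\nu N'$ for some faithful $0$-valuation $\nu$ of $N$. **Theorem.** Let $\Omega\in\Bbbk[t_1,\dots,t_{n+1}]$ be homogeneous of degree $n+1$ (with $\deg t_j=1$ for all $j$) with an isolated singularity, that is, $\Bbbk[t_1,\dots,t_{n+1}]/(\partial\Omega/\partial t_1,\dots,\partial\Omega/\partial t_{n+1})$ is finite-dimensional. Then $P_\Omega$ and $P_{\Omega-1}$ are domains, and the following hold. 1. Let $N=Q(P_\Omega)$. There are $0$-valuations $\nu^{Id}$ and $\nu^{-Id}$ on $N$ such that, for every $i\in\mathbb Z$, $\{f\in P_\Omega\mid\nu^{Id}(f)\ge i\}$ is spanned by the images of the monomials of total degree $d$ with $d\ge i$, and $\{f\in P_\Omega\mid\nu^{-Id}(f)\ge i\}$ is spanned by the images of the monomials of total degree $d$ with $-d\ge i$. They are nontrivial and not equivalent to each other, and every nontrivial $0$-valuation on $N$ is equivalent to one of them. The faithful $0$-valuations on $N$ are exactly $\nu^{Id}$ and $\nu^{-Id}$.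 For every nontrivial $0$-valuation $\nu$ on $N$ one has $N\to_\nu N$. Moreover $\mathbf d(N)=0$ and $\mathbf w(N)=1$. 2. Let $N=Q(P_{\Omega-1})$. There is a $0$-valuation $\nu^c$ on $N$ such that, for every $i\in\mathbb Z$, $\{f\in P_{\Omega-1}\mid\nu^c(f)\ge i\}$ is spanned by the images of the monomials of total degree $d$ with $-d\ge i$. It is nontrivial and faithful, and every nontrivial $0$-valuation on $N$ is equivalent to it. For every nontrivial $0$-valuation $\nu$ on $N$ one has $N\to_\nu Q(P_\Omega)$. Moreover $\mathbf d(N)=1$ and $\mathbf w(N)=1$. -/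

import Mathlib

open Function

universe u

/-- A Nambu-Poisson (`n`-Lie Poisson) structure over `k` on a commutative algebra `A`: a
skew-symmetric `k`-multilinear `n`-ary bracket which is a derivation in every argument and satisfies
the Jacobi (Filippov) identity
`{{u_1, …, u_n}, v_1, …, v_{n-1}} = ∑ s, {u_1, …, {u_s, v_1, …, v_{n-1}}, …, u_n}`.
In `jacobi` the distinguished argument sits in an arbitrary slot `i` of `v` (the entry `v i` itself is
irrelevant); by skew-symmetry all choices of the slot are equivalent. -/
class NambuPoisson (k : Type*) (n : ℕ) (A : Type*) [CommRing k] [CommRing A] [Algebra k A] where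
  bracket : A [⋀^Fin n]→ₗ[k] A
  leibniz : ∀ (v : Fin n → A) (i : Fin n) (a b : A),
    bracket (update v i (a * b)) = a * bracket (update v i b) + b * bracket (update v i a)
  jacobi : ∀ (u v : Fin n → A) (i : Fin n),
    bracket (update v i (bracket u)) = ∑ s, bracket (update u s (bracket (update v i (u s))))

/-- Slot by slot induction: to prove `p` for all tuples, prove it for tuples with entries in `S` and
extend one entry at a time. -/
theorem NambuPoisson.slotwise {ι M : Type*} [Fintype ι] [DecidableEq ι] (p : (ι → M) → Prop)
    (S : Set M) (base : ∀ x, (∀ i, x i ∈ S) → p x)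
    (step : ∀ x i, (∀ y ∈ S, p (update x i y)) → ∀ z, p (update x i z)) : ∀ x, p x := by
  have key : ∀ (s : Finset ι) (x : ι → M), (∀ i, i ∉ s → x i ∈ S) → p x := by
    intro s
    induction s using Finset.induction_on with
    | empty => intro x hx; exact base x fun i => hx i (by simp)
    | insert a s ha ih =>
      intro x hx
      have := step x a (fun y hy => ih _ fun i hi => ?_) (x a)
      · simpa using this
      · by_cases h : i = a
        · subst h; simpa using hy
        · rw [update_of_ne h]; exact hx i (by simp [h, hi])
  intro x
  exact key Finset.univ x (by simp)

/-! ### The algebras `A_Ω` -/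

namespace NambuPoisson

section Poly
open MvPolynomial
variable {k : Type u} [Field k] {m : ℕ}

/-- The Jacobian determinant `det (∂ f_i / ∂ t_j)` of `m` polynomials in `m` variables. -/
noncomputable def jacobianDet (k : Type u) [Field k] (m : ℕ) :
    MvPolynomial (Fin m) k [⋀^Fin m]→ₗ[k] MvPolynomial (Fin m) k where
  toFun f := (Matrix.of fun i j => pderiv j (f i)).det
  map_update_add' {inst} f i x y := by
    obtain rfl : inst = instDecidableEqFin m := Subsingleton.elim _ _
    have h : ∀ z, (Matrix.of fun a j => pderiv j (update f i z a)) =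
        Matrix.updateRow (Matrix.of fun a j => pderiv j (f a)) i (fun j => pderiv j z) := by
      intro z; ext1 a j
      by_cases h : a = i
      · subst h; simp
      · simp [h]
    rw [h, h, h, ← Matrix.det_updateRow_add]
    congr 2; ext1 j; simp
  map_update_smul' {inst} f i c x := by
    obtain rfl : inst = instDecidableEqFin m := Subsingleton.elim _ _
    have h : ∀ z, (Matrix.of fun a j => pderiv j (update f i z a)) =
        Matrix.updateRow (Matrix.of fun a j => pderiv j (f a)) i (fun j => pderiv j z) := by
      intro z; ext1 a j
      by_cases h : a = i
      · subst h; simp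
      · simp [h]
    have h' : (fun j => pderiv j (c • x)) = (C c : MvPolynomial (Fin m) k) • fun j => pderiv j x := by
      ext1 j; simp [MvPolynomial.smul_eq_C_mul]
    rw [h, h, h', Matrix.det_updateRow_smul, MvPolynomial.smul_eq_C_mul]
  map_eq_zero_of_eq' f i j hij hne := by
    refine Matrix.det_zero_of_row_eq hne ?_
    ext1 l; simp [hij]

theorem jacobianDet_update (f : Fin m → MvPolynomial (Fin m) k) (i : Fin m) (z) :
    jacobianDet k m (update f i z) = 
      (Matrix.updateRow (Matrix.of fun a j => pderiv j (f a)) i (fun j => pderiv j z)).det := by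
  change Matrix.det _ = _
  congr 1
  ext1 a j
  by_cases h : a = i
  · subst h; simp
  · simp [h]

theorem det_updateRow_adj {R : Type*} [CommRing R] (M : Matrix (Fin m) (Fin m) R) (s : Fin m)
    (r : Fin m → R) : (M.updateRow s r).det = ∑ j, r j * M.adjugate j s := by
  rw [Matrix.det_eq_sum_mul_adjugate_row _ s]
  refine Finset.sum_congr rfl fun j _ => ?_
  simp [Matrix.adjugate_apply]

theorem jacobianDet_leibniz (f : Fin m → MvPolynomial (Fin m) k) (i : Fin m) (a b) :
    jacobianDet k m (update f i (a * b)) =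
      a * jacobianDet k m (update f i b) + b * jacobianDet k m (update f i a) := by
  simp only [jacobianDet_update, det_updateRow_adj, Finset.mul_sum, ← Finset.sum_add_distrib]
  refine Finset.sum_congr rfl fun j _ => ?_
  simp; ring

theorem derivation_det {R : Type*} [CommRing R] [Algebra k R] (D : Derivation k R R)
    (M : Matrix (Fin m) (Fin m) R) :
    D M.det = ∑ s, (M.updateRow s (fun j => D (M s j))).det := by
  have hp : ∀ (s : Finset (Fin m)) (g : Fin m → R),
      D (∏ i ∈ s, g i) = ∑ i ∈ s, ∏ j ∈ s, update g i (D (g i)) j := by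
    intro s g
    induction s using Finset.induction_on with
    | empty => simp
    | insert a s ha ih =>
      rw [Finset.prod_insert ha, Derivation.leibniz, ih, Finset.sum_insert ha,
        Finset.prod_insert ha, smul_eq_mul, smul_eq_mul, Finset.mul_sum, add_comm]
      congr 1
      · rw [update_self, mul_comm]; congr 1
        exact Finset.prod_congr rfl fun j hj => by
          rw [update_of_ne]; rintro rfl; exact ha hj
      · refine Finset.sum_congr rfl fun i hi => ?_
        rw [Finset.prod_insert ha, update_of_ne]
        rintro rfl; exact ha hi
  rw [← Matrix.det_transpose, Matrix.det_apply, map_sum]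
  simp_rw [← Matrix.det_transpose (Matrix.updateRow _ _ _), Matrix.det_apply]
  rw [Finset.sum_comm]
  refine Finset.sum_congr rfl fun σ _ => ?_
  rw [← Finset.smul_sum, Units.smul_def, Units.smul_def, map_zsmul, hp]
  congr 1
  refine Finset.sum_congr rfl fun s _ => Finset.prod_congr rfl fun j _ => ?_
  simp only [Matrix.transpose_apply]
  by_cases h : j = s
  · subst h; simp
  · simp [h]
  
theorem jacobianDet_chain (f : Fin m → MvPolynomial (Fin m) k) (s : Fin m) (z) :
    jacobianDet k m (update f s z) = ∑ l, pderiv l z * jacobianDet k m (update f s (X l)) := by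
  simp only [jacobianDet_update, det_updateRow_adj]
  refine Finset.sum_congr rfl fun l _ => ?_
  simp [pderiv_X, Pi.single_apply]

theorem derivation_sum_apply {R : Type*} [CommRing R] [Algebra k R] {ι : Type*} (s : Finset ι)
    (D : ι → Derivation k R R) (x : R) : (∑ i ∈ s, D i) x = ∑ i ∈ s, D i x := by
  rw [← Derivation.coeFnAddMonoidHom_apply, map_sum, Finset.sum_apply]
  rfl

theorem derivation_jacobianDet (D : Derivation k (MvPolynomial (Fin m) k) (MvPolynomial (Fin m) k))
    (f : Fin m → MvPolynomial (Fin m) k) :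
    D (jacobianDet k m f) = (∑ s, jacobianDet k m (update f s (D (f s)))) -
      (∑ j, pderiv j (D (X j))) * jacobianDet k m f := by
  set M : Matrix (Fin m) (Fin m) (MvPolynomial (Fin m) k) := Matrix.of fun i j => pderiv j (f i)
    with hM
  let E : Matrix (Fin m) (Fin m) (MvPolynomial (Fin m) k) :=
    Matrix.of fun l j => pderiv j (D (X l))
  have hD : ∀ g, D g = ∑ l, pderiv l g * D (X l) := by
    intro g
    have : D = ∑ l, D (X l) • pderiv l := by
      refine derivation_ext fun i => ?_
      simp [derivation_sum_apply, pderiv_X, Pi.single_apply]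
    conv_lhs => rw [this]
    simp [derivation_sum_apply, mul_comm]
  have hc : ∀ (j : Fin m) g, D (pderiv j g) = pderiv j (D g) - ∑ l, pderiv l g * pderiv j (D (X l)) := by
    intro j g
    have := Derivation.congr_fun (D1 := ⁅D, pderiv j⁆) (D2 := - ∑ l, pderiv j (D (X l)) • pderiv l) ?_ g
    · rw [Derivation.commutator_apply] at this
      rw [sub_eq_iff_eq_add.mp this]
      simp [derivation_sum_apply, mul_comm, sub_eq_add_neg, add_comm]
    · refine derivation_ext fun i => ?_
      rw [Derivation.commutator_apply]
      simp [derivation_sum_apply, pderiv_X, Pi.single_apply]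
      split_ifs <;> simp
  have hJ : jacobianDet k m f = M.det := rfl
  have hrow : ∀ s, (M.updateRow s (fun j => D (M s j))).det =
      jacobianDet k m (update f s (D (f s))) - ∑ j, (M * E) s j * M.adjugate j s := by
    intro s
    rw [jacobianDet_update, ← hM, det_updateRow_adj, det_updateRow_adj, ← Finset.sum_sub_distrib]
    refine Finset.sum_congr rfl fun j _ => ?_
    rw [← sub_mul, hM, Matrix.of_apply, hc, Matrix.mul_apply]
    rfl
  rw [hJ, derivation_det]
  simp_rw [hrow]
  rw [Finset.sum_sub_distrib]
  congr 1
  have : ∑ s, ∑ j, (M * E) s j * M.adjugate j s = Matrix.trace ((M * E) * M.adjugate) := by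
    simp [Matrix.trace, Matrix.mul_apply (M := M * E)]
  rw [this, Matrix.mul_assoc, Matrix.trace_mul_comm, Matrix.mul_assoc, Matrix.adjugate_mul,
    Matrix.mul_smul, Matrix.mul_one, Matrix.trace_smul, smul_eq_mul, mul_comm]
  rfl

theorem jacobianDet_div [CharZero k] (g : Fin m → MvPolynomial (Fin m) k) (i : Fin m) :
    ∑ j, pderiv j (jacobianDet k m (update g i (X j))) = 0 := by
  have h1 : ∀ j, pderiv j (jacobianDet k m (update g i (X j))) =
      ∑ s ∈ Finset.univ.erase i, ∑ l, pderiv l (pderiv j (g s)) *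
        jacobianDet k m (update (update g i (X j)) s (X l)) := by
    intro j
    rw [derivation_jacobianDet]
    have : ∑ l, pderiv l (pderiv j (X l : MvPolynomial (Fin m) k)) = 0 := by
      refine Finset.sum_eq_zero fun l _ => ?_
      rw [pderiv_X, Pi.single_apply]; split_ifs <;> simp
    rw [this, zero_mul, sub_zero, ← Finset.add_sum_erase _ _ (Finset.mem_univ i)]
    rw [jacobianDet_chain _ i]
    have h0 : ∑ l, pderiv l (pderiv j (update g i (X j) i)) *
        jacobianDet k m (update (update g i (X j)) i (X l)) = 0 := by
      refine Finset.sum_eq_zero fun l _ => ?_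
      simp
    rw [h0, zero_add]
    refine Finset.sum_congr rfl fun s hs => ?_
    rw [jacobianDet_chain, update_of_ne (Finset.ne_of_mem_erase hs)]
  simp_rw [h1]
  rw [Finset.sum_comm]
  refine Finset.sum_eq_zero fun s hs => ?_
  have hsi : s ≠ i := Finset.ne_of_mem_erase hs
  set T := ∑ x, ∑ l, (pderiv l) ((pderiv x) (g s)) *
    (jacobianDet k m) (update (update g i (X x)) s (X l)) with hT
  have hsym : T = -T := by
    conv_lhs => rw [hT, Finset.sum_comm]
    rw [hT, ← Finset.sum_neg_distrib]
    refine Finset.sum_congr rfl fun a _ => ?_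
    rw [← Finset.sum_neg_distrib]
    refine Finset.sum_congr rfl fun b _ => ?_
    have hswap : update (update g i (X b)) s (X a) =
        (update (update g i (X a)) s (X b)) ∘ Equiv.swap i s := by
      ext1 c
      by_cases h1 : c = i
      · subst h1; simp [hsi.symm]
      · by_cases h2 : c = s
        · subst h2; simp [hsi.symm]
        · simp [h1, h2, Equiv.swap_apply_of_ne_of_ne h1 h2]
    have hcomm : pderiv a (pderiv b (g s)) = pderiv b (pderiv a (g s)) := by
      have := Derivation.congr_fun (D1 := ⁅pderiv (R := k) a, pderiv b⁆) (D2 := 0) ?_ (g s)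
      · rwa [Derivation.commutator_apply, Derivation.zero_apply, sub_eq_zero] at this
      · refine derivation_ext fun j => ?_
        rw [Derivation.commutator_apply]
        simp only [pderiv_X, Pi.single_apply]
        split_ifs <;> simp
    rw [hswap, AlternatingMap.map_swap _ _ hsi.symm, hcomm, mul_neg]
  exact self_eq_neg.mp hsym

/-- The algebra `A_Ω`: the polynomial ring `k[t_1, …, t_{n+1}]`, to be equipped with the
Nambu-Poisson bracket of the potential `Ω`. -/
def NambuPoly {n : ℕ} (_Ω : MvPolynomial (Fin (n + 1)) k) : Type u := MvPolynomial (Fin (n + 1)) k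

section
variable {n : ℕ} (Ω : MvPolynomial (Fin (n + 1)) k)

noncomputable instance : CommRing (NambuPoly Ω) :=
  inferInstanceAs (CommRing (MvPolynomial (Fin (n + 1)) k))
noncomputable instance : Algebra k (NambuPoly Ω) :=
  inferInstanceAs (Algebra k (MvPolynomial (Fin (n + 1)) k))

theorem snoc_update' {M : Type*} (v : Fin n → M) (w : M) (i : Fin n) (x : M) :
    (Fin.snoc (update v i x) w : Fin (n + 1) → M) =
      update (Fin.snoc v w : Fin (n + 1) → M) i.castSucc x := by
  ext1 j
  refine Fin.lastCases ?_ (fun j => ?_) j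
  · rw [update_of_ne (Fin.castSucc_lt_last i).ne']; simp
  · by_cases h : j = i
    · subst h; simp
    · rw [update_of_ne (by simpa using h)]; simp [h]

/-- The bracket of `A_Ω`: `{f_1, …, f_n}` is the Jacobian determinant of `(f_1, …, f_n, Ω)`. -/
noncomputable def nambuPolyBracket :
    MvPolynomial (Fin (n + 1)) k [⋀^Fin n]→ₗ[k] MvPolynomial (Fin (n + 1)) k where
  toFun f := jacobianDet k (n + 1) (Fin.snoc f Ω)
  map_update_add' {inst} f i x y := by
    obtain rfl : inst = instDecidableEqFin n := Subsingleton.elim _ _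
    simp
  map_update_smul' {inst} f i c x := by
    obtain rfl : inst = instDecidableEqFin n := Subsingleton.elim _ _
    simp
  map_eq_zero_of_eq' f i j hij hne :=
    (jacobianDet k (n + 1)).map_eq_zero_of_eq _ (i := i.castSucc) (j := j.castSucc)
      (by simpa using hij) (by simpa using hne)

theorem nambuPolyBracket_apply (f) :
  nambuPolyBracket Ω f = jacobianDet k (n + 1) (Fin.snoc f Ω) := rfl

theorem nambuPolyBracket_leibniz (v : Fin n → MvPolynomial (Fin (n + 1)) k) (i : Fin n) (a b) :
    nambuPolyBracket Ω (update v i (a * b)) =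
      a * nambuPolyBracket Ω (update v i b) + b * nambuPolyBracket Ω (update v i a) := by
  simp only [nambuPolyBracket_apply, snoc_update', jacobianDet_leibniz]

theorem nambuPolyBracket_jacobi [CharZero k] (u v : Fin n → MvPolynomial (Fin (n + 1)) k)
    (i : Fin n) : nambuPolyBracket Ω (update v i (nambuPolyBracket Ω u)) =
      ∑ s, nambuPolyBracket Ω (update u s (nambuPolyBracket Ω (update v i (u s)))) := by
  let D : Derivation k (MvPolynomial (Fin (n + 1)) k) (MvPolynomial (Fin (n + 1)) k) :=
    Derivation.mk' ((nambuPolyBracket Ω).toMultilinearMap.toLinearMap v i) fun a b => by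
      simpa using nambuPolyBracket_leibniz Ω v i a b
  have hD : ∀ x, D x = nambuPolyBracket Ω (update v i x) := fun x => rfl
  have hΩ : D Ω = 0 := by
    rw [hD, nambuPolyBracket_apply]
    exact (jacobianDet k (n + 1)).map_eq_zero_of_eq _ (i := i.castSucc) (j := Fin.last n)
      (by simp) (Fin.castSucc_lt_last i).ne
  have hdiv : ∑ j, pderiv j (D (X j)) = 0 := by
    simp only [hD, nambuPolyBracket_apply, snoc_update']
    exact jacobianDet_div _ _
  rw [← hD, nambuPolyBracket_apply, derivation_jacobianDet, hdiv, zero_mul, sub_zero,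
    Fin.sum_univ_castSucc]
  have hl : jacobianDet k (n + 1) (update (Fin.snoc u Ω : Fin (n + 1) → _) (Fin.last n)
      (D ((Fin.snoc u Ω : Fin (n + 1) → MvPolynomial (Fin (n + 1)) k) (Fin.last n)))) = 0 := by
    rw [Fin.snoc_last, hΩ]
    exact (jacobianDet k (n + 1)).map_coord_zero (Fin.last n) (by simp)
  rw [hl, add_zero]
  refine Finset.sum_congr rfl fun s _ => ?_
  rw [nambuPolyBracket_apply, snoc_update', Fin.snoc_castSucc, hD]

noncomputable instance [CharZero k] : NambuPoisson k n (NambuPoly Ω) where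
  bracket := nambuPolyBracket Ω
  leibniz := nambuPolyBracket_leibniz Ω
  jacobi := nambuPolyBracket_jacobi Ω
end
end Poly

end NambuPoisson

/-! ### Quotients by Nambu-Poisson ideals and the algebras `P_{Ω-ξ}` -/

namespace NambuPoisson

section Quot
variable {k : Type u} [Field k] {n : ℕ} {A : Type*} [CommRing A] [Algebra k A]

/-- `I` is a Nambu-Poisson ideal: `{I, A, …, A} ⊆ I`. -/
def IsIdeal (k : Type u) [Field k] (n : ℕ) {A : Type*} [CommRing A] [Algebra k A]
    [NambuPoisson k n A] (I : Ideal A) : Prop :=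
  ∀ (v : Fin n → A) (i : Fin n), v i ∈ I → bracket (k := k) v ∈ I

theorem quot_congr {R ι : Type*} [CommRing R] [Fintype ι] [DecidableEq ι] {M : ι → Type*} {N : Type*}
    [∀ i, AddCommGroup (M i)] [∀ i, Module R (M i)] [AddCommGroup N] [Module R N]
    (f : MultilinearMap R M N) (p : ∀ i, Submodule R (M i))
    (q : Submodule R N) (hf : ∀ v i, v i ∈ p i → f v ∈ q) (v w : ∀ i, M i)
    (h : ∀ i, v i - w i ∈ p i) : f v - f w ∈ q := by
  have key : ∀ s : Finset ι, f (s.piecewise w v) - f v ∈ q := by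
    intro s
    induction s using Finset.induction_on with
    | empty => simp
    | insert a s ha ih =>
      have e : f ((insert a s).piecewise w v) =
          f (s.piecewise w v) - f (update (s.piecewise w v) a (v a - w a)) := by
        rw [Finset.piecewise_insert, f.map_update_sub]
        have : update (s.piecewise w v) a (v a) = s.piecewise w v := by
          rw [update_eq_self_iff]; simp [ha]
        rw [this]; abel
      rw [e, sub_right_comm]
      exact q.sub_mem ih (hf _ a (by simpa using h a))
  have := q.neg_mem (key Finset.univ)
  simpa using this

/-- The multilinear map induced on quotients. -/
noncomputable def quotMap {R ι : Type*} [CommRing R] [Fintype ι] [hdec : DecidableEq ι]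
    {M : ι → Type*} {N : Type*}
    [∀ i, AddCommGroup (M i)] [∀ i, Module R (M i)] [AddCommGroup N] [Module R N]
    (f : MultilinearMap R M N) (p : ∀ i, Submodule R (M i))
    (q : Submodule R N) (hf : ∀ v i, v i ∈ p i → f v ∈ q) :
    MultilinearMap R (fun i => M i ⧸ p i) (N ⧸ q) :=
  have key : ∀ (v : ∀ i, M i) (x : ∀ i, M i ⧸ p i) (_ : ∀ i, Submodule.Quotient.mk (v i) = x i),
      (Submodule.Quotient.mk (f fun i => (x i).out) : N ⧸ q) = Submodule.Quotient.mk (f v) := by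
    intro v x h
    rw [Submodule.Quotient.eq]
    refine quot_congr f p q hf _ _ fun i => ?_
    rw [← Submodule.Quotient.eq, h]
    exact Quotient.out_eq _
  have hupd : ∀ (x : ∀ i, M i ⧸ p i) (i : ι) (y : M i) (j : ι),
      (Submodule.Quotient.mk (update (fun i => (x i).out) i y j) : M j ⧸ p j) =
        update x i (Submodule.Quotient.mk y) j := by
    intro x i y j
    by_cases h : j = i
    · subst h; simp
    · simp only [update_of_ne h]; exact Quotient.out_eq _
  { toFun := fun x => Submodule.Quotient.mk (f fun i => (x i).out)
    map_update_add' := by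
      intro inst x i a b
      obtain rfl : inst = hdec := Subsingleton.elim _ _
      obtain ⟨a, rfl⟩ := Submodule.Quotient.mk_surjective _ a
      obtain ⟨b, rfl⟩ := Submodule.Quotient.mk_surjective _ b
      rw [← Submodule.Quotient.mk_add, key _ _ (hupd x i a), key _ _ (hupd x i b),
        key _ _ (hupd x i (a + b)), f.map_update_add, Submodule.Quotient.mk_add]
    map_update_smul' := by
      intro inst x i c a
      obtain rfl : inst = hdec := Subsingleton.elim _ _
      obtain ⟨a, rfl⟩ := Submodule.Quotient.mk_surjective _ a
      rw [← Submodule.Quotient.mk_smul, key _ _ (hupd x i a),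
        key _ _ (hupd x i (c • a)), f.map_update_smul, Submodule.Quotient.mk_smul] }

theorem quotMap_mk {R ι : Type*} [CommRing R] [Fintype ι] [DecidableEq ι]
    {M : ι → Type*} {N : Type*}
    [∀ i, AddCommGroup (M i)] [∀ i, Module R (M i)] [AddCommGroup N] [Module R N]
    (f : MultilinearMap R M N) (p : ∀ i, Submodule R (M i))
    (q : Submodule R N) (hf : ∀ v i, v i ∈ p i → f v ∈ q) (v : ∀ i, M i) :
    quotMap f p q hf (fun i => Submodule.Quotient.mk (v i)) = Submodule.Quotient.mk (f v) := by
  change Submodule.Quotient.mk (f _) = _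
  rw [Submodule.Quotient.eq]
  refine quot_congr f p q hf _ _ fun i => ?_
  rw [← Submodule.Quotient.eq]
  exact Quotient.out_eq _

variable [NambuPoisson k n A] (I : Ideal A) (hI : IsIdeal k n I)

/-- The bracket of `A ⧸ I`. -/
noncomputable def quotBracket : (A ⧸ I) [⋀^Fin n]→ₗ[k] (A ⧸ I) where
  toMultilinearMap := quotMap (bracket (k := k) (n := n) (A := A)).toMultilinearMap
    (fun _ => I.restrictScalars k) (I.restrictScalars k) hI
  map_eq_zero_of_eq' v i j hij hne := by
    change (Submodule.Quotient.mk (bracket (k := k) fun i => (v i).out) : A ⧸ I) = 0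
    rw [AlternatingMap.map_eq_zero_of_eq _ _ (i := i) (j := j) (by simp only [hij]) hne]
    rfl

theorem quotBracket_mk (v : Fin n → A) :
    quotBracket I hI (fun i => Ideal.Quotient.mk I (v i)) = Ideal.Quotient.mk I (bracket (k := k) v) :=
  quotMap_mk (bracket (k := k) (n := n) (A := A)).toMultilinearMap
    (fun _ => I.restrictScalars k) (I.restrictScalars k) hI v

theorem quotBracket_update (v : Fin n → A) (i : Fin n) (a : A) :
    quotBracket I hI (update (fun i => Ideal.Quotient.mk I (v i)) i (Ideal.Quotient.mk I a)) =
      Ideal.Quotient.mk I (bracket (k := k) (update v i a)) := by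
  rw [← quotBracket_mk I hI]
  congr 1
  ext1 j
  by_cases h : j = i
  · subst h; simp
  · simp [h]

/-- The quotient of a Nambu-Poisson algebra by a Nambu-Poisson ideal. -/
noncomputable abbrev quotient : NambuPoisson k n (A ⧸ I) where
  bracket := quotBracket I hI
  leibniz v i a b := by
    obtain ⟨v, rfl⟩ : ∃ v' : Fin n → A, v = fun i => Ideal.Quotient.mk I (v' i) :=
      ⟨fun i => (v i).out, funext fun i => (Quotient.out_eq _).symm⟩
    obtain ⟨a, rfl⟩ := Ideal.Quotient.mk_surjective a
    obtain ⟨b, rfl⟩ := Ideal.Quotient.mk_surjective b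
    simp only [← map_mul, ← map_add, quotBracket_update, leibniz]
  jacobi u v i := by
    obtain ⟨v, rfl⟩ : ∃ v' : Fin n → A, v = fun i => Ideal.Quotient.mk I (v' i) :=
      ⟨fun i => (v i).out, funext fun i => (Quotient.out_eq _).symm⟩
    obtain ⟨u, rfl⟩ : ∃ v' : Fin n → A, u = fun i => Ideal.Quotient.mk I (v' i) :=
      ⟨fun i => (u i).out, funext fun i => (Quotient.out_eq _).symm⟩
    simp only [quotBracket_mk, quotBracket_update]
    rw [jacobi, map_sum]

end Quot

section
open MvPolynomial
variable {k : Type u} [Field k] {n : ℕ} (Ω : MvPolynomial (Fin (n + 1)) k) (ξ : k)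

/-- The ideal `(Ω - ξ)` of `A_Ω`. -/
noncomputable def nambuIdeal : Ideal (NambuPoly Ω) :=
  Ideal.span {(Ω - C ξ : MvPolynomial (Fin (n + 1)) k)}

theorem nambuPolyBracket_sub_C (v : Fin n → MvPolynomial (Fin (n + 1)) k) (i : Fin n) :
    nambuPolyBracket Ω (update v i (Ω - C ξ)) = 0 := by
  rw [nambuPolyBracket_apply, snoc_update', jacobianDet_update]
  refine Matrix.det_zero_of_row_eq (i := i.castSucc) (j := Fin.last n)
    (Fin.castSucc_lt_last i).ne ?_
  rw [Matrix.updateRow_self, Matrix.updateRow_ne (Fin.castSucc_lt_last i).ne']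
  ext1 j
  simp

variable [CharZero k]

theorem nambuIdeal_isIdeal : IsIdeal k n (nambuIdeal Ω ξ) := by
  intro v i hi
  obtain ⟨c, hc⟩ := Ideal.mem_span_singleton'.mp hi
  have h := leibniz (k := k) v i c (Ω - C ξ : MvPolynomial (Fin (n + 1)) k)
  rw [hc, update_eq_self] at h
  have h0 : bracket (k := k) (A := NambuPoly Ω)
      (update v i (Ω - C ξ : MvPolynomial (Fin (n + 1)) k)) = 0 := by
    exact nambuPolyBracket_sub_C Ω ξ v i
  rw [h, h0, mul_zero, zero_add]
  exact Ideal.mul_mem_right _ _ (Ideal.mem_span_singleton_self _)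

/-- The Nambu-Poisson algebra `P_{Ω-ξ} = A_Ω / (Ω - ξ)`. -/
abbrev NambuHyp : Type u := NambuPoly Ω ⧸ nambuIdeal Ω ξ

noncomputable instance : NambuPoisson k n (NambuHyp Ω ξ) :=
  quotient _ (nambuIdeal_isIdeal Ω ξ)
end

end NambuPoisson

/-! ### The Nambu-Poisson fraction field

The bracket of a domain `A` extends uniquely to `K = Q(A)`. It is obtained by extending the bracket
`K`-multilinearly to the free `K`-module on the symbols `d a` (`a ∈ A`), dividing by the radical of
the resulting form, and extending `d` to `K` by the quotient rule. -/

namespace NambuPoisson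

section Frac

theorem slot_identity {k : Type u} [Field k] {n : ℕ} {A : Type*} [CommRing A] [Algebra k A]
    [NambuPoisson k n A] (u v : Fin n → A) (i j : Fin n) (hij : j ≠ i) (c d : A) :
    ∑ s, (bracket (k := k) (update (update v j d) i (u s)) * bracket (k := k) (update u s c) +
      bracket (k := k) (update (update v j c) i (u s)) * bracket (k := k) (update u s d)) = 0 := by
  have h := jacobi (k := k) u (update v j (c * d)) i
  have e : ∀ x, bracket (k := k) (update (update v j (c * d)) i x) =
      c * bracket (k := k) (update (update v j d) i x) +
        d * bracket (k := k) (update (update v j c) i x) := by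
    intro x
    simp only [update_comm hij, leibniz]
  simp only [e, AlternatingMap.map_update_add, leibniz] at h
  rw [jacobi, jacobi, Finset.mul_sum, Finset.mul_sum, ← Finset.sum_add_distrib, ← sub_eq_zero,
    ← Finset.sum_sub_distrib, ← neg_eq_zero, ← Finset.sum_neg_distrib] at h
  rw [← h]
  refine Finset.sum_congr rfl fun s _ => ?_
  ring

/-- `g` is additive and satisfies the Leibniz rule. -/
def IsDer {K : Type*} [CommRing K] (g : K → K) : Prop :=
  (∀ x y, g (x + y) = g x + g y) ∧ ∀ x y, g (x * y) = x * g y + y * g x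

namespace IsDer
variable {K : Type*} [CommRing K] {g h : K → K}

theorem add (hg : IsDer g) (hh : IsDer h) : IsDer fun x => g x + h x :=
  ⟨fun x y => by simp only [hg.1, hh.1]; ring, fun x y => by simp only [hg.2, hh.2]; ring⟩

theorem sub (hg : IsDer g) (hh : IsDer h) : IsDer fun x => g x - h x :=
  ⟨fun x y => by simp only [hg.1, hh.1]; ring, fun x y => by simp only [hg.2, hh.2]; ring⟩

theorem mul_const (hg : IsDer g) (c : K) : IsDer fun x => g x * c :=
  ⟨fun x y => by simp only [hg.1]; ring, fun x y => by simp only [hg.2]; ring⟩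

theorem const_mul (hg : IsDer g) (c : K) : IsDer fun x => c * g x :=
  ⟨fun x y => by simp only [hg.1]; ring, fun x y => by simp only [hg.2]; ring⟩

theorem comm (hg : IsDer g) (hh : IsDer h) : IsDer fun x => g (h x) - h (g x) :=
  ⟨fun x y => by simp only [hg.1, hh.1]; ring,
    fun x y => by simp only [hg.1, hh.1, hg.2, hh.2]; ring⟩

theorem sum {ι : Type*} (s : Finset ι) {g : ι → K → K} (hg : ∀ i ∈ s, IsDer (g i)) :
    IsDer fun x => ∑ i ∈ s, g i x := by
  refine ⟨fun x y => ?_, fun x y => ?_⟩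
  · rw [← Finset.sum_add_distrib]
    exact Finset.sum_congr rfl fun i hi => (hg i hi).1 x y
  · rw [Finset.mul_sum, Finset.mul_sum, ← Finset.sum_add_distrib]
    exact Finset.sum_congr rfl fun i hi => (hg i hi).2 x y

theorem eq_zero {A K : Type*} [CommRing A] [IsDomain A] [Field K] [Algebra A K] [IsFractionRing A K]
    {g : K → K} (hg : IsDer g) (h0 : ∀ a : A, g (algebraMap A K a) = 0) (x : K) : g x = 0 := by
  obtain ⟨a, s, hs, rfl⟩ := IsFractionRing.div_surjective (A := A) x
  have hs' : algebraMap A K s ≠ 0 := IsFractionRing.to_map_ne_zero_of_mem_nonZeroDivisors hs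
  have := hg.2 (algebraMap A K a / algebraMap A K s) (algebraMap A K s)
  rw [div_mul_cancel₀ _ hs', h0, h0, mul_zero, zero_add] at this
  exact (mul_eq_zero.mp this.symm).resolve_left hs'

end IsDer

variable {k : Type u} [Field k] {n : ℕ} {A : Type*} [CommRing A] [Algebra k A]
  [NambuPoisson k n A] (K : Type*) [Field K] [Algebra A K]

variable (k n A) in
open scoped Classical in
/-- The `K`-multilinear extension of the bracket of `A` to the free `K`-module on `A`. -/
noncomputable def freeBracket : MultilinearMap K (fun _ : Fin n => Π₀ _ : A, K) K :=
  MultilinearMap.fromDFinsuppEquiv (fun _ : Fin n => A) K fun p =>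
    MultilinearMap.mkPiRing K (Fin n) (algebraMap A K (bracket (k := k) p))

open scoped Classical in
theorem freeBracket_single (p : Fin n → A) (x : Fin n → K) :
    freeBracket k n A K (fun i => DFinsupp.single (p i) (x i)) =
      (∏ i, x i) * algebraMap A K (bracket (k := k) p) := by
  rw [freeBracket, MultilinearMap.fromDFinsuppEquiv_single]
  simp

open scoped Classical in
theorem freeBracket_update_single (p : Fin n → A) (i : Fin n) (a : A) (c : K) :
    freeBracket k n A K (update (fun i => DFinsupp.single (p i) (1 : K)) i (DFinsupp.single a c)) =
      c * algebraMap A K (bracket (k := k) (update p i a)) := by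
  have : (update (fun i => DFinsupp.single (p i) (1 : K)) i (DFinsupp.single a c)) =
      fun j => (DFinsupp.single (update p i a j) (update (fun _ => (1 : K)) i c j) :
        Π₀ _ : A, K) := by
    ext1 j
    by_cases h : j = i
    · subst h; simp
    · simp [h]
  rw [this, freeBracket_single, Finset.prod_update_of_mem (Finset.mem_univ i)]
  simp

variable (k n A) in
/-- The vectors on which `freeBracket` vanishes, in whatever slot they are put. -/
noncomputable def freeRadical : Submodule K (Π₀ _ : A, K) :=
  ⨅ (i : Fin n) (w : Fin n → Π₀ _ : A, K), LinearMap.ker ((freeBracket k n A K).toLinearMap w i)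

theorem mem_freeRadical {l : Π₀ _ : A, K} : l ∈ freeRadical k n A K ↔
    ∀ (i : Fin n) (w : Fin n → Π₀ _ : A, K), freeBracket k n A K (update w i l) = 0 := by
  simp [freeRadical, Submodule.mem_iInf]

open scoped Classical in
theorem mem_freeRadical_of {l : Π₀ _ : A, K} (h : ∀ (i : Fin n) (p : Fin n → A),
    freeBracket k n A K (update (fun j => DFinsupp.single (p j) (1 : K)) i l) = 0) :
    l ∈ freeRadical k n A K := by
  rw [mem_freeRadical]
  intro i
  refine slotwise _ (Set.range fun a => (DFinsupp.single a (1 : K) : Π₀ _ : A, K)) ?_ ?_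
  · intro x hx
    choose p hp using hx
    obtain rfl : (fun j => DFinsupp.single (p j) (1 : K)) = x := funext hp
    exact h i p
  · intro w j hw z
    by_cases hij : j = i
    · subst hij
      simpa using hw _ ⟨0, rfl⟩
    · have hs : ∀ a, freeBracket k n A K (update (update w i l) j (DFinsupp.single a (1 : K))) = 0 := by
        intro a
        rw [update_comm (Ne.symm hij)]
        exact hw _ ⟨a, rfl⟩
      rw [update_comm hij]
      induction z using DFinsupp.induction with
      | h0 => exact (freeBracket k n A K).map_coord_zero j (by simp)
      | ha a b f _ _ ih =>
        have : (DFinsupp.single a b : Π₀ _ : A, K) = b • DFinsupp.single a (1 : K) := by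
          rw [← DFinsupp.single_smul]; simp
        rw [MultilinearMap.map_update_add, ih, this, MultilinearMap.map_update_smul, hs]
        simp

variable (k n A) in
/-- The class `d a` of the basis vector of `a ∈ A` modulo the radical. -/
noncomputable def freeD (a : A) : (Π₀ _ : A, K) ⧸ freeRadical k n A K :=
  haveI := Classical.decEq A
  Submodule.Quotient.mk (DFinsupp.single a 1)

theorem freeD_add (a b : A) : freeD k n A K (a + b) = freeD k n A K a + freeD k n A K b := by
  classical
  have : DFinsupp.single (a + b) (1 : K) - (DFinsupp.single a (1 : K) + DFinsupp.single b (1 : K)) ∈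
      freeRadical k n A K := by
    refine mem_freeRadical_of K fun i p => ?_
    rw [MultilinearMap.map_update_sub, MultilinearMap.map_update_add]
    simp only [freeBracket_update_single, AlternatingMap.map_update_add, map_add]
    ring
  rw [← Submodule.Quotient.eq] at this
  rw [freeD, freeD, freeD, ← Submodule.Quotient.mk_add]
  convert this

theorem freeD_mul (a b : A) : freeD k n A K (a * b) =
    algebraMap A K a • freeD k n A K b + algebraMap A K b • freeD k n A K a := by
  classical
  have : DFinsupp.single (a * b) (1 : K) - (algebraMap A K a • DFinsupp.single b (1 : K) +
      algebraMap A K b • DFinsupp.single a (1 : K)) ∈ freeRadical k n A K := by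
    refine mem_freeRadical_of K fun i p => ?_
    rw [MultilinearMap.map_update_sub, MultilinearMap.map_update_add,
      MultilinearMap.map_update_smul, MultilinearMap.map_update_smul]
    simp only [freeBracket_update_single, leibniz, map_add, map_mul, smul_eq_mul]
    ring
  rw [← Submodule.Quotient.eq] at this
  rw [freeD, freeD, freeD, ← Submodule.Quotient.mk_smul, ← Submodule.Quotient.mk_smul,
    ← Submodule.Quotient.mk_add]
  convert this

variable [Algebra k K] [IsScalarTower k A K]

theorem freeD_smul (c : k) (a : A) : freeD k n A K (c • a) = algebraMap k K c • freeD k n A K a := by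
  classical
  have : DFinsupp.single (c • a) (1 : K) - algebraMap k K c • DFinsupp.single a (1 : K) ∈
      freeRadical k n A K := by
    refine mem_freeRadical_of K fun i p => ?_
    rw [MultilinearMap.map_update_sub, MultilinearMap.map_update_smul]
    simp only [freeBracket_update_single, AlternatingMap.map_update_smul, smul_eq_mul]
    rw [Algebra.smul_def, map_mul, ← IsScalarTower.algebraMap_apply]
    ring
  rw [← Submodule.Quotient.eq] at this
  rw [freeD, freeD, ← Submodule.Quotient.mk_smul]
  convert this

variable [IsDomain A] [IsFractionRing A K]

/-- The extension of `d` to `K` by the quotient rule: `d (a / s) = (d a - (a / s) d s) / s`. -/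
noncomputable def fracD (x : K) : (Π₀ _ : A, K) ⧸ freeRadical k n A K :=
  let y := IsLocalization.sec (nonZeroDivisors A) x
  (algebraMap A K y.2)⁻¹ • (freeD k n A K y.1 - x • freeD k n A K (y.2 : A))

theorem fracD_spec (x : K) (a s : A) (hs : s ≠ 0) (h : x * algebraMap A K s = algebraMap A K a) :
    algebraMap A K s • fracD (k := k) (n := n) (A := A) K x =
      freeD k n A K a - x • freeD k n A K s := by
  have h2 := IsLocalization.sec_spec (nonZeroDivisors A) x
  have ht := nonZeroDivisors.coe_ne_zero (IsLocalization.sec (nonZeroDivisors A) x).2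
  rw [fracD]
  generalize (IsLocalization.sec (nonZeroDivisors A) x).1 = b at *
  generalize ((IsLocalization.sec (nonZeroDivisors A) x).2 : A) = t at *
  have inj := FaithfulSMul.algebraMap_injective A K
  have ht' : algebraMap A K t ≠ 0 := (map_ne_zero_iff _ inj).mpr ht
  have he : a * t = b * s := by
    apply inj
    rw [map_mul, map_mul, ← h, ← h2]; ring
  have hd := congrArg (freeD k n A K) he
  rw [freeD_mul, freeD_mul] at hd
  rw [smul_smul, mul_comm, ← smul_smul, inv_smul_eq_iff₀ ht', smul_sub, smul_sub, smul_smul, smul_smul,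
    mul_comm _ x, mul_comm _ x, h, h2, sub_eq_sub_iff_add_eq_add]
  rw [add_comm, ← sub_eq_zero] at hd
  rw [← sub_eq_zero, ← neg_eq_zero, ← hd]
  abel


theorem freeD_one : freeD k n A K 1 = 0 := by
  have := freeD_mul (k := k) (n := n) K (1 : A) 1
  simpa using this

theorem fracD_algebraMap (a : A) : fracD (k := k) (n := n) (A := A) K (algebraMap A K a) =
    freeD k n A K a := by
  have := fracD_spec (k := k) (n := n) K (algebraMap A K a) a 1 one_ne_zero (by simp)
  simpa [freeD_one] using this

theorem frac_rep (x : K) : ∃ a s : A, s ≠ 0 ∧ x * algebraMap A K s = algebraMap A K a := by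
  obtain ⟨a, s, hs, rfl⟩ := IsFractionRing.div_surjective (A := A) x
  exact ⟨a, s, nonZeroDivisors.ne_zero hs, div_mul_cancel₀ _
    (IsFractionRing.to_map_ne_zero_of_mem_nonZeroDivisors hs)⟩

theorem fracD_mul (x y : K) : fracD (k := k) (n := n) (A := A) K (x * y) =
    x • fracD (k := k) (n := n) (A := A) K y + y • fracD (k := k) (n := n) (A := A) K x := by
  obtain ⟨a, s, hs, ha⟩ := frac_rep (A := A) K x
  obtain ⟨b, t, ht, hb⟩ := frac_rep (A := A) K y
  have hst : algebraMap A K (s * t) ≠ 0 := by simp [hs, ht]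
  have h3 := fracD_spec (k := k) (n := n) K (x * y) (a * b) (s * t) (mul_ne_zero hs ht)
    (by rw [map_mul, map_mul, ← ha, ← hb]; ring)
  have h1 := fracD_spec (k := k) (n := n) K x a s hs ha
  have h2 := fracD_spec (k := k) (n := n) K y b t ht hb
  apply smul_right_injective _ hst
  dsimp only
  rw [h3, freeD_mul, freeD_mul, ← ha, ← hb, map_mul, smul_add (algebraMap A K s * algebraMap A K t)]
  have e1 : (algebraMap A K s * algebraMap A K t) • x • fracD (k := k) (n := n) (A := A) K y =
      (algebraMap A K s * x) • (algebraMap A K t • fracD (k := k) (n := n) (A := A) K y) := by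
    simp only [smul_smul]; congr 1; ring
  have e2 : (algebraMap A K s * algebraMap A K t) • y • fracD (k := k) (n := n) (A := A) K x =
      (algebraMap A K t * y) • (algebraMap A K s • fracD (k := k) (n := n) (A := A) K x) := by
    simp only [smul_smul]; congr 1; ring
  rw [e1, e2, h1, h2]
  module

theorem fracD_add (x y : K) : fracD (k := k) (n := n) (A := A) K (x + y) =
    fracD (k := k) (n := n) (A := A) K x + fracD (k := k) (n := n) (A := A) K y := by
  obtain ⟨a, s, hs, ha⟩ := frac_rep (A := A) K x
  obtain ⟨b, t, ht, hb⟩ := frac_rep (A := A) K y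
  have hst : algebraMap A K (s * t) ≠ 0 := by simp [hs, ht]
  have h3 := fracD_spec (k := k) (n := n) K (x + y) (a * t + b * s) (s * t) (mul_ne_zero hs ht)
    (by rw [map_mul, map_add, map_mul, map_mul, ← ha, ← hb]; ring)
  have h1 := fracD_spec (k := k) (n := n) K x a s hs ha
  have h2 := fracD_spec (k := k) (n := n) K y b t ht hb
  apply smul_right_injective _ hst
  dsimp only
  rw [h3, freeD_add, freeD_mul, freeD_mul, freeD_mul, ← ha, ← hb, map_mul, smul_add (algebraMap A K s * algebraMap A K t)]
  have e1 : (algebraMap A K s * algebraMap A K t) • fracD (k := k) (n := n) (A := A) K y =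
      algebraMap A K s • (algebraMap A K t • fracD (k := k) (n := n) (A := A) K y) := by
    simp only [smul_smul]
  have e2 : (algebraMap A K s * algebraMap A K t) • fracD (k := k) (n := n) (A := A) K x =
      algebraMap A K t • (algebraMap A K s • fracD (k := k) (n := n) (A := A) K x) := by
    simp only [smul_smul]; congr 1; ring
  rw [e1, e2, h1, h2]
  module

theorem fracD_smul (c : k) (x : K) : fracD (k := k) (n := n) (A := A) K (c • x) =
    algebraMap k K c • fracD (k := k) (n := n) (A := A) K x := by
  obtain ⟨a, s, hs, ha⟩ := frac_rep (A := A) K x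
  have hst : algebraMap A K s ≠ 0 := by simp [hs]
  have h3 := fracD_spec (k := k) (n := n) K (c • x) (c • a) s hs
    (by rw [Algebra.smul_def, Algebra.smul_def, map_mul, ← ha, ← IsScalarTower.algebraMap_apply]
        ring)
  have h1 := fracD_spec (k := k) (n := n) K x a s hs ha
  apply smul_right_injective _ hst
  dsimp only
  rw [h3, freeD_smul, smul_comm, h1, Algebra.smul_def]
  module

variable (k n A) in
/-- The form induced by `freeBracket` modulo its radical. -/
noncomputable def kaehlerBracket :
    MultilinearMap K (fun _ : Fin n => (Π₀ _ : A, K) ⧸ freeRadical k n A K) K :=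
  (Submodule.quotEquivOfEqBot (⊥ : Submodule K K) rfl).toLinearMap.compMultilinearMap
    (quotMap (freeBracket k n A K) (fun _ => freeRadical k n A K) ⊥ fun v i h => by
      have := (mem_freeRadical K).mp h i v
      rw [update_eq_self] at this
      simp [this])

theorem kaehlerBracket_freeD (p : Fin n → A) :
    kaehlerBracket k n A K (fun i => freeD k n A K (p i)) = algebraMap A K (bracket (k := k) p) := by
  classical
  have h : (fun i => freeD k n A K (p i)) =
      fun i => Submodule.Quotient.mk (DFinsupp.single (p i) (1 : K)) := by
    ext1 i
    rw [freeD]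
  rw [kaehlerBracket, LinearMap.compMultilinearMap_apply, h, quotMap_mk]
  change freeBracket k n A K _ = _
  rw [freeBracket_single]
  simp

variable (k n A) in
/-- The extension of the bracket of `A` to `K`, as a multilinear map. -/
noncomputable def fracMultilinear : MultilinearMap k (fun _ : Fin n => K) K :=
  ((kaehlerBracket k n A K).restrictScalars k).compLinearMap fun _ =>
    { toFun := fracD (k := k) (n := n) (A := A) K
      map_add' := fracD_add K
      map_smul' := fun c x => by
        rw [fracD_smul]; exact algebraMap_smul K c _ }

theorem fracMultilinear_apply (v : Fin n → K) : fracMultilinear k n A K v =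
    kaehlerBracket k n A K (fun i => fracD (k := k) (n := n) (A := A) K (v i)) := rfl

theorem fracMultilinear_algebraMap (p : Fin n → A) :
    fracMultilinear k n A K (algebraMap A K ∘ p) = algebraMap A K (bracket (k := k) p) := by
  simp only [fracMultilinear_apply, Function.comp_apply, fracD_algebraMap, kaehlerBracket_freeD]

theorem fracMultilinear_isDer (v : Fin n → K) (i : Fin n) :
    IsDer fun x => fracMultilinear k n A K (update v i x) := by
  refine ⟨fun x y => (fracMultilinear k n A K).map_update_add v i x y, fun x y => ?_⟩
  have h : ∀ z, fracMultilinear k n A K (update v i z) =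
      kaehlerBracket k n A K (update (fun j => fracD (k := k) (n := n) (A := A) K (v j)) i
        (fracD (k := k) (n := n) (A := A) K z)) := by
    intro z
    rw [fracMultilinear_apply]
    congr 1
    ext1 j
    by_cases h : j = i
    · subst h; simp
    · simp [h]
  simp only [h]
  rw [fracD_mul, MultilinearMap.map_update_add, MultilinearMap.map_update_smul,
    MultilinearMap.map_update_smul, smul_eq_mul, smul_eq_mul]

theorem fracMultilinear_update (p : Fin n → A) (i : Fin n) (a : A) :
    fracMultilinear k n A K (update (algebraMap A K ∘ p) i (algebraMap A K a)) =
      algebraMap A K (bracket (k := k) (update p i a)) := by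
  rw [← Function.comp_update, fracMultilinear_algebraMap]

theorem fracMultilinear_swap (i j : Fin n) (hij : i ≠ j) (v : Fin n → K) :
    fracMultilinear k n A K v + fracMultilinear k n A K (v ∘ Equiv.swap i j) = 0 := by
  revert v
  refine slotwise _ (Set.range (algebraMap A K)) ?_ ?_
  · intro x hx
    choose p hp using hx
    obtain rfl : algebraMap A K ∘ p = x := funext hp
    rw [Function.comp_assoc, fracMultilinear_algebraMap, fracMultilinear_algebraMap,
      AlternatingMap.map_swap _ _ hij]
    simp
  · intro x t hx z
    have h : ∀ z, update x t z ∘ Equiv.swap i j =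
        update (x ∘ Equiv.swap i j) (Equiv.swap i j t) z := by
      intro z
      ext1 s
      simp only [Function.comp_apply, update_apply]
      congr 1
      rw [Equiv.swap_apply_eq_iff]
    simp only [h] at hx ⊢
    exact IsDer.eq_zero (A := A) ((fracMultilinear_isDer K x t).add (fracMultilinear_isDer K _ _))
      (fun a => hx _ ⟨a, rfl⟩) z

variable (k n A) in
/-- The extension of the bracket of `A` to `K`. -/
noncomputable def fracBracket [CharZero k] : K [⋀^Fin n]→ₗ[k] K where
  toMultilinearMap := fracMultilinear k n A K
  map_eq_zero_of_eq' v i j hij hne := by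
    have h := fracMultilinear_swap (k := k) (A := A) K i j hne v
    have : v ∘ Equiv.swap i j = v := by
      ext1 s
      simp only [Function.comp_apply, Equiv.swap_apply_def]
      split_ifs with h1 h2
      · rw [h1, hij]
      · rw [h2, hij]
      · rfl
    rw [this] at h
    have : CharZero K := charZero_of_injective_algebraMap (FaithfulSMul.algebraMap_injective k K)
    exact self_eq_neg.mp (eq_neg_of_add_eq_zero_left h)

variable [CharZero k]

theorem fracBracket_isDer (v : Fin n → K) (i : Fin n) :
    IsDer fun x => fracBracket k n A K (update v i x) := fracMultilinear_isDer K v i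

theorem fracBracket_update (p : Fin n → A) (i : Fin n) (a : A) :
    fracBracket k n A K (update (algebraMap A K ∘ p) i (algebraMap A K a)) =
      algebraMap A K (bracket (k := k) (update p i a)) := fracMultilinear_update K p i a

theorem fracBracket_algebraMap (p : Fin n → A) :
    fracBracket k n A K (algebraMap A K ∘ p) = algebraMap A K (bracket (k := k) p) :=
  fracMultilinear_algebraMap K p

theorem frac_slot_identity (u v : Fin n → K) (i j : Fin n) (hij : j ≠ i) (c d : K) :
    ∑ s, (fracBracket k n A K (update (update v j d) i (u s)) * fracBracket k n A K (update u s c) +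
      fracBracket k n A K (update (update v j c) i (u s)) *
        fracBracket k n A K (update u s d)) = 0 := by
  have der : ∀ w t, IsDer fun x => fracBracket k n A K (update w t x) := fracBracket_isDer K
  have der' : ∀ w t y, t ≠ i → IsDer fun x => fracBracket k n A K (update (update w t x) i y) := by
    intro w t y h
    simp only [update_comm h]
    exact der _ _
  -- the entries of `u`, `v` and `c`, `d` in `A`
  have h0 : ∀ (p q : Fin n → A) (a b : A), ∑ s,
      (fracBracket k n A K (update (update (algebraMap A K ∘ q) j (algebraMap A K b)) i
          ((algebraMap A K ∘ p) s)) *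
        fracBracket k n A K (update (algebraMap A K ∘ p) s (algebraMap A K a)) +
      fracBracket k n A K (update (update (algebraMap A K ∘ q) j (algebraMap A K a)) i
          ((algebraMap A K ∘ p) s)) *
        fracBracket k n A K (update (algebraMap A K ∘ p) s (algebraMap A K b))) = 0 := by
    intro p q a b
    have := congrArg (algebraMap A K) (slot_identity (k := k) p q i j hij a b)
    rw [map_zero, map_sum] at this
    rw [← this]
    refine Finset.sum_congr rfl fun s _ => ?_
    simp only [← Function.comp_update, Function.comp_apply, fracBracket_algebraMap, map_add, map_mul]
  -- general `c`, `d`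
  have h1 : ∀ (p q : Fin n → A) (c d : K), ∑ s,
      (fracBracket k n A K (update (update (algebraMap A K ∘ q) j d) i
          ((algebraMap A K ∘ p) s)) *
        fracBracket k n A K (update (algebraMap A K ∘ p) s c) +
      fracBracket k n A K (update (update (algebraMap A K ∘ q) j c) i
          ((algebraMap A K ∘ p) s)) *
        fracBracket k n A K (update (algebraMap A K ∘ p) s d)) = 0 := by
    intro p q c d
    refine IsDer.eq_zero (A := A) (IsDer.sum _ fun s _ =>
      ((der' _ _ _ hij).mul_const _).add ((der _ _).const_mul _)) (fun b => ?_) d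
    exact IsDer.eq_zero (A := A) (IsDer.sum _ fun s _ =>
      ((der _ _).const_mul _).add ((der' _ _ _ hij).mul_const _)) (fun a => h0 p q a b) c
  -- general `v`
  have h2 : ∀ (p : Fin n → A) (v : Fin n → K), ∑ s,
      (fracBracket k n A K (update (update v j d) i
          ((algebraMap A K ∘ p) s)) *
        fracBracket k n A K (update (algebraMap A K ∘ p) s c) +
      fracBracket k n A K (update (update v j c) i
          ((algebraMap A K ∘ p) s)) *
        fracBracket k n A K (update (algebraMap A K ∘ p) s d)) = 0 := by
    intro p
    refine slotwise _ (Set.range (algebraMap A K)) ?_ ?_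
    · intro x hx
      choose q hq using hx
      obtain rfl : algebraMap A K ∘ q = x := funext hq
      exact h1 p q c d
    · intro x t hx z
      by_cases htj : t = j
      · subst htj
        have := hx _ ⟨0, rfl⟩
        simpa only [update_idem] using this
      by_cases hti : t = i
      · subst hti
        have := hx _ ⟨0, rfl⟩
        simp only [update_comm (Ne.symm htj), update_idem] at this ⊢
        exact this
      · simp only [update_comm htj] at hx ⊢
        exact IsDer.eq_zero (A := A) (IsDer.sum _ fun s _ =>
          ((der' _ _ _ hti).mul_const _).add ((der' _ _ _ hti).mul_const _))
          (fun a => hx _ ⟨a, rfl⟩) z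
  revert u
  refine slotwise _ (Set.range (algebraMap A K)) ?_ ?_
  · intro x hx
    choose q hq using hx
    obtain rfl : algebraMap A K ∘ q = x := funext hq
    exact h2 q v
  · intro x t hx z
    refine IsDer.eq_zero (A := A) (g := fun z => ∑ s,
      (fracBracket k n A K (update (update v j d) i (update x t z s)) *
        fracBracket k n A K (update (update x t z) s c) +
      fracBracket k n A K (update (update v j c) i (update x t z s)) *
        fracBracket k n A K (update (update x t z) s d))) (IsDer.sum _ fun s _ => ?_)
      (fun a => hx _ ⟨a, rfl⟩) z
    by_cases hst : s = t
    · subst hst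
      simp only [update_self, update_idem]
      exact ((der _ _).mul_const _).add ((der _ _).mul_const _)
    · simp only [update_of_ne hst, update_comm (Ne.symm hst)]
      exact ((der _ _).const_mul _).add ((der _ _).const_mul _)

theorem fracBracket_jacobi (u v : Fin n → K) (i : Fin n) :
    fracBracket k n A K (update v i (fracBracket k n A K u)) -
      ∑ s, fracBracket k n A K (update u s (fracBracket k n A K (update v i (u s)))) = 0 := by
  have der : ∀ w t, IsDer fun x => fracBracket k n A K (update w t x) := fracBracket_isDer K
  -- the entries of `v` in `A`
  have h1 : ∀ q : Fin n → A, fracBracket k n A K (update v i (fracBracket k n A K (algebraMap A K ∘ q))) -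
      ∑ s, fracBracket k n A K (update (algebraMap A K ∘ q) s
        (fracBracket k n A K (update v i ((algebraMap A K ∘ q) s)))) = 0 := by
    intro q
    revert v
    refine slotwise _ (Set.range (algebraMap A K)) ?_ ?_
    · intro x hx
      choose p hp using hx
      obtain rfl : algebraMap A K ∘ p = x := funext hp
      simp only [Function.comp_apply, fracBracket_update, fracBracket_algebraMap]
      rw [jacobi, map_sum, sub_self]
    · intro x t hx z
      by_cases hti : t = i
      · subst hti
        have := hx _ ⟨0, rfl⟩
        simpa only [update_idem] using this
      refine IsDer.eq_zero (A := A) (g := fun z =>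
        fracBracket k n A K (update (update x t z) i (fracBracket k n A K (algebraMap A K ∘ q))) -
        ∑ s, fracBracket k n A K (update (algebraMap A K ∘ q) s
          (fracBracket k n A K (update (update x t z) i ((algebraMap A K ∘ q) s)))))
        ⟨fun a b => ?_, fun a b => ?_⟩ (fun a => hx _ ⟨a, rfl⟩) z
      · simp only [update_comm hti, AlternatingMap.map_update_add, Finset.sum_add_distrib]
        ring
      · have e := frac_slot_identity (k := k) (A := A) K (algebraMap A K ∘ q) x i t hti a b
        simp only [update_comm hti, (der _ _).2, (der _ _).1, Finset.sum_add_distrib,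
          ← Finset.mul_sum, Function.comp_apply] at e ⊢
        linear_combination -e
  revert u
  refine slotwise _ (Set.range (algebraMap A K)) ?_ ?_
  · intro x hx
    choose q hq using hx
    obtain rfl : algebraMap A K ∘ q = x := funext hq
    exact h1 q
  · intro x t hx z
    have e : ∀ z, fracBracket k n A K (update v i (fracBracket k n A K (update x t z))) -
        ∑ s, fracBracket k n A K (update (update x t z) s
          (fracBracket k n A K (update v i (update x t z s)))) =
        (fracBracket k n A K (update v i (fracBracket k n A K (update x t z))) -
          fracBracket k n A K (update x t (fracBracket k n A K (update v i z)))) -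
        ∑ s ∈ Finset.univ.erase t, fracBracket k n A K (update (update x s
          (fracBracket k n A K (update v i (x s)))) t z) := by
      intro z
      rw [← Finset.add_sum_erase _ _ (Finset.mem_univ t), update_idem, update_self, sub_sub]
      congr 2
      refine Finset.sum_congr rfl fun s hs => ?_
      have hst := Finset.ne_of_mem_erase hs
      rw [update_of_ne hst, update_comm (Ne.symm hst)]
    simp only [e] at hx ⊢
    exact IsDer.eq_zero (A := A) (((der v i).comm (der x t)).sub (IsDer.sum _ fun s _ => der _ _))
      (fun a => hx _ ⟨a, rfl⟩) z

/-- The Nambu-Poisson fraction field `Q(A)` of a Nambu-Poisson domain `A`. -/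
noncomputable instance : NambuPoisson k n (FractionRing A) where
  bracket := fracBracket k n A (FractionRing A)
  leibniz v i := (fracBracket_isDer (FractionRing A) v i).2
  jacobi u v i := sub_eq_zero.mp (fracBracket_jacobi (FractionRing A) u v i)

end Frac
end NambuPoisson

/-! ### Valuations and associated graded rings -/

/-- A `0`-valuation `ν : N → ℤ ∪ {∞}` on a Nambu-Poisson field `N` over `k`. -/
structure ZeroValuation (k : Type*) (n : ℕ) (N : Type*) [Field k] [Field N] [Algebra k N]
    [NambuPoisson k n N] where
  toFun : N → WithTop ℤ
  eq_top_iff : ∀ a, toFun a = ⊤ ↔ a = 0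
  map_algebraMap : ∀ c : k, c ≠ 0 → toFun (algebraMap k N c) = 0
  map_mul : ∀ a b, toFun (a * b) = toFun a + toFun b
  min_le_map_add : ∀ a b, min (toFun a) (toFun b) ≤ toFun (a + b)
  map_add_of_ne : ∀ a b, toFun a ≠ toFun b → toFun (a + b) = min (toFun a) (toFun b)
  sum_le_map_bracket : ∀ b : Fin n → N, ∑ s, toFun (b s) ≤ toFun (NambuPoisson.bracket (k := k) b)

namespace ZeroValuation

section Gr
variable {k : Type*} {n : ℕ} {N : Type*} [Field k] [Field N] [Algebra k N] [NambuPoisson k n N]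

instance : CoeFun (ZeroValuation k n N) fun _ => N → WithTop ℤ := ⟨toFun⟩

variable (ν : ZeroValuation k n N)

theorem map_zero : ν 0 = ⊤ := (ν.eq_top_iff 0).mpr rfl

theorem map_one : ν 1 = 0 := by simpa using ν.map_algebraMap 1 one_ne_zero

theorem le_map_algebraMap (c : k) : ((0 : ℤ) : WithTop ℤ) ≤ ν (algebraMap k N c) := by
  by_cases h : c = 0
  · simp [h, ν.map_zero]
  · simp [ν.map_algebraMap c h]

/-- The filtration `F_i = {a | ν a ≥ i}` of `ν`. -/
def filtration (i : ℤ) : Submodule k N where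
  carrier := {a | (i : WithTop ℤ) ≤ ν a}
  zero_mem' := by simp [ν.map_zero]
  add_mem' {a b} ha hb := le_trans (le_min ha hb) (ν.min_le_map_add a b)
  smul_mem' c a ha := by
    change (i : WithTop ℤ) ≤ ν (c • a)
    rw [Algebra.smul_def, ν.map_mul]
    simpa using add_le_add (ν.le_map_algebraMap c) ha

theorem mem_filtration {i : ℤ} {a : N} : a ∈ ν.filtration i ↔ (i : WithTop ℤ) ≤ ν a := Iff.rfl

theorem mul_mem_filtration {i j : ℤ} {a b : N} (ha : a ∈ ν.filtration i)
    (hb : b ∈ ν.filtration j) : a * b ∈ ν.filtration (i + j) := by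
  rw [mem_filtration, ν.map_mul]
  rw [mem_filtration] at ha hb
  simpa using add_le_add ha hb

theorem bracket_mem_filtration {p : Fin n → ℤ} {a : Fin n → N}
    (h : ∀ i, a i ∈ ν.filtration (p i)) :
    NambuPoisson.bracket (k := k) a ∈ ν.filtration (∑ i, p i) := by
  rw [mem_filtration, WithTop.coe_sum]
  exact (Finset.sum_le_sum fun i _ => h i).trans (ν.sum_le_map_bracket a)

/-- The homogeneous component `F_i / F_{i+1}`. -/
def grPiece (i : ℤ) : Type _ :=
  ν.filtration i ⧸ (ν.filtration (i + 1)).comap (ν.filtration i).subtype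

noncomputable instance (i : ℤ) : AddCommGroup (ν.grPiece i) :=
  inferInstanceAs (AddCommGroup
    (ν.filtration i ⧸ (ν.filtration (i + 1)).comap (ν.filtration i).subtype))

noncomputable instance (i : ℤ) : Module k (ν.grPiece i) :=
  inferInstanceAs (Module k
    (ν.filtration i ⧸ (ν.filtration (i + 1)).comap (ν.filtration i).subtype))

/-- The class in `F_i / F_{i+1}` of an element of `F_i`. -/
def grMk {i : ℤ} {a : N} (h : a ∈ ν.filtration i) : ν.grPiece i := Submodule.Quotient.mk ⟨a, h⟩

theorem exists_grMk {i : ℤ} (x : ν.grPiece i) :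
    ∃ (a : N) (h : a ∈ ν.filtration i), x = ν.grMk h := by
  obtain ⟨a, rfl⟩ := Submodule.Quotient.mk_surjective _ x
  exact ⟨a.1, a.2, rfl⟩

theorem grMk_eq_iff {i : ℤ} {a b : N} (ha : a ∈ ν.filtration i) (hb : b ∈ ν.filtration i) :
    ν.grMk ha = ν.grMk hb ↔ a - b ∈ ν.filtration (i + 1) :=
  Submodule.Quotient.eq _

theorem grMk_eq_zero_iff {i : ℤ} {a : N} (ha : a ∈ ν.filtration i) :
    ν.grMk ha = 0 ↔ a ∈ ν.filtration (i + 1) :=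
  Submodule.Quotient.mk_eq_zero _

theorem grMk_add {i : ℤ} {a b : N} (ha : a ∈ ν.filtration i) (hb : b ∈ ν.filtration i) :
    ν.grMk ha + ν.grMk hb = ν.grMk (add_mem ha hb) := rfl

theorem gradedMonoid_mk_eq {i j : ℤ} {a b : N} (ha : a ∈ ν.filtration i) (hb : b ∈ ν.filtration j)
    (hij : i = j) (hab : a = b) :
    GradedMonoid.mk (A := ν.grPiece) i (ν.grMk ha) = GradedMonoid.mk j (ν.grMk hb) := by
  subst hij; subst hab; rfl

/-- The multiplication `F_i / F_{i+1} × F_j / F_{j+1} → F_{i+j} / F_{i+j+1}`. -/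
noncomputable def grMul {i j : ℤ} (x : ν.grPiece i) (y : ν.grPiece j) : ν.grPiece (i + j) :=
  ν.grMk (ν.mul_mem_filtration (Quotient.out x).2 (Quotient.out y).2)

theorem grMul_mk {i j : ℤ} {a b : N} (ha : a ∈ ν.filtration i) (hb : b ∈ ν.filtration j) :
    ν.grMul (ν.grMk ha) (ν.grMk hb) = ν.grMk (ν.mul_mem_filtration ha hb) := by
  have h1 : (Quotient.out (ν.grMk ha)).1 - a ∈ ν.filtration (i + 1) :=
    (ν.grMk_eq_iff (Quotient.out (ν.grMk ha)).2 ha).mp (Quotient.out_eq _)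
  have h2 : (Quotient.out (ν.grMk hb)).1 - b ∈ ν.filtration (j + 1) :=
    (ν.grMk_eq_iff (Quotient.out (ν.grMk hb)).2 hb).mp (Quotient.out_eq _)
  rw [grMul, grMk_eq_iff]
  have e : (Quotient.out (ν.grMk ha)).1 * (Quotient.out (ν.grMk hb)).1 - a * b =
      ((Quotient.out (ν.grMk ha)).1 - a) * (Quotient.out (ν.grMk hb)).1 + a * ((Quotient.out (ν.grMk hb)).1 - b) := by ring
  rw [e]
  refine add_mem ?_ ?_
  · have := ν.mul_mem_filtration h1 (Quotient.out (ν.grMk hb)).2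
    rwa [add_right_comm] at this
  · have := ν.mul_mem_filtration ha h2
    rwa [← add_assoc] at this

theorem one_mem_filtration : (1 : N) ∈ ν.filtration 0 := by
  rw [mem_filtration]
  simpa using ν.le_map_algebraMap 1

theorem algebraMap_mem_filtration (c : k) : algebraMap k N c ∈ ν.filtration 0 :=
  ν.le_map_algebraMap c

theorem natCast_mem_filtration (m : ℕ) : (m : N) ∈ ν.filtration 0 := by
  rw [mem_filtration]
  simpa using ν.le_map_algebraMap m

theorem intCast_mem_filtration (m : ℤ) : (m : N) ∈ ν.filtration 0 := by
  rw [mem_filtration]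
  simpa using ν.le_map_algebraMap m

noncomputable instance : GradedMonoid.GMul ν.grPiece where
  mul := ν.grMul

theorem gMul_mk {i j : ℤ} {a b : N} (ha : a ∈ ν.filtration i) (hb : b ∈ ν.filtration j) :
    GradedMonoid.GMul.mul (ν.grMk ha) (ν.grMk hb) = ν.grMk (ν.mul_mem_filtration ha hb) :=
  ν.grMul_mk ha hb

instance : GradedMonoid.GOne ν.grPiece where
  one := ν.grMk ν.one_mem_filtration

noncomputable instance : DirectSum.GCommRing ν.grPiece where
  mul_zero {i j} x := by
    obtain ⟨a, ha, rfl⟩ := ν.exists_grMk x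
    rw [show (0 : ν.grPiece j) = ν.grMk (zero_mem _) from rfl, gMul_mk, grMk_eq_zero_iff, mul_zero]
    exact zero_mem _
  zero_mul {i j} x := by
    obtain ⟨a, ha, rfl⟩ := ν.exists_grMk x
    rw [show (0 : ν.grPiece i) = ν.grMk (zero_mem _) from rfl, gMul_mk, grMk_eq_zero_iff, zero_mul]
    exact zero_mem _
  mul_add {i j} x y z := by
    obtain ⟨a, ha, rfl⟩ := ν.exists_grMk x
    obtain ⟨b, hb, rfl⟩ := ν.exists_grMk y
    obtain ⟨c, hc, rfl⟩ := ν.exists_grMk z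
    simp only [grMk_add, gMul_mk, mul_add]
  add_mul {i j} x y z := by
    obtain ⟨a, ha, rfl⟩ := ν.exists_grMk x
    obtain ⟨b, hb, rfl⟩ := ν.exists_grMk y
    obtain ⟨c, hc, rfl⟩ := ν.exists_grMk z
    simp only [grMk_add, gMul_mk, add_mul]
  one_mul x := by
    obtain ⟨i, x⟩ := x
    obtain ⟨a, ha, rfl⟩ := ν.exists_grMk x
    change GradedMonoid.mk _ (ν.grMul (ν.grMk _) (ν.grMk _)) = _
    rw [grMul_mk]
    exact ν.gradedMonoid_mk_eq _ _ (zero_add i) (one_mul a)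
  mul_one x := by
    obtain ⟨i, x⟩ := x
    obtain ⟨a, ha, rfl⟩ := ν.exists_grMk x
    change GradedMonoid.mk _ (ν.grMul (ν.grMk _) (ν.grMk _)) = _
    rw [grMul_mk]
    exact ν.gradedMonoid_mk_eq _ _ (add_zero i) (mul_one a)
  mul_assoc x y z := by
    obtain ⟨i, x⟩ := x
    obtain ⟨j, y⟩ := y
    obtain ⟨l, z⟩ := z
    obtain ⟨a, ha, rfl⟩ := ν.exists_grMk x
    obtain ⟨b, hb, rfl⟩ := ν.exists_grMk y
    obtain ⟨c, hc, rfl⟩ := ν.exists_grMk z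
    change GradedMonoid.mk _ (ν.grMul (ν.grMul (ν.grMk _) (ν.grMk _)) (ν.grMk _)) =
      GradedMonoid.mk _ (ν.grMul (ν.grMk _) (ν.grMul (ν.grMk _) (ν.grMk _)))
    simp only [grMul_mk]
    exact ν.gradedMonoid_mk_eq _ _ (add_assoc i j l) (mul_assoc a b c)
  mul_comm x y := by
    obtain ⟨i, x⟩ := x
    obtain ⟨j, y⟩ := y
    obtain ⟨a, ha, rfl⟩ := ν.exists_grMk x
    obtain ⟨b, hb, rfl⟩ := ν.exists_grMk y
    change GradedMonoid.mk _ (ν.grMul (ν.grMk _) (ν.grMk _)) =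
      GradedMonoid.mk _ (ν.grMul (ν.grMk _) (ν.grMk _))
    simp only [grMul_mk]
    exact ν.gradedMonoid_mk_eq _ _ (add_comm i j) (mul_comm a b)
  natCast m := ν.grMk (ν.natCast_mem_filtration m)
  natCast_zero := by
    rw [grMk_eq_zero_iff]; simp
  natCast_succ m := by
    change _ = ν.grMk _ + ν.grMk _
    rw [grMk_add]
    congr 1
    push_cast
    rfl
  intCast m := ν.grMk (ν.intCast_mem_filtration m)
  intCast_ofNat m := by
    congr 1
    push_cast
    rfl
  intCast_negSucc_ofNat m := by
    change _ = ν.grMk (neg_mem (ν.natCast_mem_filtration (m + 1)))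
    congr 1
    push_cast
    rfl

noncomputable instance : DirectSum.GAlgebra k ν.grPiece where
  toFun :=
    { toFun := fun c => ν.grMk (ν.algebraMap_mem_filtration c)
      map_zero' := by rw [grMk_eq_zero_iff]; simp
      map_add' := fun a b => by
        rw [grMk_add]; congr 1; rw [map_add] }
  map_one := by
    change ν.grMk _ = ν.grMk _
    congr 1; rw [_root_.map_one]
  map_mul r s := by
    change GradedMonoid.mk _ (ν.grMk _) = GradedMonoid.mk _ (ν.grMul (ν.grMk _) (ν.grMk _))
    rw [grMul_mk]
    exact ν.gradedMonoid_mk_eq _ _ (add_zero 0).symm (_root_.map_mul _ _ _)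
  commutes r x := by
    obtain ⟨i, x⟩ := x
    obtain ⟨a, ha, rfl⟩ := ν.exists_grMk x
    refine (congrArg (GradedMonoid.mk _) (ν.grMul_mk (ν.algebraMap_mem_filtration r) ha)).trans
      (Eq.trans ?_ (congrArg (GradedMonoid.mk _)
        (ν.grMul_mk ha (ν.algebraMap_mem_filtration r))).symm)
    exact ν.gradedMonoid_mk_eq _ _ (add_comm _ _) (mul_comm _ _)
  smul_def r x := by
    obtain ⟨i, x⟩ := x
    obtain ⟨a, ha, rfl⟩ := ν.exists_grMk x
    refine Eq.trans (b := GradedMonoid.mk i (ν.grMk ((ν.filtration i).smul_mem r ha))) rfl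
      (Eq.trans ?_ (congrArg (GradedMonoid.mk _)
        (ν.grMul_mk (ν.algebraMap_mem_filtration r) ha)).symm)
    exact ν.gradedMonoid_mk_eq _ _ (zero_add i).symm (Algebra.smul_def r a)

open DirectSum in
/-- The associated graded ring `gr_ν(N) = ⨁ F_i / F_{i+1}`. -/
abbrev Gr : Type _ := ⨁ i, ν.grPiece i

theorem grMul_ne_zero {i j : ℤ} {x : ν.grPiece i} {y : ν.grPiece j} (hx : x ≠ 0) (hy : y ≠ 0) :
    ν.grMul x y ≠ 0 := by
  obtain ⟨a, ha, rfl⟩ := ν.exists_grMk x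
  obtain ⟨b, hb, rfl⟩ := ν.exists_grMk y
  rw [grMul_mk]
  rw [Ne, grMk_eq_zero_iff, mem_filtration] at hx hy ⊢
  rw [mem_filtration] at ha hb
  rw [ν.map_mul]
  cases h1 : ν a with
  | top => simp [h1] at hx
  | coe a' =>
    cases h2 : ν b with
    | top => simp [h2] at hy
    | coe b' =>
      rw [h1] at ha hx
      rw [h2] at hb hy
      norm_cast at *
      omega

instance : IsDomain ν.Gr := by
  have h1 : Nontrivial ν.Gr := by
    refine ⟨DirectSum.of ν.grPiece 0 (ν.grMk ν.one_mem_filtration), 0, fun h => ?_⟩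
    have := congrArg (fun x => x 0) h
    simp only [DirectSum.of_eq_same] at this
    erw [grMk_eq_zero_iff, mem_filtration, ν.map_one] at this
    norm_cast at this
  have h2 : NoZeroDivisors ν.Gr := by
    classical
    refine ⟨fun {x y} hxy => ?_⟩
    by_contra! h
    obtain ⟨hx, hy⟩ := h
    have hx' : (DFinsupp.support x).Nonempty := by
      rwa [Finset.nonempty_iff_ne_empty, Ne, DFinsupp.support_eq_empty]
    have hy' : (DFinsupp.support y).Nonempty := by
      rwa [Finset.nonempty_iff_ne_empty, Ne, DFinsupp.support_eq_empty]
    set i := (DFinsupp.support x).max' hx' with hi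
    set j := (DFinsupp.support y).max' hy' with hj
    have hmi : i ∈ DFinsupp.support x := Finset.max'_mem _ _
    have hmj : j ∈ DFinsupp.support y := Finset.max'_mem _ _
    have := congrArg (fun z => z (i + j)) hxy
    simp only [DirectSum.mul_eq_sum_support_ghas_mul, DirectSum.sum_apply] at this
    rw [Finset.sum_eq_single (i, j), DirectSum.of_eq_same] at this
    · refine ν.grMul_ne_zero ?_ ?_ this
      · simpa using hmi
      · simpa using hmj
    · rintro ⟨a, b⟩ hab hne
      rw [Finset.mem_product] at hab
      have ha : a ≤ i := Finset.le_max' _ _ hab.1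
      have hb : b ≤ j := Finset.le_max' _ _ hab.2
      refine DirectSum.of_eq_of_ne _ _ _ ?_
      intro h
      apply hne
      ext
      · change a = i; dsimp only at h; omega
      · change b = j; dsimp only at h; omega
    · intro h
      exact absurd (Finset.mk_mem_product hmi hmj) h
  exact NoZeroDivisors.to_isDomain _
end Gr
end ZeroValuation

namespace ZeroValuation

section GrBracket
variable {k : Type*} {n : ℕ} {N : Type*} [Field k] [Field N] [Algebra k N] [NambuPoisson k n N]
variable (ν : ZeroValuation k n N)

/-- The bracket `F_{p_1} × ⋯ × F_{p_n} → F_{p_1 + ⋯ + p_n}`. -/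
noncomputable def filtrationBracket (p : Fin n → ℤ) :
    MultilinearMap k (fun i => ν.filtration (p i)) (ν.filtration (∑ i, p i)) :=
  ((NambuPoisson.bracket (k := k) (A := N)).toMultilinearMap.compLinearMap
    fun i => (ν.filtration (p i)).subtype).codRestrict (ν.filtration (∑ i, p i))
    fun v => ν.bracket_mem_filtration fun i => (v i).2

/-- The bracket on homogeneous components. -/
noncomputable def grPieceBracket (p : Fin n → ℤ) :
    MultilinearMap k (fun i => ν.grPiece (p i)) (ν.grPiece (∑ i, p i)) :=
  NambuPoisson.quotMap (ν.filtrationBracket p)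
    (fun i => (ν.filtration (p i + 1)).comap (ν.filtration (p i)).subtype)
    ((ν.filtration ((∑ i, p i) + 1)).comap (ν.filtration (∑ i, p i)).subtype) fun v i hv => by
      have h := ν.bracket_mem_filtration (p := update p i (p i + 1)) (a := fun j => (v j : N)) ?_
      · have e : ∑ j, update p i (p i + 1) j = (∑ j, p j) + 1 := by
          rw [Finset.sum_update_of_mem (Finset.mem_univ i), ← Finset.add_sum_erase _ _
            (Finset.mem_univ i), Finset.sdiff_singleton_eq_erase]
          ring
        rw [e] at h
        exact h
      · intro j
        by_cases hj : j = i
        · subst hj; rw [update_self]; exact hv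
        · rw [update_of_ne hj]; exact (v j).2

theorem grPieceBracket_mk (p : Fin n → ℤ) {a : Fin n → N} (h : ∀ i, a i ∈ ν.filtration (p i)) :
    ν.grPieceBracket p (fun i => ν.grMk (h i)) = ν.grMk (ν.bracket_mem_filtration h) :=
  NambuPoisson.quotMap_mk _ _ _ _ fun i => (⟨a i, h i⟩ : ν.filtration (p i))

/-- The bracket on `gr_ν(N)` as a multilinear map. -/
noncomputable def grMultilinear : MultilinearMap k (fun _ : Fin n => ν.Gr) ν.Gr :=
  MultilinearMap.fromDirectSumEquiv (κ := fun _ : Fin n => ℤ) (M := fun _ i => ν.grPiece i)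
    fun p => (DirectSum.lof k ℤ ν.grPiece (∑ i, p i)).compMultilinearMap (ν.grPieceBracket p)

open scoped Classical in
/-- The symbol in degree `i` of `a ∈ F_i` (with the value `0` if `a ∉ F_i`). -/
noncomputable def grSymbol (i : ℤ) (a : N) : ν.Gr :=
  if h : a ∈ ν.filtration i then DirectSum.of ν.grPiece i (ν.grMk h) else 0

theorem grSymbol_of_mem {i : ℤ} {a : N} (h : a ∈ ν.filtration i) :
    ν.grSymbol i a = DirectSum.of ν.grPiece i (ν.grMk h) := dif_pos h

theorem grSymbol_add {i : ℤ} {a b : N} (ha : a ∈ ν.filtration i) (hb : b ∈ ν.filtration i) :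
    ν.grSymbol i (a + b) = ν.grSymbol i a + ν.grSymbol i b := by
  rw [grSymbol_of_mem _ ha, grSymbol_of_mem _ hb, grSymbol_of_mem _ (add_mem ha hb), ← grMk_add,
    _root_.map_add]

theorem grSymbol_zero (i : ℤ) : ν.grSymbol i 0 = 0 := by
  rw [grSymbol_of_mem _ (zero_mem _), show ν.grMk (zero_mem (ν.filtration i)) = 0 from rfl,
    _root_.map_zero]

theorem grSymbol_neg {i : ℤ} {a : N} (ha : a ∈ ν.filtration i) :
    ν.grSymbol i (-a) = -ν.grSymbol i a := by
  rw [eq_neg_iff_add_eq_zero, ← grSymbol_add _ (neg_mem ha) ha, neg_add_cancel, grSymbol_zero]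

theorem grSymbol_sum {ι : Type*} (s : Finset ι) {i : ℤ} {a : ι → N}
    (h : ∀ j ∈ s, a j ∈ ν.filtration i) :
    ν.grSymbol i (∑ j ∈ s, a j) = ∑ j ∈ s, ν.grSymbol i (a j) := by
  classical
  induction s using Finset.induction_on with
  | empty => simp [grSymbol_zero]
  | insert b s hb ih =>
    rw [Finset.sum_insert hb, Finset.sum_insert hb, grSymbol_add, ih]
    · exact fun j hj => h j (Finset.mem_insert_of_mem hj)
    · exact h b (Finset.mem_insert_self _ _)
    · exact sum_mem fun j hj => h j (Finset.mem_insert_of_mem hj)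

theorem grSymbol_mul {i j : ℤ} {a b : N} (ha : a ∈ ν.filtration i) (hb : b ∈ ν.filtration j) :
    ν.grSymbol i a * ν.grSymbol j b = ν.grSymbol (i + j) (a * b) := by
  rw [grSymbol_of_mem _ ha, grSymbol_of_mem _ hb, grSymbol_of_mem _ (ν.mul_mem_filtration ha hb),
    DirectSum.of_mul_of, gMul_mk]

theorem grMultilinear_symbol {p : Fin n → ℤ} {a : Fin n → N} (h : ∀ i, a i ∈ ν.filtration (p i)) :
    ν.grMultilinear (fun i => ν.grSymbol (p i) (a i)) =
      ν.grSymbol (∑ i, p i) (NambuPoisson.bracket (k := k) a) := by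
  have e : (fun i => ν.grSymbol (p i) (a i)) =
      fun i => DirectSum.lof k ℤ ν.grPiece (p i) (ν.grMk (h i)) := by
    ext1 i
    rw [grSymbol_of_mem _ (h i)]
    rfl
  rw [e, grMultilinear]
  refine (MultilinearMap.fromDirectSumEquiv_lof (κ := fun _ : Fin n => ℤ)
    (M := fun _ i => ν.grPiece i) _ p fun i => ν.grMk (h i)).trans ?_
  rw [LinearMap.compMultilinearMap_apply, grPieceBracket_mk,
    grSymbol_of_mem _ (ν.bracket_mem_filtration h)]
  rfl

/-- The homogeneous elements of `gr_ν(N)`. -/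
def symbols : Set ν.Gr := {x | ∃ (i : ℤ) (a : N), a ∈ ν.filtration i ∧ x = ν.grSymbol i a}

theorem zero_mem_symbols : (0 : ν.Gr) ∈ ν.symbols :=
  ⟨0, 0, zero_mem _, (ν.grSymbol_zero 0).symm⟩

theorem gr_induction {p : ν.Gr → Prop} (hs : ∀ x ∈ ν.symbols, p x)
    (ha : ∀ x y, p x → p y → p (x + y)) (x : ν.Gr) : p x := by
  induction x using DirectSum.induction_on with
  | zero => exact hs _ ν.zero_mem_symbols
  | of i x =>
    obtain ⟨a, h, rfl⟩ := ν.exists_grMk x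
    exact hs _ ⟨i, a, h, (ν.grSymbol_of_mem h).symm⟩
  | add x y hx hy => exact ha _ _ hx hy

theorem gr_eq_zero {g : ν.Gr → ν.Gr} (hg : ∀ x y, g (x + y) = g x + g y)
    (h0 : ∀ x ∈ ν.symbols, g x = 0) (x : ν.Gr) : g x = 0 :=
  ν.gr_induction h0 (fun x y hx hy => by rw [hg, hx, hy, add_zero]) x

theorem exists_symbols {x : Fin n → ν.Gr} (hx : ∀ i, x i ∈ ν.symbols) :
    ∃ (p : Fin n → ℤ) (a : Fin n → N), (∀ i, a i ∈ ν.filtration (p i)) ∧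
      x = fun i => ν.grSymbol (p i) (a i) := by
  choose p a h e using hx
  exact ⟨p, a, h, funext e⟩

theorem update_symbol (p : Fin n → ℤ) (a : Fin n → N) (i : Fin n) (j : ℤ) (b : N) :
    update (fun i => ν.grSymbol (p i) (a i)) i (ν.grSymbol j b) =
      fun l => ν.grSymbol (update p i j l) (update a i b l) := by
  ext1 l
  by_cases h : l = i
  · subst h; simp
  · simp [h]

theorem update_mem {p : Fin n → ℤ} {a : Fin n → N} (h : ∀ i, a i ∈ ν.filtration (p i)) (i : Fin n)
    {j : ℤ} {b : N} (hb : b ∈ ν.filtration j) (l : Fin n) :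
    update a i b l ∈ ν.filtration (update p i j l) := by
  by_cases h' : l = i
  · subst h'; simpa using hb
  · simpa [h'] using h l

theorem grMultilinear_update {p : Fin n → ℤ} {a : Fin n → N} (h : ∀ i, a i ∈ ν.filtration (p i))
    (i : Fin n) {j : ℤ} {b : N} (hb : b ∈ ν.filtration j) :
    ν.grMultilinear (update (fun i => ν.grSymbol (p i) (a i)) i (ν.grSymbol j b)) =
      ν.grSymbol (∑ l, p l - p i + j) (NambuPoisson.bracket (k := k) (update a i b)) := by
  rw [update_symbol, grMultilinear_symbol _ (ν.update_mem h i hb)]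
  congr 1
  rw [Finset.sum_update_of_mem (Finset.mem_univ i), ← Finset.add_sum_erase _ _ (Finset.mem_univ i),
    Finset.sdiff_singleton_eq_erase]
  ring

theorem bracket_update_mem {p : Fin n → ℤ} {a : Fin n → N} (h : ∀ i, a i ∈ ν.filtration (p i))
    (i : Fin n) {j : ℤ} {b : N} (hb : b ∈ ν.filtration j) :
    NambuPoisson.bracket (k := k) (update a i b) ∈ ν.filtration (∑ l, p l - p i + j) := by
  have := ν.bracket_mem_filtration (ν.update_mem h i hb)
  rw [Finset.sum_update_of_mem (Finset.mem_univ i)] at this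
  rw [← Finset.add_sum_erase _ _ (Finset.mem_univ i), ← Finset.sdiff_singleton_eq_erase]
  convert this using 2
  ring

theorem grMultilinear_swap (i j : Fin n) (hij : i ≠ j) (v : Fin n → ν.Gr) :
    ν.grMultilinear v + ν.grMultilinear (v ∘ Equiv.swap i j) = 0 := by
  revert v
  refine NambuPoisson.slotwise _ ν.symbols ?_ ?_
  · intro x hx
    obtain ⟨p, a, h, rfl⟩ := ν.exists_symbols hx
    rw [grMultilinear_symbol _ h]
    refine (congrArg _ (grMultilinear_symbol ν (p := p ∘ Equiv.swap i j) (a := a ∘ Equiv.swap i j)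
      fun l => h _)).trans ?_
    rw [AlternatingMap.map_swap _ _ hij, show ∑ l, (p ∘ Equiv.swap i j) l = ∑ l, p l from
        Equiv.sum_comp (Equiv.swap i j) p,
      grSymbol_neg _ (ν.bracket_mem_filtration h), add_neg_cancel]
  · intro x t hx z
    have h : ∀ z, update x t z ∘ Equiv.swap i j =
        update (x ∘ Equiv.swap i j) (Equiv.swap i j t) z := by
      intro z
      ext1 s
      simp only [Function.comp_apply, update_apply]
      congr 1
      rw [Equiv.swap_apply_eq_iff]
    simp only [h] at hx ⊢
    refine ν.gr_eq_zero (g := fun z => ν.grMultilinear (update x t z) +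
      ν.grMultilinear (update (x ∘ Equiv.swap i j) (Equiv.swap i j t) z)) (fun a b => ?_) hx z
    simp only [MultilinearMap.map_update_add]
    abel

/-- The induced bracket on `gr_ν(N)`: on classes of `a_s ∈ F_{p_s}` it is the class of
`{a_1, …, a_n}` in `F_{∑ p_s} / F_{∑ p_s + 1}`. -/
noncomputable def grBracket [CharZero k] : ν.Gr [⋀^Fin n]→ₗ[k] ν.Gr where
  toMultilinearMap := ν.grMultilinear
  map_eq_zero_of_eq' v i j hij hne := by
    have h := ν.grMultilinear_swap i j hne v
    have : v ∘ Equiv.swap i j = v := by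
      ext1 s
      simp only [Function.comp_apply, Equiv.swap_apply_def]
      split_ifs with h1 h2
      · rw [h1, hij]
      · rw [h2, hij]
      · rfl
    rw [this, ← two_smul k] at h
    exact (smul_eq_zero_iff_right (two_ne_zero' k)).mp h

variable [CharZero k]

theorem grBracket_leibniz (v : Fin n → ν.Gr) (i : Fin n) (x y : ν.Gr) :
    ν.grBracket (update v i (x * y)) - (x * ν.grBracket (update v i y) +
      y * ν.grBracket (update v i x)) = 0 := by
  revert v
  refine NambuPoisson.slotwise _ ν.symbols ?_ ?_
  · intro v hv
    obtain ⟨p, a, h, rfl⟩ := ν.exists_symbols hv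
    refine ν.gr_eq_zero (g := fun x => ν.grBracket (update _ i (x * y)) -
      (x * ν.grBracket (update _ i y) + y * ν.grBracket (update _ i x))) (fun x x' => ?_) ?_ x
    · simp only [add_mul, AlternatingMap.map_update_add]; ring
    rintro _ ⟨s, c, hc, rfl⟩
    refine ν.gr_eq_zero (g := fun y => ν.grBracket (update _ i (_ * y)) -
      (_ * ν.grBracket (update _ i y) + y * ν.grBracket (update _ i _))) (fun x x' => ?_) ?_ y
    · simp only [mul_add, add_mul, AlternatingMap.map_update_add]; ring
    rintro _ ⟨t, d, hd, rfl⟩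
    have e : ∀ {j : ℤ} {b : N}, b ∈ ν.filtration j →
        ν.grBracket (update (fun i => ν.grSymbol (p i) (a i)) i (ν.grSymbol j b)) =
        ν.grSymbol (∑ l, p l - p i + j) (NambuPoisson.bracket (k := k) (update a i b)) :=
      fun hb => ν.grMultilinear_update h i hb
    have hC := ν.bracket_update_mem h i hc
    have hD := ν.bracket_update_mem h i hd
    have m1 := ν.mul_mem_filtration hc hD
    have m2 := ν.mul_mem_filtration hd hC
    have e1 : s + (∑ l, p l - p i + t) = ∑ l, p l - p i + (s + t) := by ring
    have e2 : t + (∑ l, p l - p i + s) = ∑ l, p l - p i + (s + t) := by ring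
    rw [e1] at m1
    rw [e2] at m2
    beta_reduce
    rw [grSymbol_mul _ hc hd, e (ν.mul_mem_filtration hc hd), e hc, e hd, grSymbol_mul _ hc hD,
      grSymbol_mul _ hd hC, e1, e2, NambuPoisson.leibniz, grSymbol_add _ m1 m2, sub_self]
  · intro v t hv z
    by_cases hti : t = i
    · subst hti
      have := hv _ ν.zero_mem_symbols
      simpa only [update_idem] using this
    · simp only [update_comm hti] at hv ⊢
      refine ν.gr_eq_zero (g := fun z => ν.grBracket (update (update v i (x * y)) t z) -
        (x * ν.grBracket (update (update v i y) t z) +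
          y * ν.grBracket (update (update v i x) t z))) (fun a b => ?_) hv z
      simp only [AlternatingMap.map_update_add]; ring

theorem grBracket_jacobi (u v : Fin n → ν.Gr) (i : Fin n) :
    ν.grBracket (update v i (ν.grBracket u)) -
      ∑ s, ν.grBracket (update u s (ν.grBracket (update v i (u s)))) = 0 := by
  revert u
  refine NambuPoisson.slotwise _ ν.symbols ?_ ?_
  · intro u hu
    obtain ⟨q, b, hb, rfl⟩ := ν.exists_symbols hu
    revert v
    refine NambuPoisson.slotwise _ ν.symbols ?_ ?_
    · intro v hv
      obtain ⟨p, a, ha, rfl⟩ := ν.exists_symbols hv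
      have e : ∀ {p : Fin n → ℤ} {a : Fin n → N} (_ : ∀ i, a i ∈ ν.filtration (p i)) (i : Fin n)
          {j : ℤ} {b : N}, b ∈ ν.filtration j →
          ν.grBracket (update (fun i => ν.grSymbol (p i) (a i)) i (ν.grSymbol j b)) =
          ν.grSymbol (∑ l, p l - p i + j) (NambuPoisson.bracket (k := k) (update a i b)) :=
        fun h i _ _ hb => ν.grMultilinear_update h i hb
      have e0 : ν.grBracket (fun i => ν.grSymbol (q i) (b i)) =
        ν.grSymbol (∑ l, q l) (NambuPoisson.bracket (k := k) b) := ν.grMultilinear_symbol hb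
      have e3 : ∀ s, ∑ l, q l - q s + (∑ l, p l - p i + q s) = ∑ l, p l - p i + ∑ l, q l := by
        intro s; ring
      have m : ∀ s, NambuPoisson.bracket (k := k)
          (update b s (NambuPoisson.bracket (k := k) (update a i (b s)))) ∈
          ν.filtration (∑ l, p l - p i + ∑ l, q l) := by
        intro s
        rw [← e3 s]
        exact ν.bracket_update_mem hb s (ν.bracket_update_mem ha i (hb s))
      rw [e0, e ha i (ν.bracket_mem_filtration hb), NambuPoisson.jacobi,
        grSymbol_sum _ _ fun s _ => m s, sub_eq_zero]
      refine Finset.sum_congr rfl fun s _ => ?_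
      rw [e ha i (hb s), e hb s (ν.bracket_update_mem ha i (hb s)), e3]
    · intro v t hv z
      by_cases hti : t = i
      · subst hti
        have := hv _ ν.zero_mem_symbols
        simpa only [update_idem] using this
      · simp only [update_comm hti] at hv ⊢
        refine ν.gr_eq_zero (g := fun z => ν.grBracket (update (update v i _) t z) -
          ∑ s, ν.grBracket (update _ s (ν.grBracket (update (update v i _) t z))))
          (fun a b => ?_) hv z
        simp only [AlternatingMap.map_update_add, Finset.sum_add_distrib]; ring
  · intro u t hu z
    refine ν.gr_eq_zero (g := fun z => ν.grBracket (update v i (ν.grBracket (update u t z))) -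
      ∑ s, ν.grBracket (update (update u t z) s (ν.grBracket (update v i (update u t z s)))))
      (fun a b => ?_) hu z
    rw [AlternatingMap.map_update_add, AlternatingMap.map_update_add, sub_add_sub_comm,
      ← Finset.sum_add_distrib]
    congr 1
    refine Finset.sum_congr rfl fun s _ => ?_
    by_cases hst : s = t
    · subst hst
      simp only [update_self, update_idem, AlternatingMap.map_update_add]
    · simp only [update_of_ne hst, update_comm (Ne.symm hst), AlternatingMap.map_update_add]

noncomputable instance : NambuPoisson k n ν.Gr where
  bracket := ν.grBracket
  leibniz v i a b := sub_eq_zero.mp (ν.grBracket_leibniz v i a b)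
  jacobi u v i := sub_eq_zero.mp (ν.grBracket_jacobi u v i)

end GrBracket

end ZeroValuation

/-! ### Faithful valuations, depth and width -/

/-- The Gelfand-Kirillov dimension of a commutative `k`-algebra: the supremum over the
finite-dimensional subspaces `V` containing `1` of `limsup_m log (dim V ^ m) / log m`. -/
noncomputable def GKdim (k A : Type*) [Field k] [CommRing A] [Algebra k A] : EReal :=
  ⨆ (V : Submodule k A) (_ : V.FG) (_ : (1 : A) ∈ V),
    Filter.limsup (fun m : ℕ =>
      ((Real.log (Module.finrank k ↥(V ^ m)) / Real.log m : ℝ) : EReal)) Filter.atTop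

namespace ZeroValuation

variable {k : Type*} {n : ℕ} {N : Type*} [Field k] [Field N] [Algebra k N] [NambuPoisson k n N]

/-- `ν` is nontrivial: it is not zero on all of `N \ {0}`. -/
def IsNontrivial (ν : ZeroValuation k n N) : Prop := ∃ a : N, a ≠ 0 ∧ ν a ≠ 0

/-- Equivalence of valuations: `a ν₁ = b ν₂` for some positive integers `a`, `b`. -/
def IsEquiv (ν₁ ν₂ : ZeroValuation k n N) : Prop :=
  ∃ a b : ℕ, 0 < a ∧ 0 < b ∧ ∀ x, a • ν₁ x = b • ν₂ x

/-- `ν` is faithful: its image is `ℤ ∪ {∞}`, the bracket on `gr_ν(N)` is nonzero, and `gr_ν(N)` has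
the same Gelfand-Kirillov dimension as `N`. -/
def IsFaithful [CharZero k] (ν : ZeroValuation k n N) : Prop :=
  Set.range ν.toFun = Set.univ ∧
  (∃ v : Fin n → ν.Gr, NambuPoisson.bracket (k := k) v ≠ 0) ∧
  GKdim k ν.Gr = GKdim k N

/-- The valuation `ν` of `Q(B)` is the one given by the filtration `F` of `B`, that is,
`F_i = {f ∈ B | ν f ≥ i}` (as `ν (f / g) = ν f - ν g`, there is at most one such `ν`). -/
def IsGivenBy [CharZero k] {B : Type*} [CommRing B] [IsDomain B] [Algebra k B] [NambuPoisson k n B]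
    (ν : ZeroValuation k n (FractionRing B)) (F : ℤ → Submodule k B) : Prop :=
  ∀ (i : ℤ) (f : B), f ∈ F i ↔ (i : WithTop ℤ) ≤ ν (algebraMap B (FractionRing B) f)

end ZeroValuation

/-- A (bundled) Nambu-Poisson field over `k`. -/
structure NambuPoissonField (k : Type u) [Field k] (n : ℕ) : Type (u + 1) where
  carrier : Type u
  [field : Field carrier]
  [algebra : Algebra k carrier]
  [nambuPoisson : NambuPoisson k n carrier]

attribute [instance] NambuPoissonField.field NambuPoissonField.algebra
  NambuPoissonField.nambuPoisson

namespace NambuPoissonField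

variable {k : Type u} [Field k] {n : ℕ}

/-- Isomorphism of Nambu-Poisson fields. -/
def Iso (M N : NambuPoissonField k n) : Prop :=
  ∃ e : M.carrier ≃ₐ[k] N.carrier, ∀ v : Fin n → M.carrier,
    e (NambuPoisson.bracket (k := k) v) = NambuPoisson.bracket (k := k) fun i => e (v i)

variable (k n) in
/-- Isomorphism of Nambu-Poisson fields is an equivalence relation. -/
def isoSetoid : Setoid (NambuPoissonField k n) where
  r := Iso
  iseqv :=
    { refl := fun _ => ⟨AlgEquiv.refl, fun _ => rfl⟩
      symm := by
        rintro M N ⟨e, he⟩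
        refine ⟨e.symm, fun v => ?_⟩
        rw [e.symm_apply_eq, he]
        simp
      trans := by
        rintro L M N ⟨e, he⟩ ⟨f, hf⟩
        exact ⟨e.trans f, fun v => by simp [he, hf]⟩ }

variable [CharZero k]

/-- The Nambu-Poisson fraction field `Q(A)` of a Nambu-Poisson domain `A`. -/
noncomputable def Q (k : Type u) [Field k] [CharZero k] (n : ℕ) (A : Type u) [CommRing A]
    [IsDomain A] [Algebra k A] [NambuPoisson k n A] : NambuPoissonField k n where
  carrier := FractionRing A

/-- `N →_ν Q`: the Nambu-Poisson field `Q` is isomorphic to the Nambu-Poisson fraction field of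
`gr_ν(N)`. -/
def Arrow (N : NambuPoissonField k n) (ν : ZeroValuation k n N.carrier)
    (Q' : NambuPoissonField k n) : Prop := Q'.Iso (Q k n ν.Gr)

/-- The depth of `N`: the supremum of the lengths `l` of chains
`N = N_0 →_{ν_1} N_1 → ⋯ →_{ν_l} N_l` with all `ν_i` faithful and with the `N_i` pairwise
non-isomorphic. -/
noncomputable def depth (N : NambuPoissonField k n) : ℕ∞ :=
  ⨆ (l : ℕ) (_ : ∃ C : Fin (l + 1) → NambuPoissonField k n, C 0 = N ∧
    (∀ i : Fin l, ∃ ν : ZeroValuation k n (C i.castSucc).carrier,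
      ν.IsFaithful ∧ (C i.castSucc).Arrow ν (C i.succ)) ∧
    ∀ i j, i ≠ j → ¬ (C i).Iso (C j)), (l : ℕ∞)

/-- The width of `N`: the number of isomorphism classes of Nambu-Poisson fields `Q'` with
`N →_ν Q'` for some faithful `0`-valuation `ν`. -/
noncomputable def width (N : NambuPoissonField k n) : ℕ∞ :=
  Set.encard (Quotient.mk (isoSetoid k n) '' {Q' | ∃ ν : ZeroValuation k n N.carrier,
    ν.IsFaithful ∧ N.Arrow ν Q'})

end NambuPoissonField

/-! ### Potentials with an isolated singularity and the natural filtrations -/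

namespace NambuPoisson

variable {k : Type u} [Field k] {n : ℕ}

/-- `Ω` has an isolated singularity (at the origin): `k[t_1, …, t_{n+1}] / (∂Ω/∂t_1, …, ∂Ω/∂t_{n+1})`
is finite-dimensional. -/
def HasIsolatedSingularity (Ω : MvPolynomial (Fin (n + 1)) k) : Prop :=
  Module.Finite k (MvPolynomial (Fin (n + 1)) k ⧸
    Ideal.span (Set.range fun j => MvPolynomial.pderiv j Ω))

/-- The filtration of `P_{Ω-ξ}` determined by `deg t_j = r` for all `j`: the `i`-th piece is spanned
by the (images of the) monomials of total degree `d` with `r d ≥ i`. For homogeneous `Ω` and `ξ = 0`,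
the `i`-th piece is the sum of the components of `P_Ω` of Adams degree `d ≥ i` if `r = 1`, and of
those with `-d ≥ i` if `r = -1`. -/
noncomputable def degFiltration (Ω : MvPolynomial (Fin (n + 1)) k) (ξ : k) (r i : ℤ) :
    Submodule k (NambuHyp Ω ξ) :=
  Submodule.span k {x | ∃ m : Fin (n + 1) →₀ ℕ, i ≤ r * (∑ j, (m j : ℤ)) ∧
    x = Ideal.Quotient.mk (nambuIdeal Ω ξ)
      (MvPolynomial.monomial m 1 : MvPolynomial (Fin (n + 1)) k)}

end NambuPoisson

/-!
Both fields `Q(P_Ω)` and `Q(P_{Ω-1})` are treated as one case: a Nambu-Poisson field `N` with a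
*presentation* by `Ω - ξ`, that is, a bracket preserving homomorphism from the polynomial ring to
`N` with kernel `(Ω - ξ)` whose image generates `N` as a field (`NambuPoisson.Presentation`). Such
a field is unique up to isomorphism (`Presentation.iso`).

**Algebra of `Ω`.** An isolated singularity in at least three variables forces the homogeneous
polynomial `Ω` to be prime (`HasIsolatedSingularity.prime`): the Jacobian ideal contains
powers of all variables, but it lies in the ideal generated by any two factors, which would have
height at most two. The same holds for `Ω - ξ` (`prime_sub_C`),
since leading forms multiply. Modulo `Ω - ξ`, every nonzero polynomial has a representative whose
extreme component (lowest or highest, according to the sign of the weight `r`) is not divisible by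
`Ω` (`exists_isLead`). The degree of that component is well defined and gives the valuations
`ν^{Id}`, `ν^{-Id}` and `ν^c` (`hypValuation`); the bracket of `n` polynomials of degrees `d_1, …,
d_n` has degree `∑ d_s` because `Ω` has degree `n + 1`.

**Classification.** Let `ν` be a `0`-valuation of `N`, and `m` the smallest value of the
coordinates. Sending each coordinate to its class in degree `m` defines a bracket preserving
homomorphism `grMap` from the polynomial ring to the domain `gr_ν(N)`. Its kernel is stable under
the bracket. The key lemma (`dvd_of_map_eq_zero`) says that a homomorphism to a domain whose
kernel is bracket stable, contains a prime element `P`, and does not contain all partial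
derivatives of `Ω`, has kernel `(P)`: by stability, the gradient of every element of the kernel is
proportional to that of `Ω` modulo the kernel, while two independent algebraic relations between
the coordinates would have non-proportional gradients; so the image has transcendence degree `n`,
and its kernel is `(P)`. As the singularity is isolated, some partial derivative of `Ω` is indeed
not in the kernel of `grMap`. If `m = 0`, the key lemma with `P = Ω - ξ` shows that `ν` is
trivial. If `m ≠ 0`, then `m < 0` or `ξ = 0`, and the key lemma with `P = Ω` shows that `grMap`
has kernel `(Ω)` (`exists_grMap_ker`). So `ν` is `|m|` times the degree valuation of weight `r =
±1` (`exists_hasSlope`), and the fraction field of `gr_ν(N)` is again presented, by `Ω` itself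
(`nonempty_gr_presentation`).

**Faithfulness.** The bracket of `gr_ν(N)` is nonzero since the partial derivatives of `Ω` are
brackets of coordinates. The Gelfand-Kirillov dimensions of `gr_ν(N)` and `N` agree because
passing to fraction fields does not change that dimension (`GKdim_fractionRing`) and the dimension
of the space of polynomial functions of degree at most `e` on the hypersurface `Ω = ξ` does not
depend on `ξ` (`finrank_map_hypMk_affineForms_pow`). Hence `ν` is faithful exactly when it is
surjective.

**Depth and width.** Every faithful arrow from a presented field ends in the class of `Q(P_Ω)`, so the
width is `1` and the depth at most `1`. The fields `Q(P_Ω)` and `Q(P_{Ω-1})` are not isomorphic,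
since they have two classes and one class of nontrivial `0`-valuations, respectively.
-/

/-! ### Polynomials whose monomials have bounded degree -/

namespace MvPolynomial

section DegGE
variable {σ : Type*} {k : Type*} [Field k]

/-- The polynomials all of whose monomials `m` satisfy `i ≤ r * deg m`. For `r = 1` this bounds the
order from below, for `r = -1` it bounds the total degree from above; treating both signs at once
treats the two filtrations at once. -/
def degGE (σ : Type*) (k : Type*) [Field k] (r i : ℤ) : Submodule k (MvPolynomial σ k) where
  carrier := {f | ∀ m, coeff m f ≠ 0 → i ≤ r * (m.degree : ℤ)}
  zero_mem' := by simp
  add_mem' {f g} hf hg m hm := by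
    by_cases h : coeff m f = 0
    · refine hg m fun h' => hm ?_
      simp [h, h']
    · exact hf m h
  smul_mem' c f hf m hm := hf m fun h => hm (by simp [h])

variable {r i j : ℤ} {f g : MvPolynomial σ k}

theorem degGE_anti (h : i ≤ j) : degGE σ k r j ≤ degGE σ k r i := fun _ hf m hm =>
  h.trans (hf m hm)

theorem mul_mem_degGE (hf : f ∈ degGE σ k r i) (hg : g ∈ degGE σ k r j) :
    f * g ∈ degGE σ k r (i + j) := by
  classical
  intro m hm
  rw [coeff_mul] at hm
  obtain ⟨⟨a, b⟩, hab, h⟩ := Finset.exists_ne_zero_of_sum_ne_zero hm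
  rw [Finset.HasAntidiagonal.mem_antidiagonal] at hab
  have h1 := hf a (left_ne_zero_of_mul h)
  have h2 := hg b (right_ne_zero_of_mul h)
  have : (m.degree : ℤ) = a.degree + b.degree := by
    rw [← hab]; push_cast [map_add]; rfl
  rw [this, mul_add]
  exact add_le_add h1 h2

theorem prod_mem_degGE {ι : Type*} (s : Finset ι) {p : ι → ℤ} {F : ι → MvPolynomial σ k}
    (h : ∀ a ∈ s, F a ∈ degGE σ k r (p a)) : ∏ a ∈ s, F a ∈ degGE σ k r (∑ a ∈ s, p a) := by
  classical
  induction s using Finset.induction_on with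
  | empty =>
    intro m hm
    simp only [Finset.prod_empty, coeff_one] at hm
    obtain rfl : 0 = m := by by_contra h; simp [h] at hm
    simp
  | insert a s ha ih =>
    rw [Finset.prod_insert ha, Finset.sum_insert ha]
    exact mul_mem_degGE (h _ (Finset.mem_insert_self _ _))
      (ih fun b hb => h b (Finset.mem_insert_of_mem hb))

theorem monomial_mem_degGE {m : σ →₀ ℕ} {c : k} (h : i ≤ r * (m.degree : ℤ)) :
    monomial m c ∈ degGE σ k r i := by
  classical
  intro m' hm'
  rw [coeff_monomial] at hm'
  obtain rfl : m = m' := by by_contra h; simp [h] at hm'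
  exact h

theorem pderiv_mem_degGE (l : σ) (hf : f ∈ degGE σ k r i) : pderiv l f ∈ degGE σ k r (i - r) := by
  intro m hm
  rw [coeff_pderiv] at hm
  have h1 := hf _ (left_ne_zero_of_mul hm)
  rw [map_add, Finsupp.degree_single] at h1
  push_cast at h1
  linarith

theorem IsHomogeneous.mem_degGE {d : ℕ} (hf : f.IsHomogeneous d) : f ∈ degGE σ k r (r * d) := by
  intro m hm
  have : m.degree = d := by
    by_contra h
    exact hm (hf.coeff_eq_zero h)
  rw [this]

theorem exists_mem_degGE (f : MvPolynomial σ k) (r : ℤ) : ∃ i, f ∈ degGE σ k r i := by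
  refine ⟨-|r| * f.totalDegree, fun m hm => ?_⟩
  have h := le_totalDegree (mem_support_iff.mpr hm)
  have h' : (m.degree : ℤ) ≤ f.totalDegree := by exact_mod_cast h
  nlinarith [neg_abs_le r, abs_nonneg r, (Int.natCast_nonneg m.degree)]

theorem homogeneousComponent_eq_zero_of_mem_degGE {d : ℕ} (hf : f ∈ degGE σ k r i)
    (h : r * d < i) : homogeneousComponent d f = 0 := by
  refine homogeneousComponent_eq_zero' _ _ fun m hm hd => ?_
  have := hf m (mem_support_iff.mp hm)
  rw [hd] at this
  omega

theorem sub_homogeneousComponent_mem_degGE {d : ℕ} (hr : r ≠ 0) (hf : f ∈ degGE σ k r (r * d)) :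
    f - homogeneousComponent d f ∈ degGE σ k r (r * d + 1) := by
  intro m hm
  rw [coeff_sub, coeff_homogeneousComponent] at hm
  split_ifs at hm with h
  · simp at hm
  · rw [sub_zero] at hm
    have h1 := hf m hm
    have h2 : r * (m.degree : ℤ) ≠ r * d := fun h' => h (by exact_mod_cast mul_left_cancel₀ hr h')
    omega

/-- Extreme components multiply. -/
theorem homogeneousComponent_mul_of_mem_degGE {a b : ℕ} (hr : r ≠ 0)
    (hf : f ∈ degGE σ k r (r * a)) (hg : g ∈ degGE σ k r (r * b)) :
    homogeneousComponent (a + b) (f * g) =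
      homogeneousComponent a f * homogeneousComponent b g := by
  have hf' := sub_homogeneousComponent_mem_degGE hr hf
  have hg' := sub_homogeneousComponent_mem_degGE hr hg
  have hfa := homogeneousComponent_isHomogeneous a f
  have hgb := homogeneousComponent_isHomogeneous b g
  have e : f * g = homogeneousComponent a f * homogeneousComponent b g +
      (homogeneousComponent a f * (g - homogeneousComponent b g) +
        (f - homogeneousComponent a f) * g) := by ring
  have h1 := mul_mem_degGE (hfa.mem_degGE (r := r)) hg'
  have h2 := mul_mem_degGE hf' hg
  have h : homogeneousComponent a f * (g - homogeneousComponent b g) +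
        (f - homogeneousComponent a f) * g ∈ degGE σ k r (r * (a + b : ℕ) + 1) := by
    refine add_mem (degGE_anti ?_ h1) (degGE_anti ?_ h2) <;> push_cast <;> linarith
  have h0 := homogeneousComponent_eq_zero_of_mem_degGE (d := a + b) h (by omega)
  rw [e, map_add, h0, add_zero, homogeneousComponent_eq_self (hfa.mul hgb)]

/-- Every nonzero polynomial has an extreme component. -/
theorem exists_extreme (r : ℤ) (hf : f ≠ 0) :
    ∃ d : ℕ, f ∈ degGE σ k r (r * d) ∧ homogeneousComponent d f ≠ 0 := by
  classical
  have hs : f.support.Nonempty := support_nonempty.mpr hf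
  obtain ⟨m, hm, hmin⟩ := f.support.exists_min_image (fun m => r * (m.degree : ℤ)) hs
  refine ⟨m.degree, fun m' hm' => hmin _ (mem_support_iff.mpr hm'), fun h => ?_⟩
  have := congrArg (coeff m) h
  rw [coeff_homogeneousComponent, if_pos rfl, coeff_zero] at this
  exact mem_support_iff.mp hm this

theorem isHomogeneous_of_mem_degGE {d : ℕ} (h1 : f ∈ degGE σ k 1 (1 * d))
    (h2 : f ∈ degGE σ k (-1) (-1 * d)) : f.IsHomogeneous d := by
  rw [← sum_homogeneousComponent f]
  refine IsHomogeneous.sum _ _ _ fun i _ => ?_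
  by_cases hid : i = d
  · rw [hid]; exact homogeneousComponent_isHomogeneous _ _
  · rcases lt_or_gt_of_ne hid with h | h
    · rw [homogeneousComponent_eq_zero_of_mem_degGE h1 (by omega)]
      exact isHomogeneous_zero _ _ _
    · rw [homogeneousComponent_eq_zero_of_mem_degGE h2 (by omega)]
      exact isHomogeneous_zero _ _ _

/-- A factor of a homogeneous polynomial is homogeneous. -/
theorem IsHomogeneous.of_mul_left {d : ℕ} (h : (f * g).IsHomogeneous d) (hne : f * g ≠ 0) :
    ∃ a b : ℕ, a + b = d ∧ f.IsHomogeneous a ∧ g.IsHomogeneous b := by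
  have hf := left_ne_zero_of_mul hne
  have hg := right_ne_zero_of_mul hne
  have key : ∀ r : ℤ, r ≠ 0 → ∃ a b : ℕ, a + b = d ∧ f ∈ degGE σ k r (r * a) ∧
      g ∈ degGE σ k r (r * b) := by
    intro r hr
    obtain ⟨a, ha, ha'⟩ := exists_extreme r hf
    obtain ⟨b, hb, hb'⟩ := exists_extreme r hg
    refine ⟨a, b, ?_, ha, hb⟩
    have h1 := homogeneousComponent_mul_of_mem_degGE hr ha hb
    by_contra hab
    rw [homogeneousComponent_of_mem h, if_neg hab] at h1
    exact mul_ne_zero ha' hb' h1.symm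
  obtain ⟨a, b, hab, ha, hb⟩ := key 1 one_ne_zero
  obtain ⟨a', b', hab', ha', hb'⟩ := key (-1) (by norm_num)
  have le : ∀ {p : MvPolynomial σ k} {x y : ℕ}, p ≠ 0 → p ∈ degGE σ k 1 (1 * x) →
      p ∈ degGE σ k (-1) (-1 * y) → x ≤ y := by
    intro p x y hp h1 h2
    obtain ⟨m, hm⟩ := support_nonempty.mpr hp
    have h3 := h1 m (mem_support_iff.mp hm)
    have h4 := h2 m (mem_support_iff.mp hm)
    omega
  have l1 := le hf ha ha'
  have l2 := le hg hb hb'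
  obtain rfl : a' = a := by omega
  obtain rfl : b' = b := by omega
  exact ⟨a', b', hab, isHomogeneous_of_mem_degGE ha ha', isHomogeneous_of_mem_degGE hb hb'⟩

theorem homogeneousComponent_isHomogeneous_mul {a d : ℕ} (hf : f.IsHomogeneous a) (h : a ≤ d) :
    homogeneousComponent d (f * g) = f * homogeneousComponent (d - a) g := by
  conv_lhs => rw [← sum_homogeneousComponent g, Finset.mul_sum, map_sum]
  have e : ∀ i, homogeneousComponent d (f * homogeneousComponent i g) =
      if i = d - a then f * homogeneousComponent i g else 0 := by
    intro i
    rw [homogeneousComponent_of_mem (hf.mul (homogeneousComponent_isHomogeneous i g))]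
    congr 1
    ext; constructor <;> intro <;> omega
  simp only [e]
  rw [Finset.sum_ite_eq']
  split_ifs with h'
  · rfl
  · rw [homogeneousComponent_eq_zero, mul_zero]
    rw [Finset.mem_range] at h'
    omega

theorem homogeneousComponent_isHomogeneous_mul_of_lt {a d : ℕ} (hf : f.IsHomogeneous a)
    (h : d < a) : homogeneousComponent d (f * g) = 0 := by
  conv_lhs => rw [← sum_homogeneousComponent g, Finset.mul_sum, map_sum]
  refine Finset.sum_eq_zero fun i _ => ?_
  rw [homogeneousComponent_of_mem (hf.mul (homogeneousComponent_isHomogeneous i g)), if_neg]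
  omega

/-- A homogeneous polynomial that divides a polynomial divides all its components. -/
theorem IsHomogeneous.dvd_homogeneousComponent {a : ℕ} (hf : f.IsHomogeneous a) (h : f ∣ g)
    (d : ℕ) : f ∣ homogeneousComponent d g := by
  obtain ⟨q, rfl⟩ := h
  rcases le_or_gt a d with had | had
  · exact ⟨_, homogeneousComponent_isHomogeneous_mul hf had⟩
  · rw [homogeneousComponent_isHomogeneous_mul_of_lt hf had]; exact dvd_zero _

theorem IsHomogeneous.not_dvd_of_lt {a d : ℕ} (hf : f.IsHomogeneous a) (hg : g.IsHomogeneous d)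
    (hg0 : g ≠ 0) (h : d < a) : ¬ f ∣ g := by
  rintro ⟨q, rfl⟩
  have := homogeneousComponent_isHomogeneous_mul_of_lt (g := q) hf h
  rw [homogeneousComponent_eq_self hg] at this
  exact hg0 this

end DegGE

end MvPolynomial

/-! ### Isolated singularities and irreducibility -/

namespace NambuPoisson

open MvPolynomial

variable {k : Type u} [Field k] {n : ℕ} {Ω : MvPolynomial (Fin (n + 1)) k}

/-- The ideal generated by the partial derivatives of `Ω`. -/
noncomputable def jacobianIdeal (Ω : MvPolynomial (Fin (n + 1)) k) :
    Ideal (MvPolynomial (Fin (n + 1)) k) :=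
  Ideal.span (Set.range fun j => pderiv j Ω)

attribute [local instance] MvPolynomial.gradedAlgebra in
theorem jacobianIdeal_isHomogeneous {d : ℕ} (hΩ : Ω.IsHomogeneous d) :
    (jacobianIdeal Ω).IsHomogeneous (homogeneousSubmodule (Fin (n + 1)) k) := by
  refine Ideal.homogeneous_span _ _ ?_
  rintro _ ⟨j, rfl⟩
  exact ⟨d - 1, hΩ.pderiv⟩

attribute [local instance] MvPolynomial.gradedAlgebra in
/-- The powers of a variable are linearly dependent modulo the Jacobian ideal, and the Jacobian ideal
is homogeneous. -/
theorem HasIsolatedSingularity.exists_X_pow_mem {d : ℕ} (hΩ : Ω.IsHomogeneous d)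
    (h : HasIsolatedSingularity Ω) (l : Fin (n + 1)) :
    ∃ M : ℕ, (X l : MvPolynomial (Fin (n + 1)) k) ^ M ∈ jacobianIdeal Ω := by
  have hfin : Module.Finite k (MvPolynomial (Fin (n + 1)) k ⧸ jacobianIdeal Ω) := h
  have hint : IsIntegral k (Ideal.Quotient.mkₐ k (jacobianIdeal Ω) (X l)) :=
    Algebra.IsIntegral.isIntegral _
  obtain ⟨p, hp, hp0⟩ := hint
  refine ⟨p.natDegree, ?_⟩
  have h1 : Polynomial.aeval (X l : MvPolynomial (Fin (n + 1)) k) p ∈ jacobianIdeal Ω := by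
    rw [← Ideal.Quotient.eq_zero_iff_mem, ← Ideal.Quotient.mkₐ_eq_mk k,
      ← Polynomial.aeval_algHom_apply]
    exact hp0
  have h2 := homogeneousComponent_mem_of_mem (jacobianIdeal_isHomogeneous hΩ) h1 p.natDegree
  have h3 : homogeneousComponent p.natDegree (Polynomial.aeval (X l) p) =
      (X l : MvPolynomial (Fin (n + 1)) k) ^ p.natDegree := by
    rw [Polynomial.aeval_eq_sum_range, map_sum, Finset.sum_eq_single p.natDegree]
    · rw [map_smul, homogeneousComponent_eq_self (isHomogeneous_X_pow _ _), hp.coeff_natDegree,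
        one_smul]
    · intro b _ hb
      rw [map_smul, homogeneousComponent_of_mem (isHomogeneous_X_pow _ _), if_neg hb.symm, smul_zero]
    · simp
  rwa [h3] at h2

theorem HasIsolatedSingularity.ne_zero (h : HasIsolatedSingularity Ω) : Ω ≠ 0 := by
  rintro rfl
  obtain ⟨M, hM⟩ := h.exists_X_pow_mem (isHomogeneous_zero _ _ 0) 0
  have : jacobianIdeal (0 : MvPolynomial (Fin (n + 1)) k) = ⊥ := by
    simp [jacobianIdeal]
  rw [this, Ideal.mem_bot] at hM
  exact pow_ne_zero _ (X_ne_zero _) hM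

/-- The homogeneous maximal ideal contains a chain of primes generated by variables. -/
theorem three_le_height_ker_constantCoeff (hn : 2 ≤ n) :
    3 ≤ (RingHom.ker (aeval (R := k) fun _ : Fin (n + 1) => (0 : k))).height := by
  let P : ℕ → Ideal (MvPolynomial (Fin (n + 1)) k) := fun a =>
    RingHom.ker (aeval (R := k) fun i : Fin (n + 1) =>
      if (i : ℕ) < a then (0 : MvPolynomial (Fin (n + 1)) k) else X i)
  have hprime : ∀ a, (P a).IsPrime := fun a => RingHom.ker_isPrime _
  have hlt : ∀ a, a < n + 1 → P a < P (a + 1) := by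
    intro a ha
    refine lt_of_le_of_ne ?_ fun h => ?_
    · intro f hf
      rw [RingHom.mem_ker] at hf ⊢
      have e : (aeval (R := k) fun i : Fin (n + 1) =>
          if (i : ℕ) < a + 1 then (0 : MvPolynomial (Fin (n + 1)) k) else X i) =
          (aeval (R := k) fun i : Fin (n + 1) =>
          if (i : ℕ) < a + 1 then (0 : MvPolynomial (Fin (n + 1)) k) else X i).comp
          (aeval (R := k) fun i : Fin (n + 1) =>
          if (i : ℕ) < a then (0 : MvPolynomial (Fin (n + 1)) k) else X i) := by
        refine algHom_ext fun i => ?_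
        simp only [AlgHom.comp_apply, aeval_X]
        split_ifs with h1 h2 h2
        · rw [map_zero]
        · rw [aeval_X, if_pos h1]
        · omega
        · rw [aeval_X, if_neg h1]
      rw [e, AlgHom.comp_apply, hf, map_zero]
    · have : (X ⟨a, ha⟩ : MvPolynomial (Fin (n + 1)) k) ∈ P (a + 1) := by
        simp [P, RingHom.mem_ker]
      rw [← h] at this
      simp [P, RingHom.mem_ker] at this
  have hheight : ∀ a : ℕ, a ≤ n + 1 → (a : ℕ∞) ≤ (P a).height := by
    intro a
    induction a with
    | zero => simp
    | succ a ih =>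
      intro ha
      have := hprime a
      have := hprime (a + 1)
      have h1 := Ideal.height_add_one_le_of_lt_of_isPrime (hlt a (by omega))
      push_cast
      exact (add_le_add_left (ih (by omega)) 1).trans h1
  refine (hheight 3 (by omega)).trans (Ideal.height_mono fun f hf => ?_)
  rw [RingHom.mem_ker] at hf ⊢
  have := congrArg (aeval fun _ : Fin (n + 1) => (0 : k)) hf
  rw [map_zero] at this
  rw [← AlgHom.comp_apply] at this
  refine Eq.trans (DFunLike.congr_fun (algHom_ext fun i => ?_) f) this
  simp only [AlgHom.comp_apply, aeval_X]
  split_ifs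
  · rw [map_zero]
  · rw [aeval_X]

/-- If `Ω = f g` with `f`, `g` homogeneous of positive degree, then the Jacobian ideal lies in
`(f, g)`, so the homogeneous maximal ideal is a minimal prime of `(f, g)`, against Krull's height
theorem. -/
theorem HasIsolatedSingularity.irreducible (hn : 2 ≤ n) {d : ℕ} (hd : d ≠ 0)
    (hΩ : Ω.IsHomogeneous d) (h : HasIsolatedSingularity Ω) : Irreducible Ω := by
  have h0 := h.ne_zero
  have hunit : ∀ {f : MvPolynomial (Fin (n + 1)) k} {a : ℕ}, f.IsHomogeneous a → a ≠ 0 →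
      aeval (fun _ : Fin (n + 1) => (0 : k)) f = 0 := by
    intro f a hf ha
    have h1 : coeff 0 f = 0 := hf.coeff_eq_zero (by simpa using ha.symm)
    have h2 : aeval (fun _ : Fin (n + 1) => (0 : k)) f = constantCoeff f := by
      exact aeval_zero' f
    rw [h2]
    exact h1
  refine ⟨fun hu => ?_, ?_⟩
  · have := hu.map (aeval fun _ : Fin (n + 1) => (0 : k))
    rw [hunit hΩ hd] at this
    exact not_isUnit_zero this
  intro f g hfg
  subst hfg
  obtain ⟨a, b, hab, hf, hg⟩ := hΩ.of_mul_left h0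
  have isUnit_of : ∀ {f : MvPolynomial (Fin (n + 1)) k}, f ≠ 0 → f.IsHomogeneous 0 →
      IsUnit f := by
    intro f hf0 hf
    rw [← totalDegree_zero_iff_isHomogeneous, totalDegree_eq_zero_iff_eq_C] at hf
    rw [hf] at hf0 ⊢
    refine (Ne.isUnit fun h => hf0 ?_).map C
    rw [h, map_zero]
  by_cases ha : a = 0
  · subst ha; exact Or.inl (isUnit_of (left_ne_zero_of_mul h0) hf)
  by_cases hb : b = 0
  · subst hb; exact Or.inr (isUnit_of (right_ne_zero_of_mul h0) hg)
  exfalso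
  let 𝔪 := RingHom.ker (aeval (R := k) fun _ : Fin (n + 1) => (0 : k))
  have hm : 𝔪 ∈ (Ideal.span {f, g}).minimalPrimes := by
    refine ⟨⟨RingHom.ker_isPrime _, ?_⟩, ?_⟩
    · rw [Ideal.span_le]
      rintro x (rfl | rfl)
      · exact hunit hf ha
      · exact hunit hg hb
    · rintro q ⟨hq, hfgq⟩ - x hx
      have hJ : jacobianIdeal (f * g) ≤ q := by
        refine Ideal.span_le.mpr ?_
        rintro _ ⟨j, rfl⟩
        change pderiv j (f * g) ∈ q
        rw [pderiv_mul]
        exact add_mem (q.mul_mem_left _ (hfgq (Ideal.subset_span (by simp))))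
          (q.mul_mem_right _ (hfgq (Ideal.subset_span (by simp))))
      have hX : ∀ l, (X l : MvPolynomial (Fin (n + 1)) k) ∈ q := by
        intro l
        obtain ⟨M, hM⟩ := h.exists_X_pow_mem hΩ l
        exact hq.mem_of_pow_mem _ (hJ hM)
      rw [← Ideal.Quotient.eq_zero_iff_mem, ← Ideal.Quotient.mkₐ_eq_mk k]
      have e : Ideal.Quotient.mkₐ k q =
          (Algebra.ofId k _).comp (aeval fun _ : Fin (n + 1) => (0 : k)) := by
        refine algHom_ext fun i => ?_
        rw [AlgHom.comp_apply, aeval_X, map_zero]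
        exact Ideal.Quotient.eq_zero_iff_mem.mpr (hX i)
      rw [e, AlgHom.comp_apply]
      have : aeval (fun _ : Fin (n + 1) => (0 : k)) x = 0 := hx
      rw [this, map_zero]
  have h1 := Ideal.height_le_card_of_mem_minimalPrimes_span (Set.toFinite _) hm
  have h2 : Set.ncard {f, g} ≤ 2 := (Set.ncard_insert_le f {g}).trans (by simp)
  have h3 := (three_le_height_ker_constantCoeff (k := k) hn).trans h1
  have h4 : 3 ≤ Set.ncard {f, g} := by exact_mod_cast h3
  omega

theorem HasIsolatedSingularity.prime (hn : 2 ≤ n) {d : ℕ} (hd : d ≠ 0)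
    (hΩ : Ω.IsHomogeneous d) (h : HasIsolatedSingularity Ω) : Prime Ω :=
  (h.irreducible hn hd hΩ).prime

end NambuPoisson

/-! ### Prime ideals that are stable under the bracket -/

namespace NambuPoisson

open MvPolynomial

section Minors
variable {k : Type u} [Field k] {m : ℕ}

theorem jacobianDet_X_comp (τ : Equiv.Perm (Fin m)) :
    jacobianDet k m (fun i => X (τ i)) = ((Equiv.Perm.sign τ : ℤˣ) : ℤ) • 1 := by
  have h := (jacobianDet k m).map_perm X τ
  have h1 : jacobianDet k m (X : Fin m → MvPolynomial (Fin m) k) = 1 := by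
    change Matrix.det _ = _
    rw [← Matrix.det_one (n := Fin m)]
    congr 1
    ext1 i j
    simp [pderiv_X, Matrix.one_apply, Pi.single_apply]
  rw [h1, Units.smul_def] at h
  exact h

/-- The Jacobian determinant of `f`, `g` and all but two of the coordinates is, up to sign, a
`2 × 2` minor of the gradients of `f` and `g`. -/
theorem jacobianDet_update_update (τ : Equiv.Perm (Fin m)) {a b : Fin m} (hab : a ≠ b)
    (f g : MvPolynomial (Fin m) k) :
    jacobianDet k m (update (update (fun i => X (τ i)) b g) a f) =
      (Equiv.Perm.sign τ : ℤ) • (pderiv (τ a) f * pderiv (τ b) g -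
        pderiv (τ b) f * pderiv (τ a) g) := by
  set y : Fin m → MvPolynomial (Fin m) k := fun i => X (τ i) with hy
  set J := jacobianDet k m with hJ
  have hJy : J y = (Equiv.Perm.sign τ : ℤ) • 1 := jacobianDet_X_comp τ
  have h0 : ∀ q, q ≠ a → q ≠ b → ∀ p, J (update (update y b (y q)) a (y p)) = 0 := by
    intro q hqa hqb p
    refine J.map_eq_zero_of_eq _ (i := b) (j := q) ?_ (Ne.symm hqb)
    rw [update_of_ne (Ne.symm hab), update_self, update_of_ne hqa, update_of_ne hqb]
  have h1 : ∀ p, p ≠ a → J (update (update y b (y b)) a (y p)) = 0 := by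
    intro p hpa
    rw [update_eq_self]
    refine J.map_eq_zero_of_eq _ (i := a) (j := p) ?_ (Ne.symm hpa)
    rw [update_self, update_of_ne hpa]
  have h2 : ∀ p, p ≠ b → J (update (update y b (y a)) a (y p)) = 0 := by
    intro p hpb
    by_cases hpa : p = a
    · subst hpa
      refine J.map_eq_zero_of_eq _ (i := p) (j := b) ?_ hab
      rw [update_self, update_of_ne (Ne.symm hab), update_self]
    · refine J.map_eq_zero_of_eq _ (i := a) (j := p) ?_ (Ne.symm hpa)
      rw [update_self, update_of_ne hpa, update_of_ne hpb]
  have h3 : J (update (update y b (y a)) a (y b)) = - J y := by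
    rw [← J.map_swap y hab]
    congr 1
    ext1 c
    by_cases hca : c = a
    · subst hca; simp
    by_cases hcb : c = b
    · subst hcb; simp [hca]
    simp [hca, hcb, Equiv.swap_apply_of_ne_of_ne hca hcb]
  have hf : ∀ z, J (update z a f) = ∑ p, pderiv (τ p) f * J (update z a (y p)) := by
    intro z
    rw [hJ, jacobianDet_chain, ← Equiv.sum_comp τ]
  have hg : ∀ z, J (update z b g) = ∑ q, pderiv (τ q) g * J (update z b (y q)) := by
    intro z
    rw [hJ, jacobianDet_chain, ← Equiv.sum_comp τ]
  rw [update_comm hab.symm, hg, Finset.sum_eq_add a b hab]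
  · rw [update_comm hab, hf, Finset.sum_eq_single b, h3, update_comm hab, hf,
      Finset.sum_eq_single a, update_eq_self, update_eq_self, hJy]
    · simp only [zsmul_eq_mul]; ring
    · intro p _ hp
      rw [h1 p hp, mul_zero]
    · simp
    · intro p _ hp
      rw [h2 p hp, mul_zero]
    · simp
  · intro q _ hq
    rw [update_comm hab, hf, Finset.sum_eq_zero, mul_zero]
    intro p _
    rw [h0 q hq.1 hq.2, mul_zero]
  · simp
  · simp

theorem exists_perm_apply_apply {α : Type*} [DecidableEq α] {a b i j : α} (hab : a ≠ b)
    (hij : i ≠ j) : ∃ τ : Equiv.Perm α, τ a = i ∧ τ b = j := by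
  refine ⟨Equiv.swap (Equiv.swap a i b) j * Equiv.swap a i, ?_, by simp⟩
  rw [Equiv.Perm.mul_apply, Equiv.swap_apply_left, Equiv.swap_apply_of_ne_of_ne _ hij]
  intro h
  apply hab
  apply (Equiv.swap a i).injective
  rw [Equiv.swap_apply_left]
  exact h

end Minors

variable {k : Type u} [Field k] {n : ℕ} {Ω : MvPolynomial (Fin (n + 1)) k}
  {G : Type*} [CommRing G] [Algebra k G]

/-- If the kernel of `φ` is stable under the bracket, then modulo the kernel the gradient of every
element of the kernel is proportional to the gradient of `Ω`. -/
theorem gradient_proportional (hn : n ≠ 0) (φ : MvPolynomial (Fin (n + 1)) k →ₐ[k] G)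
    (hst : ∀ (v : Fin n → MvPolynomial (Fin (n + 1)) k) (i : Fin n), φ (v i) = 0 →
      φ (nambuPolyBracket Ω v) = 0)
    {f : MvPolynomial (Fin (n + 1)) k} (hf : φ f = 0) (i j : Fin (n + 1)) :
    φ (pderiv i f) * φ (pderiv j Ω) = φ (pderiv j f) * φ (pderiv i Ω) := by
  by_cases hij : i = j
  · subst hij; rfl
  let a : Fin n := ⟨0, Nat.pos_of_ne_zero hn⟩
  obtain ⟨τ, hi, hj⟩ := exists_perm_apply_apply (Fin.castSucc_lt_last a).ne hij
  have h := hst (update (fun s => X (τ s.castSucc)) a f) a (by simpa using hf)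
  have e : (Fin.snoc (fun s : Fin n => X (τ s.castSucc)) Ω :
      Fin (n + 1) → MvPolynomial (Fin (n + 1)) k) = update (fun i => X (τ i)) (Fin.last n) Ω := by
    ext1 c
    refine Fin.lastCases ?_ (fun c => ?_) c
    · simp
    · rw [Fin.snoc_castSucc, update_of_ne (Fin.castSucc_lt_last c).ne]
  rw [nambuPolyBracket_apply, snoc_update', e,
    jacobianDet_update_update τ (Fin.castSucc_lt_last a).ne, hi, hj, map_zsmul] at h
  have h' : φ (pderiv i f * pderiv j Ω - pderiv j f * pderiv i Ω) = 0 := by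
    rcases Int.units_eq_one_or (Equiv.Perm.sign τ) with h1 | h1
    · rwa [h1, Units.val_one, one_smul] at h
    · rwa [h1, Units.val_neg, Units.val_one, neg_smul, one_smul, neg_eq_zero] at h
  rwa [map_sub, map_mul, map_mul, sub_eq_zero] at h'

section Indep
variable {σ : Type*}

theorem mem_supported_of_pderiv_eq_zero [CharZero k] {s : Set σ} {i : σ} {p : MvPolynomial σ k}
    (hp : p ∈ supported k (insert i s)) (h : pderiv i p = 0) : p ∈ supported k s := by
  classical
  rw [mem_supported] at hp ⊢
  intro j hj
  refine (hp hj).resolve_left ?_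
  rintro rfl
  obtain ⟨m, hm, hjm⟩ := (mem_vars_iff_mem_support _).mp hj
  rw [mem_support_iff] at hm
  have h1 := congrArg (coeff (m - Finsupp.single j 1)) h
  have h2 : m - Finsupp.single j 1 + Finsupp.single j 1 = m :=
    tsub_add_cancel_of_le (Finsupp.single_le_iff.mpr
      (Nat.one_le_iff_ne_zero.mpr (Finsupp.mem_support_iff.mp hjm)))
  rw [coeff_pderiv, h2, coeff_zero] at h1
  have h3 := (mul_eq_zero.mp h1).resolve_left hm
  exact Nat.cast_add_one_ne_zero _ h3

theorem pderiv_mem_supported {s : Set σ} (i : σ) {p : MvPolynomial σ k}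
    (hp : p ∈ supported k s) : pderiv i p ∈ supported k s := by
  classical
  rw [mem_supported] at hp ⊢
  intro j hj
  obtain ⟨m, hm, hjm⟩ := (mem_vars_iff_mem_support _).mp hj
  rw [mem_support_iff, coeff_pderiv] at hm
  refine hp ((mem_vars_iff_mem_support _).mpr ⟨_, mem_support_iff.mpr (left_ne_zero_of_mul hm), ?_⟩)
  rw [Finsupp.mem_support_iff] at hjm ⊢
  rw [Finsupp.add_apply]
  omega

variable [CharZero k]

/-- If `t_i` is algebraically dependent on the algebraically independent `t_j`, `j ∈ s`, modulo the
kernel of `φ`, then this is witnessed by a relation that is separable in `t_i`: one of minimal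
degree. -/
theorem exists_separable_relation (φ : MvPolynomial σ k →ₐ[k] G) {s : Set σ} {i : σ}
    (hs : ∀ f ∈ supported k s, φ f = 0 → f = 0)
    (hi : ∃ f ∈ supported k (insert i s), φ f = 0 ∧ f ≠ 0) :
    ∃ p ∈ supported k (insert i s), φ p = 0 ∧ φ (pderiv i p) ≠ 0 := by
  classical
  have hex : ∃ d : ℕ, ∃ f ∈ supported k (insert i s), φ f = 0 ∧ f ≠ 0 ∧
      f ∈ degGE σ k (-1) (-d) := by
    obtain ⟨f, hf, hf0, hne⟩ := hi
    obtain ⟨d, hd⟩ := exists_mem_degGE f (-1)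
    exact ⟨d.natAbs, f, hf, hf0, hne, degGE_anti (by omega) hd⟩
  obtain ⟨p, hp, hp0, hpne, hpd⟩ := Nat.find_spec hex
  refine ⟨p, hp, hp0, fun h => ?_⟩
  by_cases hd : pderiv i p = 0
  · exact hpne (hs p (mem_supported_of_pderiv_eq_zero hp hd) hp0)
  · have h1 := pderiv_mem_degGE i hpd
    obtain ⟨m, hm⟩ := support_nonempty.mpr hd
    have h2 := h1 m (mem_support_iff.mp hm)
    have hpos : 0 < Nat.find hex := by omega
    refine Nat.find_min hex (m := Nat.find hex - 1) (by omega)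
      ⟨_, pderiv_mem_supported i hp, h, hd, degGE_anti (by omega) h1⟩

end Indep

/-- Modulo a prime polynomial `P`, a polynomial ring is algebraic over the subring generated by all
variables but one, as soon as these remain algebraically independent. So every `f` not divisible by `P`
divides, modulo `P`, a nonzero polynomial in which that variable does not occur. -/
theorem exists_supported_of_not_dvd {σ : Type*} {P : MvPolynomial σ k} (hP : Prime P) (i : σ)
    {f : MvPolynomial σ k} (hf : ¬ P ∣ f) :
    ∃ r ∈ supported k ({i}ᶜ : Set σ), r ≠ 0 ∧ ∃ q c, r = f * q + P * c := by
  classical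
  let S := supported k ({i}ᶜ : Set σ)
  let I := Ideal.span {P}
  have hI : I.IsPrime := (Ideal.span_singleton_prime hP.ne_zero).mpr hP
  let ρ : MvPolynomial σ k →ₐ[k] Polynomial S := aeval fun j =>
    if h : j = i then Polynomial.X else Polynomial.C ⟨X j, X_mem_supported.mpr h⟩
  have hρ : ∀ f, Polynomial.aeval (X i : MvPolynomial σ k) (ρ f) = f := by
    intro f
    have : ((Polynomial.aeval (R := S) (X i : MvPolynomial σ k)).restrictScalars k).comp ρ =
        AlgHom.id k _ := by
      refine algHom_ext fun j => ?_
      simp only [AlgHom.comp_apply, ρ, aeval_X, AlgHom.restrictScalars_apply]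
      split_ifs with h
      · subst h; simp
      · rw [Polynomial.aeval_C]; rfl
    exact DFunLike.congr_fun this f
  have hX : IsAlgebraic S (Ideal.Quotient.mkₐ S I (X i)) := by
    refine ⟨ρ P, fun h => ?_, ?_⟩
    · have := hρ P
      rw [h, map_zero] at this
      exact hP.ne_zero this.symm
    · rw [Polynomial.aeval_algHom_apply, hρ]
      exact Ideal.Quotient.eq_zero_iff_mem.mpr (Ideal.mem_span_singleton_self P)
  have halg : ∀ g, IsAlgebraic S (Ideal.Quotient.mkₐ S I g) := by
    intro g
    have : Nontrivial S := inferInstance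
    induction g using MvPolynomial.induction_on with
    | C a =>
      have := isAlgebraic_algebraMap (R := S) (A := MvPolynomial σ k ⧸ I) (algebraMap k S a)
      exact this
    | add p q hp hq => rw [map_add]; exact hp.add hq
    | mul_X p j hp =>
      rw [map_mul]
      refine hp.mul ?_
      by_cases h : j = i
      · rw [h]; exact hX
      · exact isAlgebraic_algebraMap (R := S) (A := MvPolynomial σ k ⧸ I)
          ⟨X j, X_mem_supported.mpr h⟩
  have hf0 : Ideal.Quotient.mkₐ S I f ≠ 0 := by
    intro h
    exact hf (Ideal.mem_span_singleton.mp (Ideal.Quotient.eq_zero_iff_mem.mp h))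
  obtain ⟨r, hr, hdvd⟩ := (halg f).exists_nonzero_dvd (mem_nonZeroDivisors_of_ne_zero hf0)
  obtain ⟨q, hq⟩ := hdvd
  obtain ⟨q, rfl⟩ := Ideal.Quotient.mk_surjective q
  refine ⟨r, r.2, by simpa using hr, q, ?_⟩
  have h1 : Ideal.Quotient.mk I (r : MvPolynomial σ k) = Ideal.Quotient.mk I (f * q) := by
    rw [map_mul]; exact hq
  obtain ⟨c, hc⟩ := Ideal.mem_span_singleton.mp (Ideal.Quotient.eq.mp h1)
  exact ⟨c, by rw [← hc]; ring⟩

/-- A bracket stable prime ideal that contains a prime element `P` but not all partial derivatives of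
`Ω` is `(P)`: along it all gradients are proportional to that of `Ω`, which leaves room for just one
algebraic relation between the coordinates. -/
theorem dvd_of_map_eq_zero [CharZero k] [IsDomain G] (hn : n ≠ 0)
    (φ : MvPolynomial (Fin (n + 1)) k →ₐ[k] G)
    (hst : ∀ (v : Fin n → MvPolynomial (Fin (n + 1)) k) (i : Fin n), φ (v i) = 0 →
      φ (nambuPolyBracket Ω v) = 0)
    (hne : ∃ j, φ (pderiv j Ω) ≠ 0) {P : MvPolynomial (Fin (n + 1)) k} (hP : Prime P)
    (hP0 : φ P = 0) {f : MvPolynomial (Fin (n + 1)) k} (hf : φ f = 0) : P ∣ f := by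
  classical
  let Indep : Finset (Fin (n + 1)) → Prop := fun s => ∀ f ∈ supported k (s : Set (Fin (n + 1))),
    φ f = 0 → f = 0
  have hempty : Indep ∅ := by
    intro f hf hf0
    rw [Finset.coe_empty, supported_empty, Algebra.mem_bot] at hf
    obtain ⟨c, rfl⟩ := hf
    rw [AlgHom.commutes] at hf0
    rw [(map_eq_zero_iff _ (FaithfulSMul.algebraMap_injective k G)).mp hf0, map_zero]
  -- `s` is a transcendence basis of the image of `φ` that consists of coordinates
  obtain ⟨s, hs, hmax⟩ := (Finset.univ.filter Indep).exists_maximal ⟨∅, by simpa using hempty⟩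
  have hsI : Indep s := (Finset.mem_filter.mp hs).2
  have hrel : ∀ i, i ∉ s → ∃ p ∈ supported k (insert i (s : Set (Fin (n + 1)))),
      φ p = 0 ∧ φ (pderiv i p) ≠ 0 := by
    intro i hi
    refine exists_separable_relation φ hsI ?_
    by_contra! hcon
    have : Indep (insert i s) := by
      intro f hf hf0
      rw [Finset.coe_insert] at hf
      exact hcon f hf hf0
    have := hmax (y := insert i s) (by simpa using this) (Finset.subset_insert i s)
    exact hi (this (Finset.mem_insert_self i s))
  -- two coordinates outside `s` would give two relations with non-proportional gradients
  have hunique : ∀ i i', i ∉ s → i' ∉ s → i = i' := by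
    intro i i' hi hi'
    by_contra hii
    obtain ⟨p, hp, hp0, hpi⟩ := hrel i hi
    obtain ⟨q, hq, hq0, hqi⟩ := hrel i' hi'
    have hpi' : pderiv i' p = 0 := by
      refine pderiv_eq_zero_of_notMem_vars fun h => ?_
      rcases mem_supported.mp hp h with h | h
      · exact hii h.symm
      · exact hi' h
    have h1 := gradient_proportional hn φ hst hp0 i i'
    rw [hpi', map_zero, zero_mul] at h1
    have h2 := (mul_eq_zero.mp h1).resolve_left hpi
    obtain ⟨j, hj⟩ := hne
    have h3 := gradient_proportional hn φ hst hq0 i' j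
    rw [h2, mul_zero] at h3
    exact (mul_ne_zero hqi hj) h3
  have hsne : ∃ i, i ∉ s := by
    by_contra! h
    refine hP.ne_zero (hsI P ?_ hP0)
    rw [mem_supported]
    exact fun i _ => h i
  obtain ⟨i, hi⟩ := hsne
  have hsi : (s : Set (Fin (n + 1))) = {i}ᶜ := by
    ext j
    simp only [Finset.mem_coe, Set.mem_compl_iff, Set.mem_singleton_iff]
    constructor
    · rintro h rfl; exact hi h
    · intro h
      by_contra hj
      exact h (hunique j i hj hi)
  by_contra hdvd
  obtain ⟨r, hr, hr0, q, c, hrq⟩ := exists_supported_of_not_dvd hP i hdvd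
  refine hr0 (hsI r (by rwa [hsi]) ?_)
  rw [hrq, map_add, map_mul, map_mul, hf, hP0, zero_mul, zero_mul, add_zero]

end NambuPoisson

/-! ### Leading components modulo `Ω - ξ` -/

namespace NambuPoisson

open MvPolynomial

variable {k : Type u} [Field k] {n : ℕ}

theorem jacobianDet_mem_degGE {m : ℕ} {r : ℤ} {p : Fin m → ℤ} {f : Fin m → MvPolynomial (Fin m) k}
    (h : ∀ i, f i ∈ degGE (Fin m) k r (p i)) :
    jacobianDet k m f ∈ degGE (Fin m) k r (∑ i, p i - m * r) := by
  change Matrix.det _ ∈ _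
  rw [Matrix.det_apply]
  refine sum_mem fun τ _ => ?_
  rw [Units.smul_def]
  refine zsmul_mem ?_ _
  have h1 := prod_mem_degGE (r := r) Finset.univ (p := fun i => p (τ i) - r)
    (F := fun i => Matrix.of (fun a j => pderiv j (f a)) (τ i) i)
    fun i _ => pderiv_mem_degGE i (h (τ i))
  rwa [Finset.sum_sub_distrib, Equiv.sum_comp τ p, Finset.sum_const, Finset.card_univ,
    Fintype.card_fin, nsmul_eq_mul] at h1

variable {Ω : MvPolynomial (Fin (n + 1)) k}

/-- As `Ω` has degree `n + 1`, the bracket is homogeneous of degree zero. -/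
theorem nambuPolyBracket_mem_degGE (hΩ : Ω.IsHomogeneous (n + 1)) {r : ℤ} {p : Fin n → ℤ}
    {v : Fin n → MvPolynomial (Fin (n + 1)) k} (h : ∀ i, v i ∈ degGE _ k r (p i)) :
    nambuPolyBracket Ω v ∈ degGE _ k r (∑ i, p i) := by
  have h1 := jacobianDet_mem_degGE (r := r) (p := Fin.snoc p (r * (n + 1 : ℕ)))
    (f := Fin.snoc v Ω) (fun i => ?_)
  · rw [Fin.sum_univ_castSucc] at h1
    simp only [Fin.snoc_castSucc, Fin.snoc_last] at h1
    rw [nambuPolyBracket_apply]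
    convert h1 using 2
    ring
  · refine Fin.lastCases ?_ (fun i => ?_) i
    · simpa only [Fin.snoc_last] using hΩ.mem_degGE
    · simpa only [Fin.snoc_castSucc] using h i

theorem nambuPolyBracket_isHomogeneous (hΩ : Ω.IsHomogeneous (n + 1)) {d : Fin n → ℕ}
    {v : Fin n → MvPolynomial (Fin (n + 1)) k} (h : ∀ i, (v i).IsHomogeneous (d i)) :
    (nambuPolyBracket Ω v).IsHomogeneous (∑ i, d i) := by
  have key : ∀ r : ℤ, nambuPolyBracket Ω v ∈ degGE _ k r (r * (∑ i, d i : ℕ)) := by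
    intro r
    have := nambuPolyBracket_mem_degGE hΩ (r := r) (p := fun i => r * d i) fun i => (h i).mem_degGE
    rwa [← Finset.mul_sum, ← Nat.cast_sum] at this
  exact isHomogeneous_of_mem_degGE (key 1) (key (-1))

/-- The component of degree `d` of `f` is extreme (lowest for `r > 0`, highest for `r < 0`) and is not
divisible by `Ω`. -/
def IsLead (Ω : MvPolynomial (Fin (n + 1)) k) (r : ℤ) (f : MvPolynomial (Fin (n + 1)) k) (d : ℕ) :
    Prop :=
  f ∈ degGE (Fin (n + 1)) k r (r * d) ∧ ¬ Ω ∣ homogeneousComponent d f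

namespace IsLead

variable {r : ℤ} {f g : MvPolynomial (Fin (n + 1)) k} {a b D : ℕ} {ξ : k}

theorem mul (hΩ : Prime Ω) (hr : r ≠ 0) (hf : IsLead Ω r f a) (hg : IsLead Ω r g b) :
    IsLead Ω r (f * g) (a + b) := by
  refine ⟨?_, ?_⟩
  · have := mul_mem_degGE hf.1 hg.1
    rwa [← mul_add, ← Nat.cast_add] at this
  · rw [homogeneousComponent_mul_of_mem_degGE hr hf.1 hg.1, hΩ.dvd_mul]
    exact not_or.mpr ⟨hf.2, hg.2⟩

theorem add (hf : IsLead Ω r f a) (hg : g ∈ degGE (Fin (n + 1)) k r (r * a + 1)) :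
    IsLead Ω r (f + g) a := by
  refine ⟨add_mem hf.1 (degGE_anti (by omega) hg), ?_⟩
  rw [map_add, homogeneousComponent_eq_zero_of_mem_degGE hg (by omega), add_zero]
  exact hf.2

theorem not_dvd (hD : D ≠ 0) (hΩD : Ω.IsHomogeneous D) (hΩ : Prime Ω) (hr : ξ = 0 ∧ r ≠ 0 ∨ r < 0)
    (hf : IsLead Ω r f a) : ¬ (Ω - C ξ) ∣ f := by
  intro hdvd
  rcases hr with ⟨rfl, -⟩ | hr
  · rw [C_0, sub_zero] at hdvd
    exact hf.2 (hΩD.dvd_homogeneousComponent hdvd a)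
  · obtain ⟨h, rfl⟩ := hdvd
    have h0 : h ≠ 0 := by
      rintro rfl
      exact hf.2 (by simp)
    obtain ⟨b, hb, hb0⟩ := exists_extreme r h0
    have hC : (C ξ : MvPolynomial (Fin (n + 1)) k) ∈ degGE (Fin (n + 1)) k r 0 := by
      simpa using (isHomogeneous_C (Fin (n + 1)) ξ).mem_degGE (r := r)
    have hΩ1 : Ω - C ξ ∈ degGE (Fin (n + 1)) k r (r * D) :=
      sub_mem hΩD.mem_degGE (degGE_anti (by nlinarith) hC)
    have e := homogeneousComponent_mul_of_mem_degGE hr.ne hΩ1 hb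
    have hC0 : homogeneousComponent D (C ξ : MvPolynomial (Fin (n + 1)) k) = 0 := by
      rw [homogeneousComponent_of_mem (isHomogeneous_C _ _), if_neg hD]
    rw [map_sub, homogeneousComponent_eq_self hΩD, hC0, sub_zero] at e
    have hne : homogeneousComponent (D + b) ((Ω - C ξ) * h) ≠ 0 := by
      rw [e]; exact mul_ne_zero hΩ.ne_zero hb0
    have h1 : r * a ≤ r * (D + b : ℕ) := by
      by_contra! hlt
      exact hne (homogeneousComponent_eq_zero_of_mem_degGE hf.1 hlt)
    have h2 : r * (D + b : ℕ) ≤ r * a := by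
      by_contra! hlt
      refine hf.2 ?_
      have h3 := mul_mem_degGE hΩ1 hb
      rw [← mul_add, ← Nat.cast_add] at h3
      rw [homogeneousComponent_eq_zero_of_mem_degGE h3 hlt]
      exact dvd_zero _
    have h3 : a = D + b := by exact_mod_cast mul_left_cancel₀ hr.ne (le_antisymm h1 h2)
    refine hf.2 ?_
    rw [h3, e]
    exact dvd_mul_right _ _

theorem le_of_dvd_sub (hD : D ≠ 0) (hΩD : Ω.IsHomogeneous D) (hΩ : Prime Ω)
    (hr : ξ = 0 ∧ r ≠ 0 ∨ r < 0) {i : ℤ} (hf : IsLead Ω r f a)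
    (hg : g ∈ degGE (Fin (n + 1)) k r i) (h : (Ω - C ξ) ∣ f - g) : i ≤ r * a := by
  by_contra! hlt
  refine (hf.add (g := -g) (neg_mem (degGE_anti (by omega) hg))).not_dvd hD hΩD hΩ hr ?_
  rwa [← sub_eq_add_neg]

theorem unique (hD : D ≠ 0) (hΩD : Ω.IsHomogeneous D) (hΩ : Prime Ω)
    (hr : ξ = 0 ∧ r ≠ 0 ∨ r < 0) (hf : IsLead Ω r f a) (hg : IsLead Ω r g b)
    (h : (Ω - C ξ) ∣ f - g) : r * (a : ℤ) = r * b :=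
  le_antisymm (hg.le_of_dvd_sub hD hΩD hΩ hr hf.1 (by rwa [dvd_sub_comm]))
    (hf.le_of_dvd_sub hD hΩD hΩ hr hg.1 h)

end IsLead

variable {r : ℤ} {D : ℕ} {ξ : k}

/-- Every polynomial not divisible by `Ω - ξ` has a leading component after subtraction of a multiple
of `Ω - ξ`: for `ξ = 0` discard the components divisible by `Ω`, for `r < 0` use `Ω ≡ ξ` to lower the
degree as long as the top component is divisible by `Ω`. -/
theorem exists_isLead (hD : D ≠ 0) (hΩD : Ω.IsHomogeneous D) (hr : ξ = 0 ∧ r ≠ 0 ∨ r < 0)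
    {f : MvPolynomial (Fin (n + 1)) k} (hf : ¬ (Ω - C ξ) ∣ f) :
    ∃ g d, IsLead Ω r g d ∧ (Ω - C ξ) ∣ f - g := by
  classical
  rcases hr with ⟨rfl, hr⟩ | hr
  · simp only [C_0, sub_zero] at hf ⊢
    set s := (Finset.range (f.totalDegree + 1)).filter fun i => ¬ Ω ∣ homogeneousComponent i f
      with hs
    set g := ∑ i ∈ s, homogeneousComponent i f with hg
    have hfg : Ω ∣ f - g := by
      have : f - g = ∑ i ∈ (Finset.range (f.totalDegree + 1)).filter
          (fun i => Ω ∣ homogeneousComponent i f), homogeneousComponent i f := by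
        rw [sub_eq_iff_eq_add]
        conv_lhs => rw [← sum_homogeneousComponent f]
        rw [hg, hs, Finset.sum_filter_add_sum_filter_not]
      rw [this]
      exact Finset.dvd_sum fun i hi => (Finset.mem_filter.mp hi).2
    have hg0 : g ≠ 0 := by
      intro h
      rw [h, sub_zero] at hfg
      exact hf hfg
    obtain ⟨d, hd, hd0⟩ := exists_extreme r hg0
    refine ⟨g, d, ⟨hd, ?_⟩, hfg⟩
    have e : homogeneousComponent d g = if d ∈ s then homogeneousComponent d f else 0 := by
      rw [hg, map_sum]
      simp only [homogeneousComponent_of_mem (homogeneousComponent_isHomogeneous _ f)]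
      rw [Finset.sum_ite_eq]
    rw [e] at hd0 ⊢
    split_ifs at hd0 ⊢ with h
    · exact (Finset.mem_filter.mp h).2
    · exact absurd rfl hd0
  · have key : ∀ N : ℕ, ∀ f : MvPolynomial (Fin (n + 1)) k,
        f ∈ degGE (Fin (n + 1)) k r (r * N) → ¬ (Ω - C ξ) ∣ f →
        ∃ g d, IsLead Ω r g d ∧ (Ω - C ξ) ∣ f - g := by
      intro N
      induction N using Nat.strong_induction_on with
      | _ N ih =>
        intro f hfN hf
        by_cases hlead : IsLead Ω r f N
        · exact ⟨f, N, hlead, by simp⟩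
        have hdvd : Ω ∣ homogeneousComponent N f := by
          by_contra h
          exact hlead ⟨hfN, h⟩
        have hsub := sub_homogeneousComponent_mem_degGE hr.ne hfN
        -- as `r < 0`, a step of `1` in the filtration lowers the degree
        have hlower : ∀ f' : MvPolynomial (Fin (n + 1)) k,
            f' ∈ degGE (Fin (n + 1)) k r (r * N + 1) → (Ω - C ξ) ∣ f - f' →
            ∃ g d, IsLead Ω r g d ∧ (Ω - C ξ) ∣ f - g := by
          intro f' hf' hff'
          have hf'0 : ¬ (Ω - C ξ) ∣ f' := fun h => hf (by
            simpa using dvd_add hff' h)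
          have hne : f' ≠ 0 := fun h => hf'0 (by simp [h])
          obtain ⟨d, hd, hd0⟩ := exists_extreme r hne
          have hdN : d < N := by
            by_contra! hle
            refine hd0 (homogeneousComponent_eq_zero_of_mem_degGE hf' ?_)
            have : (N : ℤ) ≤ d := by exact_mod_cast hle
            nlinarith
          obtain ⟨g, e, hg, hge⟩ := ih d hdN f' hd hf'0
          exact ⟨g, e, hg, by simpa using dvd_add hff' hge⟩
        obtain ⟨h, hh⟩ := hdvd
        rcases lt_or_ge N D with hND | hND
        · have h1 := homogeneousComponent_isHomogeneous_mul_of_lt (g := h) hΩD hND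
          rw [← hh, homogeneousComponent_eq_self (homogeneousComponent_isHomogeneous _ _)] at h1
          rw [h1, sub_zero] at hsub
          exact hlower f hsub (by simp)
        · have h1 := homogeneousComponent_isHomogeneous_mul (g := h) hΩD hND
          rw [← hh, homogeneousComponent_eq_self (homogeneousComponent_isHomogeneous _ _)] at h1
          set h' := homogeneousComponent (N - D) h with hh'
          have hh'N : h'.IsHomogeneous (N - D) := homogeneousComponent_isHomogeneous _ _
          refine hlower (f - (Ω - C ξ) * h') ?_ ⟨h', by ring⟩
          have e : f - (Ω - C ξ) * h' = (f - homogeneousComponent N f) + C ξ * h' := by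
            rw [h1]; ring
          rw [e]
          refine add_mem hsub (degGE_anti ?_ (hh'N.C_mul ξ).mem_degGE)
          push_cast [hND]
          have : (1 : ℤ) ≤ D := by exact_mod_cast Nat.one_le_iff_ne_zero.mpr hD
          nlinarith
    obtain ⟨d, hd, -⟩ := exists_extreme r (f := f) (fun h => hf (by simp [h]))
    exact key d f hd hf

/-- If the homogeneous polynomial `Ω` is prime, then so is `Ω - ξ`: leading components multiply. -/
theorem prime_sub_C (hD : D ≠ 0) (hΩD : Ω.IsHomogeneous D) (hΩ : Prime Ω) (ξ : k) :
    Prime (Ω - C ξ) := by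
  have hr : ξ = 0 ∧ (-1 : ℤ) ≠ 0 ∨ (-1 : ℤ) < 0 := Or.inr (by norm_num)
  have h1 : IsLead Ω (-1) 1 0 := by
    refine ⟨by simpa using (isHomogeneous_one (Fin (n + 1)) k).mem_degGE (r := -1), ?_⟩
    rw [homogeneousComponent_eq_self (isHomogeneous_one _ _)]
    exact fun h => hΩ.not_isUnit (isUnit_of_dvd_one h)
  refine ⟨?_, ?_, ?_⟩
  · intro h
    apply hΩ.ne_zero
    have := congrArg (homogeneousComponent D) h
    rwa [map_sub, homogeneousComponent_eq_self hΩD, map_zero,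
      homogeneousComponent_of_mem (isHomogeneous_C _ _), if_neg hD, sub_zero] at this
  · intro h
    exact h1.not_dvd hD hΩD hΩ hr h.dvd
  · intro f g hfg
    by_contra! hcon
    obtain ⟨f', a, hf', hff'⟩ := exists_isLead hD hΩD hr hcon.1
    obtain ⟨g', b, hg', hgg'⟩ := exists_isLead hD hΩD hr hcon.2
    refine (hf'.mul hΩ (by norm_num) hg').not_dvd hD hΩD hΩ hr ?_
    have e : f' * g' = f * g - ((f - f') * g + f' * (g - g')) := by ring
    rw [e]
    exact dvd_sub hfg (dvd_add (hff'.mul_right _) (hgg'.mul_left _))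

end NambuPoisson

/-! ### Extending degree functions to fraction fields -/

namespace ZeroValuation

open NambuPoisson

section OfDomain

/-- A degree function on a Nambu-Poisson domain `B`: an integer valued function on `B \ {0}` (the value
at `0` is irrelevant) with the properties of a `0`-valuation. -/
structure DomainValuation (k : Type*) (n : ℕ) (B : Type*) [Field k] [CommRing B] [Algebra k B]
    [NambuPoisson k n B] where
  toFun : B → ℤ
  map_algebraMap : ∀ c : k, c ≠ 0 → toFun (algebraMap k B c) = 0
  map_mul : ∀ a b, a ≠ 0 → b ≠ 0 → toFun (a * b) = toFun a + toFun b
  min_le_map_add : ∀ a b, a ≠ 0 → b ≠ 0 → a + b ≠ 0 → min (toFun a) (toFun b) ≤ toFun (a + b)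
  sum_le_map_bracket : ∀ v : Fin n → B, (∀ i, v i ≠ 0) → bracket (k := k) v ≠ 0 →
    ∑ i, toFun (v i) ≤ toFun (bracket (k := k) v)

variable {k : Type u} {n : ℕ} {B : Type u} [Field k] [CommRing B] [Algebra k B]
  [NambuPoisson k n B] (w : DomainValuation k n B)

open scoped Classical in
/-- The degree function with the value `∞` at `0`. -/
noncomputable def DomainValuation.withTop (b : B) : WithTop ℤ :=
  if b = 0 then ⊤ else (w.toFun b : ℤ)

namespace DomainValuation

theorem withTop_of_ne {b : B} (hb : b ≠ 0) : w.withTop b = (w.toFun b : ℤ) := if_neg hb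

theorem withTop_zero : w.withTop 0 = ⊤ := if_pos rfl

theorem min_le_withTop_add (a b : B) : min (w.withTop a) (w.withTop b) ≤ w.withTop (a + b) := by
  by_cases ha : a = 0
  · simp [ha, withTop_zero]
  by_cases hb : b = 0
  · simp [hb, withTop_zero]
  by_cases hab : a + b = 0
  · simp [hab, withTop_zero]
  rw [withTop_of_ne _ ha, withTop_of_ne _ hb, withTop_of_ne _ hab]
  exact_mod_cast w.min_le_map_add _ _ ha hb hab

theorem sum_le_withTop_bracket (v : Fin n → B) :
    ∑ i, w.withTop (v i) ≤ w.withTop (bracket (k := k) v) := by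
  by_cases h0 : bracket (k := k) v = 0
  · simp [h0, withTop_zero]
  have hv : ∀ i, v i ≠ 0 := fun i h => h0 ((bracket (k := k)).map_coord_zero i h)
  rw [withTop_of_ne _ h0, Finset.sum_congr rfl fun i _ => w.withTop_of_ne (hv i), ← WithTop.coe_sum]
  exact_mod_cast w.sum_le_map_bracket v hv h0

variable [IsDomain B]

theorem withTop_mul (a b : B) : w.withTop (a * b) = w.withTop a + w.withTop b := by
  by_cases ha : a = 0
  · simp [ha, withTop_zero]
  by_cases hb : b = 0
  · simp [hb, withTop_zero]
  rw [withTop_of_ne _ ha, withTop_of_ne _ hb, withTop_of_ne _ (mul_ne_zero ha hb),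
    w.map_mul _ _ ha hb]
  rfl

/-- The degree of a fraction `a / s`. -/
noncomputable def fracFun (x : FractionRing B) : WithTop ℤ :=
  w.withTop (frac_rep (A := B) (FractionRing B) x).choose +
    (-(w.toFun (frac_rep (A := B) (FractionRing B) x).choose_spec.choose) : ℤ)

theorem fracFun_spec {x : FractionRing B} {a s : B} (hs : s ≠ 0)
    (h : x * algebraMap B (FractionRing B) s = algebraMap B (FractionRing B) a) :
    w.fracFun x + (w.toFun s : ℤ) = w.withTop a := by
  obtain ⟨ht, hbt⟩ := (frac_rep (A := B) (FractionRing B) x).choose_spec.choose_spec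
  rw [fracFun]
  generalize (frac_rep (A := B) (FractionRing B) x).choose_spec.choose = t at *
  generalize (frac_rep (A := B) (FractionRing B) x).choose = b at *
  have inj : Injective (algebraMap B (FractionRing B)) := IsFractionRing.injective B _
  have e : a * t = b * s := by
    apply inj
    rw [_root_.map_mul, _root_.map_mul, ← h, ← hbt]; ring
  have e' := congrArg w.withTop e
  rw [withTop_mul, withTop_mul, withTop_of_ne _ hs, withTop_of_ne _ ht] at e'
  cases h1 : w.withTop a with
  | top =>
    rw [h1, top_add] at e'
    cases h2 : w.withTop b with
    | top => simp
    | coe b' => rw [h2] at e'; exact absurd e' (by exact WithTop.top_ne_coe)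
  | coe a' =>
    cases h2 : w.withTop b with
    | top => rw [h1, h2] at e'; exact absurd e' (by exact WithTop.coe_ne_top)
    | coe b' =>
      rw [h1, h2] at e'
      norm_cast at e' ⊢
      omega

theorem fracFun_algebraMap (b : B) : w.fracFun (algebraMap B (FractionRing B) b) = w.withTop b := by
  have h1 : w.toFun 1 = 0 := by simpa using w.map_algebraMap 1 one_ne_zero
  have := w.fracFun_spec (x := algebraMap B (FractionRing B) b) (a := b) one_ne_zero (by simp)
  simpa [h1] using this

theorem add_coe_inj {x y : WithTop ℤ} {c : ℤ} (h : x + c = y + c) : x = y := by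
  cases x <;> cases y
  · rfl
  · exact absurd h (by exact WithTop.top_ne_coe)
  · exact absurd h (by exact WithTop.coe_ne_top)
  · norm_cast at h ⊢; omega

theorem le_of_add_coe_le {x y : WithTop ℤ} {c : ℤ} (h : x + c ≤ y + c) : x ≤ y := by
  cases y
  · exact le_top
  · cases x
    · exact absurd (top_le_iff.mp h) (by exact WithTop.coe_ne_top)
    · norm_cast at h ⊢; omega

theorem fracFun_eq_top_iff (x : FractionRing B) : w.fracFun x = ⊤ ↔ x = 0 := by
  obtain ⟨a, s, hs, h⟩ := frac_rep (A := B) (FractionRing B) x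
  have hw := w.fracFun_spec hs h
  have hs' : algebraMap B (FractionRing B) s ≠ 0 := by simpa using hs
  constructor
  · intro hx
    rw [hx, top_add] at hw
    by_cases ha : a = 0
    · rw [ha, _root_.map_zero] at h
      exact (mul_eq_zero.mp h).resolve_right hs'
    · rw [withTop_of_ne _ ha] at hw
      exact absurd hw (by exact WithTop.top_ne_coe)
  · rintro rfl
    simpa [withTop_zero] using w.fracFun_algebraMap 0

theorem fracFun_mul (x y : FractionRing B) : w.fracFun (x * y) = w.fracFun x + w.fracFun y := by
  obtain ⟨a, s, hs, hx⟩ := frac_rep (A := B) (FractionRing B) x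
  obtain ⟨b, t, ht, hy⟩ := frac_rep (A := B) (FractionRing B) y
  have h1 := w.fracFun_spec hs hx
  have h2 := w.fracFun_spec ht hy
  have h3 := w.fracFun_spec (x := x * y) (a := a * b) (mul_ne_zero hs ht)
    (by rw [_root_.map_mul, _root_.map_mul, ← hx, ← hy]; ring)
  rw [withTop_mul, ← h1, ← h2, w.map_mul _ _ hs ht] at h3
  apply add_coe_inj (c := w.toFun s + w.toFun t)
  rw [h3, WithTop.coe_add]
  ac_rfl

theorem min_le_fracFun_add (x y : FractionRing B) :
    min (w.fracFun x) (w.fracFun y) ≤ w.fracFun (x + y) := by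
  obtain ⟨a, s, hs, hx⟩ := frac_rep (A := B) (FractionRing B) x
  obtain ⟨b, t, ht, hy⟩ := frac_rep (A := B) (FractionRing B) y
  have hst := mul_ne_zero hs ht
  have h1 := w.fracFun_spec (x := x) (a := a * t) hst
    (by rw [_root_.map_mul, _root_.map_mul, ← hx]; ring)
  have h2 := w.fracFun_spec (x := y) (a := b * s) hst
    (by rw [_root_.map_mul, _root_.map_mul, ← hy]; ring)
  have h3 := w.fracFun_spec (x := x + y) (a := a * t + b * s) hst
    (by rw [_root_.map_mul, _root_.map_add, _root_.map_mul, _root_.map_mul, ← hx, ← hy]; ring)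
  apply le_of_add_coe_le (c := w.toFun (s * t))
  rw [h3, min_add_add_right_withTop, h1, h2]
  exact w.min_le_withTop_add _ _
where
  min_add_add_right_withTop {x y : WithTop ℤ} {c : ℤ} : min x y + c = min (x + c) (y + c) :=
    (min_add_add_right x y (c : WithTop ℤ)).symm

theorem fracFun_neg (x : FractionRing B) : w.fracFun (-x) = w.fracFun x := by
  obtain ⟨a, s, hs, hx⟩ := frac_rep (A := B) (FractionRing B) x
  have h1 : w.fracFun (-1) + w.fracFun (-1) = 0 := by
    rw [← fracFun_mul, neg_one_mul, neg_neg, ← (algebraMap B (FractionRing B)).map_one,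
      fracFun_algebraMap, withTop_of_ne _ one_ne_zero]
    have : w.toFun 1 = 0 := by simpa using w.map_algebraMap 1 one_ne_zero
    simp [this]
  have h2 : w.fracFun (-1 : FractionRing B) = 0 := by
    cases h : w.fracFun (-1 : FractionRing B) with
    | top => rw [h] at h1; exact absurd h1 (by exact WithTop.top_ne_coe)
    | coe c => rw [h] at h1; norm_cast at h1 ⊢; omega
  rw [← neg_one_mul, fracFun_mul, h2, zero_add]

theorem fracFun_add_of_ne (x y : FractionRing B) (h : w.fracFun x ≠ w.fracFun y) :
    w.fracFun (x + y) = min (w.fracFun x) (w.fracFun y) := by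
  have key : ∀ x y : FractionRing B, w.fracFun x < w.fracFun y →
      w.fracFun (x + y) = w.fracFun x := by
    intro x y hlt
    refine le_antisymm ?_ ?_
    · by_contra! hlt'
      have := w.min_le_fracFun_add (x + y) (-y)
      rw [add_neg_cancel_right, fracFun_neg] at this
      exact absurd this (not_le.mpr (lt_min hlt' hlt))
    · have := w.min_le_fracFun_add x y
      rwa [min_eq_left hlt.le] at this
  rcases lt_or_gt_of_ne h with h | h
  · rw [key x y h, min_eq_left h.le]
  · rw [add_comm, key y x h, min_eq_right h.le]

variable [CharZero k]

theorem sum_le_fracFun_bracket (v : Fin n → FractionRing B) :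
    ∑ i, w.fracFun (v i) ≤ w.fracFun (bracket (k := k) v) := by
  revert v
  refine slotwise _ (Set.range (algebraMap B (FractionRing B))) ?_ ?_
  · intro v hv
    choose p hp using hv
    obtain rfl : algebraMap B (FractionRing B) ∘ p = v := funext hp
    have e : bracket (k := k) (algebraMap B (FractionRing B) ∘ p) =
        algebraMap B (FractionRing B) (bracket (k := k) p) :=
      fracBracket_algebraMap (k := k) (n := n) (FractionRing B) p
    rw [e, fracFun_algebraMap]
    simp only [comp_apply, fracFun_algebraMap]
    exact w.sum_le_withTop_bracket p
  · intro v i hv z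
    obtain ⟨a, s, hs, hz⟩ := frac_rep (A := B) (FractionRing B) z
    have hsum : ∀ x, ∑ j, w.fracFun (update v i x j) =
        w.fracFun x + ∑ j ∈ Finset.univ.erase i, w.fracFun (v j) := by
      intro x
      rw [← Finset.add_sum_erase _ _ (Finset.mem_univ i), update_self]
      congr 1
      exact Finset.sum_congr rfl fun j hj => by rw [update_of_ne (Finset.ne_of_mem_erase hj)]
    have h1 := hv _ ⟨a, rfl⟩
    have h2 := hv _ ⟨s, rfl⟩
    have h3 := leibniz (k := k) v i z (algebraMap B (FractionRing B) s)
    rw [hz] at h3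
    set T := ∑ j ∈ Finset.univ.erase i, w.fracFun (v j)
    have hza : w.fracFun z + (w.toFun s : ℤ) = w.withTop a := w.fracFun_spec hs hz
    rw [hsum, fracFun_algebraMap] at h1 h2
    rw [withTop_of_ne _ hs] at h2
    rw [hsum]
    have h4 : algebraMap B (FractionRing B) s * bracket (k := k) (update v i z) =
        bracket (k := k) (update v i (algebraMap B (FractionRing B) a)) +
        -(z * bracket (k := k) (update v i (algebraMap B (FractionRing B) s))) := by
      rw [h3]; ring
    have h5 := w.min_le_fracFun_add (bracket (k := k) (update v i (algebraMap B (FractionRing B) a)))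
      (-(z * bracket (k := k) (update v i (algebraMap B (FractionRing B) s))))
    rw [← h4, fracFun_neg, fracFun_mul, fracFun_mul, fracFun_algebraMap, withTop_of_ne _ hs] at h5
    apply le_of_add_coe_le (c := w.toFun s)
    rw [add_comm _ ((w.toFun s : ℤ) : WithTop ℤ), add_comm _ ((w.toFun s : ℤ) : WithTop ℤ)]
    refine le_trans (le_min ?_ ?_) h5
    · refine le_of_eq_of_le ?_ h1
      rw [← hza]; ac_rfl
    · refine le_of_eq_of_le ?_ (add_le_add_right h2 (w.fracFun z))
      ac_rfl

/-- The extension of a degree function to the fraction field. -/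
noncomputable def toZeroValuation :
    ZeroValuation k n (FractionRing B) where
  toFun := w.fracFun
  eq_top_iff := w.fracFun_eq_top_iff
  map_algebraMap c hc := by
    rw [IsScalarTower.algebraMap_apply k B (FractionRing B), fracFun_algebraMap, withTop_of_ne,
      w.map_algebraMap c hc]
    · rfl
    · have : Nontrivial B := inferInstance
      simpa using hc
  map_mul := w.fracFun_mul
  min_le_map_add := w.min_le_fracFun_add
  map_add_of_ne := w.fracFun_add_of_ne
  sum_le_map_bracket := w.sum_le_fracFun_bracket

end DomainValuation

end OfDomain

end ZeroValuation

/-! ### The degree valuations of the fraction field of `P_{Ω-ξ}` -/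

namespace NambuPoisson

open MvPolynomial ZeroValuation

variable {k : Type u} [Field k] {n : ℕ} (Ω : MvPolynomial (Fin (n + 1)) k) (ξ : k)

/-- The projection `k[t_1, …, t_{n+1}] → P_{Ω-ξ}`. -/
noncomputable def hypMk : MvPolynomial (Fin (n + 1)) k →ₐ[k] NambuHyp Ω ξ :=
  (Ideal.Quotient.mkₐ k (nambuIdeal Ω ξ) : NambuPoly Ω →ₐ[k] NambuHyp Ω ξ)

theorem hypMk_surjective : Surjective (hypMk Ω ξ) :=
  Ideal.Quotient.mk_surjective (I := nambuIdeal Ω ξ)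

theorem hypMk_eq_zero_iff (f : MvPolynomial (Fin (n + 1)) k) :
    hypMk Ω ξ f = 0 ↔ (Ω - C ξ) ∣ f :=
  (Ideal.Quotient.eq_zero_iff_mem (R := NambuPoly Ω) (I := nambuIdeal Ω ξ)).trans
    (Ideal.mem_span_singleton (α := MvPolynomial (Fin (n + 1)) k))

theorem hypMk_eq_iff (f g : MvPolynomial (Fin (n + 1)) k) :
    hypMk Ω ξ f = hypMk Ω ξ g ↔ (Ω - C ξ) ∣ f - g := by
  rw [← hypMk_eq_zero_iff, map_sub, sub_eq_zero]

theorem hypMk_bracket [CharZero k] (v : Fin n → MvPolynomial (Fin (n + 1)) k) :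
    hypMk Ω ξ (nambuPolyBracket Ω v) = bracket (k := k) fun i => hypMk Ω ξ (v i) :=
  (quotBracket_mk (k := k) (n := n) (A := NambuPoly Ω) (nambuIdeal Ω ξ)
    (nambuIdeal_isIdeal Ω ξ) v).symm

variable {Ω ξ}

theorem isDomain_nambuHyp (h : Prime (Ω - C ξ)) : IsDomain (NambuHyp Ω ξ) := by
  have : (nambuIdeal Ω ξ).IsPrime :=
    (Ideal.span_singleton_prime (α := MvPolynomial (Fin (n + 1)) k) h.ne_zero).mpr h
  exact Ideal.Quotient.isDomain _

theorem mem_degFiltration_iff {r i : ℤ} {b : NambuHyp Ω ξ} :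
    b ∈ degFiltration Ω ξ r i ↔ ∃ f ∈ degGE (Fin (n + 1)) k r i, hypMk Ω ξ f = b := by
  have hdeg : ∀ m : Fin (n + 1) →₀ ℕ, ∑ j, (m j : ℤ) = (m.degree : ℤ) := by
    intro m
    rw [Finsupp.degree_eq_sum]; push_cast; rfl
  constructor
  · intro hb
    refine Submodule.span_induction (p := fun b _ => ∃ f ∈ degGE (Fin (n + 1)) k r i,
      hypMk Ω ξ f = b) ?_ ?_ ?_ ?_ hb
    · rintro _ ⟨m, hm, rfl⟩
      rw [hdeg] at hm
      exact ⟨_, monomial_mem_degGE hm, rfl⟩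
    · exact ⟨0, zero_mem _, map_zero _⟩
    · rintro _ _ _ _ ⟨f, hf, rfl⟩ ⟨g, hg, rfl⟩
      exact ⟨f + g, add_mem hf hg, map_add _ _ _⟩
    · rintro c _ _ ⟨f, hf, rfl⟩
      exact ⟨c • f, Submodule.smul_mem _ _ hf, map_smul _ _ _⟩
  · rintro ⟨f, hf, rfl⟩
    rw [f.as_sum, map_sum]
    refine sum_mem fun m hm => ?_
    have e : monomial m (coeff m f) = coeff m f • monomial m (1 : k) := by
      rw [smul_monomial, smul_eq_mul, mul_one]
    rw [e, map_smul]
    refine Submodule.smul_mem _ _ (Submodule.subset_span ⟨m, ?_, rfl⟩)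
    rw [hdeg]
    exact hf m (mem_support_iff.mp hm)

theorem isLead_C {r : ℤ} {D : ℕ} (hD : D ≠ 0) (hΩ : Ω.IsHomogeneous D) {c : k} (hc : c ≠ 0) :
    IsLead Ω r (C c) 0 := by
  have h := isHomogeneous_C (Fin (n + 1)) c
  refine ⟨by simpa using h.mem_degGE (r := r), ?_⟩
  rw [homogeneousComponent_eq_self h]
  exact hΩ.not_dvd_of_lt h (by simpa using hc) (Nat.pos_of_ne_zero hD)

variable (Ω ξ) in
open scoped Classical in
/-- The degree in `P_{Ω-ξ}` is `r` times the degree of the leading component of a representative that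
has one. -/
noncomputable def hypDegree (r : ℤ) (b : NambuHyp Ω ξ) : ℤ :=
  if h : ∃ d : ℕ, ∃ f, IsLead Ω r f d ∧ hypMk Ω ξ f = b then r * (h.choose : ℤ) else 0

variable {r : ℤ}

theorem exists_isLead_of_ne_zero (hΩ : Ω.IsHomogeneous (n + 1)) (hr : ξ = 0 ∧ r ≠ 0 ∨ r < 0)
    {b : NambuHyp Ω ξ} (hb : b ≠ 0) : ∃ f d, IsLead Ω r f d ∧ hypMk Ω ξ f = b := by
  obtain ⟨f, rfl⟩ := hypMk_surjective Ω ξ b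
  rw [Ne, hypMk_eq_zero_iff] at hb
  obtain ⟨g, d, hg, hfg⟩ := exists_isLead n.succ_ne_zero hΩ hr hb
  exact ⟨g, d, hg, ((hypMk_eq_iff Ω ξ _ _).mpr hfg).symm⟩

theorem hypDegree_hypMk (hΩ : Ω.IsHomogeneous (n + 1)) (hp : Prime Ω)
    (hr : ξ = 0 ∧ r ≠ 0 ∨ r < 0) {f : MvPolynomial (Fin (n + 1)) k} {d : ℕ} (hf : IsLead Ω r f d) :
    hypDegree Ω ξ r (hypMk Ω ξ f) = r * d := by
  have h : ∃ d : ℕ, ∃ g, IsLead Ω r g d ∧ hypMk Ω ξ g = hypMk Ω ξ f := ⟨d, f, hf, rfl⟩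
  rw [hypDegree, dif_pos h]
  obtain ⟨g, hg, hgf⟩ := h.choose_spec
  exact hg.unique n.succ_ne_zero hΩ hp hr hf ((hypMk_eq_iff Ω ξ _ _).mp hgf)

/-- The degree function of `P_{Ω-ξ}`. -/
noncomputable def hypDomainValuation [CharZero k] (hΩ : Ω.IsHomogeneous (n + 1)) (hp : Prime Ω)
    (hr : ξ = 0 ∧ r ≠ 0 ∨ r < 0) : DomainValuation k n (NambuHyp Ω ξ) where
  toFun := hypDegree Ω ξ r
  map_algebraMap c hc := by
    rw [← (hypMk Ω ξ).commutes, MvPolynomial.algebraMap_eq,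
      hypDegree_hypMk hΩ hp hr (isLead_C n.succ_ne_zero hΩ hc)]
    simp
  map_mul a b ha hb := by
    obtain ⟨f, d, hf, rfl⟩ := exists_isLead_of_ne_zero hΩ hr ha
    obtain ⟨g, e, hg, rfl⟩ := exists_isLead_of_ne_zero hΩ hr hb
    have hr0 : r ≠ 0 := hr.elim (fun h => h.2) (fun h => h.ne)
    rw [← _root_.map_mul, hypDegree_hypMk hΩ hp hr hf, hypDegree_hypMk hΩ hp hr hg,
      hypDegree_hypMk hΩ hp hr (hf.mul hp hr0 hg)]
    push_cast; ring
  min_le_map_add a b ha hb hab := by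
    obtain ⟨f, d, hf, rfl⟩ := exists_isLead_of_ne_zero hΩ hr ha
    obtain ⟨g, e, hg, rfl⟩ := exists_isLead_of_ne_zero hΩ hr hb
    obtain ⟨h, c, hh, hhe⟩ := exists_isLead_of_ne_zero hΩ hr hab
    rw [← hhe, hypDegree_hypMk hΩ hp hr hf, hypDegree_hypMk hΩ hp hr hg,
      hypDegree_hypMk hΩ hp hr hh]
    refine hh.le_of_dvd_sub n.succ_ne_zero hΩ hp hr (g := f + g)
      (add_mem (degGE_anti (min_le_left _ _) hf.1) (degGE_anti (min_le_right _ _) hg.1)) ?_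
    rw [← hypMk_eq_iff, hhe, _root_.map_add]
  sum_le_map_bracket v hv hv0 := by
    choose f d hf hfv using fun i => exists_isLead_of_ne_zero hΩ hr (hv i)
    obtain rfl : (fun i => hypMk Ω ξ (f i)) = v := funext hfv
    obtain ⟨h, c, hh, hhe⟩ := exists_isLead_of_ne_zero hΩ hr hv0
    rw [← hhe, hypDegree_hypMk hΩ hp hr hh]
    simp only [fun i => hypDegree_hypMk hΩ hp hr (hf i)]
    refine hh.le_of_dvd_sub n.succ_ne_zero hΩ hp hr
      (nambuPolyBracket_mem_degGE hΩ fun i => (hf i).1) ?_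
    rw [← hypMk_eq_iff, hhe, hypMk_bracket]

variable [CharZero k] [IsDomain (NambuHyp Ω ξ)]

/-- The `0`-valuation of `Q(P_{Ω-ξ})` with value `r` at the coordinates: `ν^{Id}` and `ν^{-Id}` for
`ξ = 0`, `r = ±1`, and `ν^c` for `ξ = 1`, `r = -1`. -/
noncomputable def hypValuation (hΩ : Ω.IsHomogeneous (n + 1)) (hp : Prime Ω)
    (hr : ξ = 0 ∧ r ≠ 0 ∨ r < 0) : ZeroValuation k n (FractionRing (NambuHyp Ω ξ)) :=
  (hypDomainValuation hΩ hp hr).toZeroValuation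

theorem hypValuation_isLead (hΩ : Ω.IsHomogeneous (n + 1)) (hp : Prime Ω)
    (hr : ξ = 0 ∧ r ≠ 0 ∨ r < 0) {f : MvPolynomial (Fin (n + 1)) k} {d : ℕ} (hf : IsLead Ω r f d) :
    hypValuation hΩ hp hr (algebraMap _ (FractionRing (NambuHyp Ω ξ)) (hypMk Ω ξ f)) =
      ((r * d : ℤ) : WithTop ℤ) := by
  have h0 : hypMk Ω ξ f ≠ 0 := by
    rw [Ne, hypMk_eq_zero_iff]
    exact hf.not_dvd n.succ_ne_zero hΩ hp hr
  refine (DomainValuation.fracFun_algebraMap _ _).trans ?_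
  rw [DomainValuation.withTop_of_ne _ h0]
  exact congrArg _ (hypDegree_hypMk hΩ hp hr hf)

theorem hypValuation_isGivenBy (hΩ : Ω.IsHomogeneous (n + 1)) (hp : Prime Ω)
    (hr : ξ = 0 ∧ r ≠ 0 ∨ r < 0) :
    (hypValuation hΩ hp hr).IsGivenBy (degFiltration Ω ξ r) := by
  intro i b
  by_cases hb : b = 0
  · subst hb
    simp [ZeroValuation.map_zero]
  obtain ⟨f, d, hf, rfl⟩ := exists_isLead_of_ne_zero hΩ hr hb
  rw [hypValuation_isLead hΩ hp hr hf, mem_degFiltration_iff, WithTop.coe_le_coe]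
  constructor
  · rintro ⟨g, hg, hgf⟩
    exact hf.le_of_dvd_sub n.succ_ne_zero hΩ hp hr hg ((hypMk_eq_iff Ω ξ _ _).mp hgf.symm)
  · intro h
    exact ⟨f, degGE_anti h hf.1, rfl⟩

end NambuPoisson

/-! ### Presentations of Nambu-Poisson fields by a potential -/

namespace NambuPoisson

open MvPolynomial

variable {k : Type u} [Field k] {n : ℕ}

theorem nambuPolyBracket_update_C (Ω : MvPolynomial (Fin (n + 1)) k)
    (v : Fin n → MvPolynomial (Fin (n + 1)) k) (i : Fin n) (c : k) :
    nambuPolyBracket Ω (update v i (C c)) = 0 := by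
  have h := nambuPolyBracket_leibniz Ω v i 1 1
  rw [mul_one, one_mul, left_eq_add] at h
  have e : (C c : MvPolynomial (Fin (n + 1)) k) = c • 1 := by
    rw [smul_eq_C_mul, mul_one]
  rw [e, AlternatingMap.map_update_smul, h, smul_zero]

theorem bracket_update_algebraMap {A : Type*} [CommRing A] [Algebra k A] [NambuPoisson k n A]
    (v : Fin n → A) (i : Fin n) (c : k) : bracket (k := k) (update v i (algebraMap k A c)) = 0 := by
  have h := leibniz (k := k) v i 1 1
  rw [mul_one, one_mul, left_eq_add] at h
  rw [Algebra.algebraMap_eq_smul_one, AlternatingMap.map_update_smul, h, smul_zero]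

/-- An algebra homomorphism respects the brackets if it does so on the coordinates. -/
theorem map_bracket_of_coordinates {Ω : MvPolynomial (Fin (n + 1)) k} {A : Type*} [CommRing A]
    [Algebra k A] [NambuPoisson k n A] (φ : MvPolynomial (Fin (n + 1)) k →ₐ[k] A)
    (h : ∀ σ : Fin n → Fin (n + 1), φ (nambuPolyBracket Ω fun i => X (σ i)) =
      bracket (k := k) fun i => φ (X (σ i))) (v : Fin n → MvPolynomial (Fin (n + 1)) k) :
    φ (nambuPolyBracket Ω v) = bracket (k := k) fun i => φ (v i) := by
  revert v
  refine slotwise _ (Set.range X) ?_ ?_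
  · intro v hv
    choose σ hσ using hv
    obtain rfl : (fun i => X (σ i)) = v := funext hσ
    exact h σ
  · intro v i hv z
    have e : ∀ z, (fun j => φ (update v i z j)) = update (fun j => φ (v j)) i (φ z) := fun z =>
      comp_update φ v i z
    simp only [e] at hv ⊢
    induction z using MvPolynomial.induction_on with
    | C a =>
      rw [nambuPolyBracket_update_C, ← MvPolynomial.algebraMap_eq, φ.commutes,
        bracket_update_algebraMap, map_zero]
    | add p q hp hq =>
      rw [AlternatingMap.map_update_add, map_add, hp, hq, map_add, AlternatingMap.map_update_add]
    | mul_X p j hp =>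
      rw [nambuPolyBracket_leibniz, map_add, map_mul, map_mul, hv _ ⟨j, rfl⟩, hp, map_mul, leibniz]

/-- A presentation of a Nambu-Poisson field `N` as the fraction field of `P_{Ω-ξ}`: a homomorphism
from the polynomial ring to `N` with kernel `(Ω - ξ)` which respects the brackets and whose image
generates `N` as a field. -/
structure Presentation (Ω : MvPolynomial (Fin (n + 1)) k) (ξ : k) (N : Type*) [Field N] [Algebra k N]
    [NambuPoisson k n N] where
  toHom : MvPolynomial (Fin (n + 1)) k →ₐ[k] N
  map_eq_zero_iff : ∀ f, toHom f = 0 ↔ (Ω - C ξ) ∣ f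
  map_bracket : ∀ v, toHom (nambuPolyBracket Ω v) = bracket (k := k) fun i => toHom (v i)
  exists_div : ∀ z : N, ∃ f g, toHom g ≠ 0 ∧ z * toHom g = toHom f

/-- The tautological presentation of `Q(P_{Ω-ξ})`. -/
noncomputable def hypPresentation [CharZero k] (Ω : MvPolynomial (Fin (n + 1)) k) (ξ : k)
    [IsDomain (NambuHyp Ω ξ)] : Presentation Ω ξ (FractionRing (NambuHyp Ω ξ)) where
  toHom := (IsScalarTower.toAlgHom k (NambuHyp Ω ξ) (FractionRing (NambuHyp Ω ξ))).comp (hypMk Ω ξ)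
  map_eq_zero_iff f := by
    rw [AlgHom.comp_apply, ← hypMk_eq_zero_iff]
    exact map_eq_zero_iff _ (IsFractionRing.injective (NambuHyp Ω ξ) _)
  map_bracket v := by
    rw [AlgHom.comp_apply, hypMk_bracket]
    exact (fracBracket_algebraMap (k := k) (A := NambuHyp Ω ξ) (FractionRing (NambuHyp Ω ξ))
      fun i => hypMk Ω ξ (v i)).symm
  exists_div z := by
    obtain ⟨a, s, hs, h⟩ := frac_rep (A := NambuHyp Ω ξ) (FractionRing (NambuHyp Ω ξ)) z
    obtain ⟨f, rfl⟩ := hypMk_surjective Ω ξ a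
    obtain ⟨g, rfl⟩ := hypMk_surjective Ω ξ s
    exact ⟨f, g, by simpa using hs, h⟩

namespace Presentation

variable {Ω : MvPolynomial (Fin (n + 1)) k} {ξ : k} {N : Type*} [Field N] [Algebra k N]
  [NambuPoisson k n N] (P : Presentation Ω ξ N)

theorem toHom_eq_iff (f g : MvPolynomial (Fin (n + 1)) k) :
    P.toHom f = P.toHom g ↔ (Ω - C ξ) ∣ f - g := by
  rw [← P.map_eq_zero_iff, map_sub, sub_eq_zero]

theorem toHom_potential : P.toHom Ω = algebraMap k N ξ := by
  rw [← P.toHom.commutes, MvPolynomial.algebraMap_eq, toHom_eq_iff]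

theorem exists_isLead (hΩ : Ω.IsHomogeneous (n + 1)) {r : ℤ} (hr : ξ = 0 ∧ r ≠ 0 ∨ r < 0)
    {f : MvPolynomial (Fin (n + 1)) k} (hf : P.toHom f ≠ 0) :
    ∃ g d, IsLead Ω r g d ∧ P.toHom g = P.toHom f := by
  rw [Ne, P.map_eq_zero_iff] at hf
  obtain ⟨g, d, hg, hfg⟩ := NambuPoisson.exists_isLead n.succ_ne_zero hΩ hr hf
  exact ⟨g, d, hg, ((P.toHom_eq_iff _ _).mpr hfg).symm⟩

theorem toHom_X_ne_zero (hn : n ≠ 0) (hΩ : Ω.IsHomogeneous (n + 1)) (hp : Prime Ω)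
    (i : Fin (n + 1)) : P.toHom (X i) ≠ 0 := by
  have h : IsLead Ω (-1) (X i) 1 := by
    have hX := isHomogeneous_X k i
    refine ⟨hX.mem_degGE, ?_⟩
    rw [homogeneousComponent_eq_self hX]
    exact hΩ.not_dvd_of_lt hX (X_ne_zero i) (by omega)
  rw [Ne, P.map_eq_zero_iff]
  exact h.not_dvd n.succ_ne_zero hΩ hp (Or.inr (by norm_num))

end Presentation

end NambuPoisson

/-! ### The homomorphism to the associated graded ring -/

namespace ZeroValuation

open NambuPoisson MvPolynomial

section Symbols
variable {k : Type*} {n : ℕ} {N : Type*} [Field k] [Field N] [Algebra k N] [NambuPoisson k n N]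
  (ν : ZeroValuation k n N)

theorem grSymbol_eq_zero_iff {i : ℤ} {a : N} (h : a ∈ ν.filtration i) :
    ν.grSymbol i a = 0 ↔ a ∈ ν.filtration (i + 1) := by
  rw [grSymbol_of_mem _ h, ← ν.grMk_eq_zero_iff h]
  exact map_eq_zero_iff _ (DirectSum.of_injective i)

theorem eq_of_mem_of_notMem {i : ℤ} {a : N} (h : a ∈ ν.filtration i)
    (h' : a ∉ ν.filtration (i + 1)) : ν a = i := by
  rw [mem_filtration] at h h'
  cases ha : ν a with
  | top => rw [ha] at h'; exact absurd le_top h'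
  | coe b => rw [ha] at h h'; norm_cast at h h' ⊢; omega

theorem algebraMap_gr (c : k) : algebraMap k ν.Gr c = ν.grSymbol 0 (algebraMap k N c) := by
  rw [grSymbol_of_mem _ (ν.algebraMap_mem_filtration c)]
  rfl

theorem filtration_anti {i j : ℤ} (h : i ≤ j) {a : N} (ha : a ∈ ν.filtration j) :
    a ∈ ν.filtration i := by
  rw [mem_filtration] at ha ⊢
  exact le_trans (by exact_mod_cast h) ha

end Symbols

section GrMap

variable {k : Type u} {n : ℕ} {N : Type*} [Field k] [Field N] [Algebra k N] [NambuPoisson k n N]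
  (ν : ZeroValuation k n N) {Ω : MvPolynomial (Fin (n + 1)) k} {ξ : k} (P : Presentation Ω ξ N)

/-- The homomorphism from the polynomial ring to `gr_ν(N)` that sends the coordinates to the classes
of their images in degree `m`. -/
noncomputable def grMap (m : ℤ) : MvPolynomial (Fin (n + 1)) k →ₐ[k] ν.Gr :=
  aeval fun i => ν.grSymbol m (P.toHom (X i))

variable {m : ℤ}

/-- On homogeneous polynomials `f` of degree `d`, `grMap` takes the class of the image of `f` in degree
`m d`. -/
theorem grMap_of_isHomogeneous (hm : ∀ i, P.toHom (X i) ∈ ν.filtration m)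
    {f : MvPolynomial (Fin (n + 1)) k} {d : ℕ} (hf : f.IsHomogeneous d) :
    P.toHom f ∈ ν.filtration (m * d) ∧ ν.grMap P m f = ν.grSymbol (m * d) (P.toHom f) := by
  let Q : MvPolynomial (Fin (n + 1)) k → ℕ → Prop := fun f d =>
    P.toHom f ∈ ν.filtration (m * d) ∧ ν.grMap P m f = ν.grSymbol (m * d) (P.toHom f)
  have hC : ∀ c : k, Q (C c) 0 := by
    intro c
    refine ⟨?_, ?_⟩ <;> rw [← MvPolynomial.algebraMap_eq, P.toHom.commutes, Nat.cast_zero, mul_zero]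
    · exact ν.algebraMap_mem_filtration c
    · rw [(ν.grMap P m).commutes, algebraMap_gr]
  have hmul : ∀ f g d e, Q f d → Q g e → Q (f * g) (d + e) := by
    rintro f g d e ⟨hf, hf'⟩ ⟨hg, hg'⟩
    have e1 : m * ((d + e : ℕ) : ℤ) = m * d + m * e := by push_cast; ring
    refine ⟨?_, ?_⟩ <;> rw [_root_.map_mul, e1]
    · exact ν.mul_mem_filtration hf hg
    · rw [_root_.map_mul, hf', hg', grSymbol_mul _ hf hg]
  have hX : ∀ i, Q (X i) 1 := by
    intro i
    refine ⟨?_, ?_⟩ <;> rw [Nat.cast_one, mul_one]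
    · exact hm i
    · rw [grMap, aeval_X]
  have hpow : ∀ i e, Q (X i ^ e) e := by
    intro i e
    induction e with
    | zero => simpa using hC 1
    | succ e ih => rw [pow_succ]; exact hmul _ _ _ _ ih (hX i)
  have hmon : ∀ μ : Fin (n + 1) →₀ ℕ, Q (monomial μ 1) μ.degree := by
    intro μ
    induction μ using Finsupp.induction_linear with
    | zero => simpa using hC 1
    | add μ μ' h h' =>
      have : monomial (μ + μ') (1 : k) = monomial μ 1 * monomial μ' 1 := by simp
      rw [this, _root_.map_add]
      exact hmul _ _ _ _ h h'
    | single i e =>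
      rw [← X_pow_eq_monomial, Finsupp.degree_single]
      exact hpow i e
  have hmon' : ∀ (μ : Fin (n + 1) →₀ ℕ) (c : k), Q (monomial μ c) μ.degree := by
    intro μ c
    have : monomial μ c = C c * monomial μ 1 := by rw [C_mul_monomial, mul_one]
    rw [this, ← zero_add μ.degree]
    exact hmul _ _ _ _ (hC c) (hmon μ)
  have hterm : ∀ μ ∈ f.support, Q (monomial μ (coeff μ f)) d := by
    intro μ hμ
    have : μ.degree = d := by
      by_contra h
      exact mem_support_iff.mp hμ (hf.coeff_eq_zero h)
    rw [← this]
    exact hmon' _ _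
  change Q f d
  rw [f.as_sum]
  refine ⟨?_, ?_⟩
  · rw [map_sum]
    exact sum_mem fun μ hμ => (hterm μ hμ).1
  · rw [map_sum, map_sum, grSymbol_sum _ _ fun μ hμ => (hterm μ hμ).1]
    exact Finset.sum_congr rfl fun μ hμ => (hterm μ hμ).2

theorem grMap_bracket [CharZero k] (hm : ∀ i, P.toHom (X i) ∈ ν.filtration m)
    (hΩ : Ω.IsHomogeneous (n + 1))
    (v : Fin n → MvPolynomial (Fin (n + 1)) k) :
    ν.grMap P m (nambuPolyBracket Ω v) = bracket (k := k) fun i => ν.grMap P m (v i) := by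
  refine map_bracket_of_coordinates _ (fun σ => ?_) v
  have h1 := nambuPolyBracket_isHomogeneous hΩ (v := fun i => X (σ i)) (d := fun _ => 1)
    fun i => isHomogeneous_X k (σ i)
  rw [(ν.grMap_of_isHomogeneous P hm h1).2, P.map_bracket]
  have h2 : (fun i => ν.grMap P m (X (σ i))) = fun i => ν.grSymbol m (P.toHom (X (σ i))) := by
    ext1 i; rw [grMap, aeval_X]
  rw [h2]
  refine Eq.trans ?_ (ν.grMultilinear_symbol (p := fun _ => m) fun i => hm (σ i)).symm
  congr 1
  simp [mul_comm]

theorem toHom_mem_filtration (hm : ∀ i, P.toHom (X i) ∈ ν.filtration m)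
    {r c i : ℤ} (hc : 0 ≤ c) (hmc : m = c * r)
    {f : MvPolynomial (Fin (n + 1)) k} (hf : f ∈ degGE (Fin (n + 1)) k r i) :
    P.toHom f ∈ ν.filtration (c * i) := by
  rw [← sum_homogeneousComponent f, map_sum]
  refine sum_mem fun d _ => ?_
  by_cases hd : r * d < i
  · rw [homogeneousComponent_eq_zero_of_mem_degGE hf hd, _root_.map_zero]
    exact zero_mem _
  · refine ν.filtration_anti ?_
      (ν.grMap_of_isHomogeneous P hm (homogeneousComponent_isHomogeneous d f)).1
    rw [hmc, mul_assoc]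
    exact mul_le_mul_of_nonneg_left (not_lt.mp hd) hc

end GrMap

end ZeroValuation

/-! ### Classification of the `0`-valuations -/

namespace ZeroValuation

open NambuPoisson MvPolynomial

variable {k : Type u} {n : ℕ} {N : Type*} [Field k] [Field N] [Algebra k N] [NambuPoisson k n N]
  (ν : ZeroValuation k n N) {Ω : MvPolynomial (Fin (n + 1)) k} {ξ : k} (P : Presentation Ω ξ N)

theorem exists_min_coordinate (h : ∃ i, P.toHom (X i) ≠ 0) :
    ∃ m : ℤ, (∀ i, P.toHom (X i) ∈ ν.filtration m) ∧ ∃ l, P.toHom (X l) ∉ ν.filtration (m + 1) := by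
  obtain ⟨l, -, hl⟩ := Finset.univ.exists_min_image (fun i => ν (P.toHom (X i)))
    Finset.univ_nonempty
  obtain ⟨i, hi⟩ := h
  cases hm : ν (P.toHom (X l)) with
  | top =>
    have := hl i (Finset.mem_univ i)
    rw [hm, top_le_iff, ν.eq_top_iff] at this
    exact absurd this hi
  | coe m =>
    refine ⟨m, fun j => ?_, l, ?_⟩
    · have := hl j (Finset.mem_univ j)
      rwa [hm] at this
    · rw [mem_filtration, hm]
      norm_cast
      omega

theorem exists_grMap_pderiv_ne_zero (hΩ : Ω.IsHomogeneous (n + 1)) (hs : HasIsolatedSingularity Ω)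
    {m : ℤ} (hm : ∀ i, P.toHom (X i) ∈ ν.filtration m) {l : Fin (n + 1)}
    (hl : P.toHom (X l) ∉ ν.filtration (m + 1)) : ∃ j, ν.grMap P m (pderiv j Ω) ≠ 0 := by
  by_contra! h
  obtain ⟨M, hM⟩ := hs.exists_X_pow_mem hΩ l
  have hJ : jacobianIdeal Ω ≤ RingHom.ker (ν.grMap P m) := by
    refine Ideal.span_le.mpr ?_
    rintro _ ⟨j, rfl⟩
    exact h j
  have h1 := hJ hM
  rw [RingHom.mem_ker, _root_.map_pow] at h1
  have h2 := eq_zero_of_pow_eq_zero h1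
  rw [grMap, aeval_X, ν.grSymbol_eq_zero_iff (hm l)] at h2
  exact hl h2

section Lead

variable {ν P} {m c r : ℤ}

/-- The class of the image of `f` is the image under `grMap` of the leading component of `f`. -/
theorem grMap_lead (hr : r ≠ 0) (hc : 0 < c) (hmc : m = c * r)
    (hm : ∀ i, P.toHom (X i) ∈ ν.filtration m)
    {f : MvPolynomial (Fin (n + 1)) k} {d : ℕ} (hf : IsLead Ω r f d) :
    P.toHom f ∈ ν.filtration (m * d) ∧
      ν.grMap P m (homogeneousComponent d f) = ν.grSymbol (m * d) (P.toHom f) := by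
  have h1 := ν.toHom_mem_filtration P hm hc.le hmc (sub_homogeneousComponent_mem_degGE hr hf.1)
  obtain ⟨h2, h3⟩ := ν.grMap_of_isHomogeneous P hm (homogeneousComponent_isHomogeneous d f)
  have h4 : P.toHom (f - homogeneousComponent d f) ∈ ν.filtration (m * d + 1) := by
    refine ν.filtration_anti ?_ h1
    rw [hmc]; nlinarith
  have h5 := ν.filtration_anti (by omega) h4 (i := m * d)
  have e : P.toHom f = P.toHom (homogeneousComponent d f) +
      P.toHom (f - homogeneousComponent d f) := by
    rw [← _root_.map_add, add_sub_cancel]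
  rw [e]
  refine ⟨add_mem h2 h5, ?_⟩
  rw [h3, grSymbol_add _ h2 h5, (ν.grSymbol_eq_zero_iff h5).mpr h4, add_zero]

theorem apply_toHom_lead (hr : r ≠ 0) (hc : 0 < c) (hmc : m = c * r)
    (hm : ∀ i, P.toHom (X i) ∈ ν.filtration m) (hker : ∀ f, ν.grMap P m f = 0 ↔ Ω ∣ f)
    {f : MvPolynomial (Fin (n + 1)) k} {d : ℕ} (hf : IsLead Ω r f d) :
    ν (P.toHom f) = ((m * d : ℤ) : WithTop ℤ) := by
  obtain ⟨h1, h2⟩ := grMap_lead hr hc hmc hm hf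
  refine ν.eq_of_mem_of_notMem h1 fun h => hf.2 ?_
  rw [← hker, h2, ν.grSymbol_eq_zero_iff h1]
  exact h

/-- Every element of the associated graded ring is a fraction of values of `grMap`. -/
theorem exists_grMap_div (hr : r ≠ 0) (hξ : ξ = 0 ∧ r ≠ 0 ∨ r < 0) (hc : 0 < c) (hmc : m = c * r)
    (hm : ∀ i, P.toHom (X i) ∈ ν.filtration m) (hker : ∀ f, ν.grMap P m f = 0 ↔ Ω ∣ f)
    (hΩ : Ω.IsHomogeneous (n + 1)) (x : ν.Gr) :
    ∃ f g, ν.grMap P m g ≠ 0 ∧ x * ν.grMap P m g = ν.grMap P m f := by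
  refine ν.gr_induction (p := fun x => ∃ f g, ν.grMap P m g ≠ 0 ∧
    x * ν.grMap P m g = ν.grMap P m f) ?_ ?_ x
  · rintro _ ⟨i, a, ha, rfl⟩
    by_cases ha' : a ∈ ν.filtration (i + 1)
    · refine ⟨0, 1, by simp, ?_⟩
      rw [(ν.grSymbol_eq_zero_iff ha).mpr ha', zero_mul, _root_.map_zero]
    have hνa := ν.eq_of_mem_of_notMem ha ha'
    have ha0 : a ≠ 0 := by
      rintro rfl
      exact ha' (zero_mem _)
    obtain ⟨f, g, hg, h⟩ := P.exists_div a
    have hf : P.toHom f ≠ 0 := by rw [← h]; exact mul_ne_zero ha0 hg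
    obtain ⟨f', d, hf', hff'⟩ := P.exists_isLead hΩ hξ hf
    obtain ⟨g', e, hg', hgg'⟩ := P.exists_isLead hΩ hξ hg
    rw [← hff', ← hgg'] at h
    obtain ⟨hg1, hg2⟩ := grMap_lead hr hc hmc hm hg'
    obtain ⟨hf1, hf2⟩ := grMap_lead hr hc hmc hm hf'
    refine ⟨homogeneousComponent d f', homogeneousComponent e g',
      fun h0 => hg'.2 ((hker _).mp h0), ?_⟩
    rw [hg2, hf2, grSymbol_mul _ ha hg1, h]
    congr 1
    have h1 := congrArg ν h
    rw [ν.map_mul, hνa, apply_toHom_lead hr hc hmc hm hker hf',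
      apply_toHom_lead hr hc hmc hm hker hg'] at h1
    exact_mod_cast h1
  · rintro x y ⟨f, g, hg, hfg⟩ ⟨f', g', hg', hfg'⟩
    refine ⟨f * g' + f' * g, g * g', by rw [_root_.map_mul]; exact mul_ne_zero hg hg', ?_⟩
    simp only [_root_.map_mul, _root_.map_add, ← hfg, ← hfg']
    ring

end Lead

theorem exists_sign {ξ : k} {m : ℤ} (h : ξ = 0 ∧ m ≠ 0 ∨ m < 0) :
    ∃ c r : ℤ, 0 < c ∧ m = c * r ∧ (ξ = 0 ∧ r = 1 ∨ r = -1) := by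
  rcases lt_trichotomy m 0 with hm | hm | hm
  · exact ⟨-m, -1, by omega, by ring, Or.inr rfl⟩
  · exact absurd hm (h.elim (fun h => h.2) (fun h => h.ne))
  · exact ⟨m, 1, hm, by ring, Or.inl ⟨h.elim (fun h => h.1) (fun h => by omega), rfl⟩⟩

theorem sign_admissible {ξ : k} {r : ℤ} (h : ξ = 0 ∧ r = 1 ∨ r = -1) :
    ξ = 0 ∧ r ≠ 0 ∨ r < 0 :=
  h.imp (fun h => ⟨h.1, by omega⟩) (fun h => by omega)

variable [CharZero k]

theorem grMap_stable {m : ℤ} (hm : ∀ i, P.toHom (X i) ∈ ν.filtration m)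
    (hΩ : Ω.IsHomogeneous (n + 1)) (v : Fin n → MvPolynomial (Fin (n + 1)) k) (i : Fin n)
    (h : ν.grMap P m (v i) = 0) : ν.grMap P m (nambuPolyBracket Ω v) = 0 := by
  rw [ν.grMap_bracket P hm hΩ]
  exact (bracket (k := k)).map_coord_zero i h

/-- If the coordinates have values `≥ 0`, with equality for one of them, then `ν` is trivial: the
elements of positive value form a bracket stable prime ideal of `P_{Ω-ξ}`. -/
theorem apply_eq_zero_of_min_eq_zero (hn : n ≠ 0) (hΩ : Ω.IsHomogeneous (n + 1))
    (hs : HasIsolatedSingularity Ω) (hp : Prime (Ω - C ξ))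
    (hm : ∀ i, P.toHom (X i) ∈ ν.filtration 0) {l : Fin (n + 1)}
    (hl : P.toHom (X l) ∉ ν.filtration (0 + 1)) {a : N} (ha : a ≠ 0) : ν a = 0 := by
  have hφ : ∀ f, P.toHom f ∈ ν.filtration 0 ∧ ν.grMap P 0 f = ν.grSymbol 0 (P.toHom f) := by
    intro f
    have h : ∀ d, P.toHom (homogeneousComponent d f) ∈ ν.filtration 0 ∧
        ν.grMap P 0 (homogeneousComponent d f) =
          ν.grSymbol 0 (P.toHom (homogeneousComponent d f)) := by
      intro d
      simpa using ν.grMap_of_isHomogeneous P hm (homogeneousComponent_isHomogeneous d f)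
    rw [← sum_homogeneousComponent f, map_sum, map_sum, grSymbol_sum _ _ fun d _ => (h d).1]
    exact ⟨sum_mem fun d _ => (h d).1, Finset.sum_congr rfl fun d _ => (h d).2⟩
  have hP0 : ν.grMap P 0 (Ω - C ξ) = 0 := by
    rw [(hφ _).2, (P.map_eq_zero_iff _).mpr dvd_rfl, grSymbol_zero]
  have hval : ∀ f, P.toHom f ≠ 0 → ν (P.toHom f) = 0 := by
    intro f hf
    refine ν.eq_of_mem_of_notMem (hφ f).1 fun h => hf ?_
    rw [P.map_eq_zero_iff]
    refine dvd_of_map_eq_zero hn (ν.grMap P 0) (fun v i => ν.grMap_stable P hm hΩ v i)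
      (ν.exists_grMap_pderiv_ne_zero P hΩ hs hm hl) hp hP0 ?_
    rw [(hφ f).2, ν.grSymbol_eq_zero_iff (hφ f).1]
    exact h
  obtain ⟨f, g, hg, h⟩ := P.exists_div a
  have h1 := congrArg ν h
  rw [ν.map_mul, hval g hg, hval f (by rw [← h]; exact mul_ne_zero ha hg), add_zero] at h1
  exact h1

/-- The value `m` of a nontrivial `0`-valuation at the coordinates is nonzero, and negative if `ξ ≠ 0`;
the homomorphism `grMap` has kernel `(Ω)`. -/
theorem exists_grMap_ker (hn : 2 ≤ n) (hΩ : Ω.IsHomogeneous (n + 1))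
    (hs : HasIsolatedSingularity Ω) (hν : ν.IsNontrivial) :
    ∃ m : ℤ, (ξ = 0 ∧ m ≠ 0 ∨ m < 0) ∧ (∀ i, P.toHom (X i) ∈ ν.filtration m) ∧
      ∀ f, ν.grMap P m f = 0 ↔ Ω ∣ f := by
  have hn0 : n ≠ 0 := by omega
  have hpΩ := hs.prime hn n.succ_ne_zero hΩ
  obtain ⟨m, hm, l, hl⟩ := ν.exists_min_coordinate P ⟨0, P.toHom_X_ne_zero hn0 hΩ hpΩ 0⟩
  have hm0 : m ≠ 0 := by
    rintro rfl
    obtain ⟨a, ha, hνa⟩ := hν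
    exact hνa (ν.apply_eq_zero_of_min_eq_zero P hn0 hΩ hs
      (prime_sub_C n.succ_ne_zero hΩ hpΩ ξ) hm hl ha)
  have hsign : ξ = 0 ∧ m ≠ 0 ∨ m < 0 := by
    by_cases hξ : ξ = 0
    · exact Or.inl ⟨hξ, hm0⟩
    · right
      have h1 := (ν.grMap_of_isHomogeneous P hm hΩ).1
      rw [P.toHom_potential, mem_filtration, ν.map_algebraMap ξ hξ] at h1
      have h2 : m * (n + 1 : ℕ) ≤ 0 := by exact_mod_cast h1
      refine lt_of_le_of_ne ?_ hm0
      by_contra! hpos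
      have : (0 : ℤ) < (n + 1 : ℕ) := by exact_mod_cast n.succ_pos
      nlinarith
  have hφΩ : ν.grMap P m Ω = 0 := by
    obtain ⟨h1, h2⟩ := ν.grMap_of_isHomogeneous P hm hΩ
    rw [h2, ν.grSymbol_eq_zero_iff h1, P.toHom_potential]
    rcases hsign with ⟨rfl, -⟩ | hneg
    · rw [_root_.map_zero]; exact zero_mem _
    · refine ν.filtration_anti ?_ (ν.algebraMap_mem_filtration ξ)
      have : (0 : ℤ) < (n + 1 : ℕ) := by exact_mod_cast n.succ_pos
      nlinarith
  refine ⟨m, hsign, hm, fun f => ⟨fun hf => ?_, ?_⟩⟩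
  · exact dvd_of_map_eq_zero hn0 (ν.grMap P m) (fun v i => ν.grMap_stable P hm hΩ v i)
      (ν.exists_grMap_pderiv_ne_zero P hΩ hs hm hl) hpΩ hφΩ hf
  · rintro ⟨q, rfl⟩
    rw [_root_.map_mul, hφΩ, zero_mul]

/-- For nontrivial `ν`, the fraction field of the associated graded ring is presented by `Ω` itself. -/
theorem nonempty_gr_presentation {N : Type u} [Field N] [Algebra k N] [NambuPoisson k n N]
    (ν : ZeroValuation k n N) (P : Presentation Ω ξ N) (hn : 2 ≤ n)
    (hΩ : Ω.IsHomogeneous (n + 1)) (hs : HasIsolatedSingularity Ω) (hν : ν.IsNontrivial) :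
    Nonempty (Presentation Ω 0 (FractionRing ν.Gr)) := by
  obtain ⟨m, hsign, hm, hker⟩ := ν.exists_grMap_ker P hn hΩ hs hν
  obtain ⟨c, r, hc, hmc, hr⟩ := exists_sign hsign
  have hr' := sign_admissible hr
  have hr0 : r ≠ 0 := hr'.elim (fun h => h.2) (fun h => h.ne)
  have inj : Injective (algebraMap ν.Gr (FractionRing ν.Gr)) := IsFractionRing.injective _ _
  refine ⟨{
    toHom := (IsScalarTower.toAlgHom k ν.Gr (FractionRing ν.Gr)).comp (ν.grMap P m)
    map_eq_zero_iff := fun f => ?_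
    map_bracket := fun v => ?_
    exists_div := fun z => ?_ }⟩
  · rw [C_0, sub_zero, ← hker, AlgHom.comp_apply]
    exact map_eq_zero_iff _ inj
  · rw [AlgHom.comp_apply, ν.grMap_bracket P hm hΩ]
    exact (fracBracket_algebraMap (k := k) (A := ν.Gr) (FractionRing ν.Gr)
      fun i => ν.grMap P m (v i)).symm
  · obtain ⟨a, s, hs0, h⟩ := frac_rep (A := ν.Gr) (FractionRing ν.Gr) z
    obtain ⟨f, g, hg, hfg⟩ := exists_grMap_div hr0 hr' hc hmc hm hker hΩ a
    obtain ⟨f', g', hg', hfg'⟩ := exists_grMap_div hr0 hr' hc hmc hm hker hΩ s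
    have hf' : ν.grMap P m f' ≠ 0 := by rw [← hfg']; exact mul_ne_zero hs0 hg'
    refine ⟨f * g', f' * g, ?_, ?_⟩
    · rw [AlgHom.comp_apply]
      refine (map_ne_zero_iff _ inj).mpr ?_
      rw [_root_.map_mul]
      exact mul_ne_zero hf' hg
    · change z * algebraMap _ _ (ν.grMap P m (f' * g)) = algebraMap _ _ (ν.grMap P m (f * g'))
      rw [_root_.map_mul (ν.grMap P m), _root_.map_mul (ν.grMap P m), ← hfg, ← hfg']
      simp only [_root_.map_mul]
      rw [← h]
      ring

end ZeroValuation

/-! ### Gelfand-Kirillov dimension -/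

section GKdim

variable {k A B : Type*} [Field k] [CommRing A] [Algebra k A] [CommRing B] [Algebra k B]

theorem GKdim_le_of_forall_finrank_le
    (h : ∀ V : Submodule k A, V.FG → 1 ∈ V → ∃ W : Submodule k B, W.FG ∧ 1 ∈ W ∧
      ∀ m : ℕ, Module.finrank k ↥(V ^ m) ≤ Module.finrank k ↥(W ^ m)) :
    GKdim k A ≤ GKdim k B := by
  refine iSup₂_le fun V hV => iSup_le fun hV1 => ?_
  obtain ⟨W, hW, hW1, hle⟩ := h V hV hV1
  refine le_trans ?_ (le_iSup₂_of_le W hW (le_iSup_of_le hW1 le_rfl))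
  refine Filter.limsup_le_limsup (Filter.Eventually.of_forall fun m => ?_)
  refine EReal.coe_le_coe_iff.mpr (div_le_div_of_nonneg_right ?_ (Real.log_natCast_nonneg m))
  rcases Nat.eq_zero_or_pos (Module.finrank k ↥(V ^ m)) with h0 | h0
  · rw [h0, Nat.cast_zero, Real.log_zero]
    exact Real.log_natCast_nonneg _
  · exact Real.log_le_log (by exact_mod_cast h0) (by exact_mod_cast hle m)

theorem finrank_map_of_injective {M M' : Type*} [AddCommGroup M] [Module k M] [AddCommGroup M']
    [Module k M'] {f : M →ₗ[k] M'} (hf : Injective f) (V : Submodule k M) :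
    Module.finrank k ↥(V.map f) = Module.finrank k ↥V :=
  (V.equivMapOfInjective f hf).finrank_eq.symm

theorem finrank_le_of_le_of_fg {M : Type*} [AddCommGroup M] [Module k M] {V W : Submodule k M}
    (hW : W.FG) (h : V ≤ W) : Module.finrank k ↥V ≤ Module.finrank k ↥W := by
  have : Module.Finite k W := Module.Finite.iff_fg.mpr hW
  exact Submodule.finrank_mono h

theorem GKdim_le_of_injective (φ : A →ₐ[k] B) (hφ : Injective φ) : GKdim k A ≤ GKdim k B := by
  refine GKdim_le_of_forall_finrank_le fun V hV hV1 =>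
    ⟨V.map φ.toLinearMap, hV.map _, ⟨1, hV1, map_one φ⟩, fun m => ?_⟩
  rw [← Submodule.map_pow]
  exact (finrank_map_of_injective (f := φ.toLinearMap) hφ _).ge

theorem GKdim_eq_of_algEquiv (e : A ≃ₐ[k] B) : GKdim k A = GKdim k B :=
  le_antisymm (GKdim_le_of_injective e.toAlgHom e.injective)
    (GKdim_le_of_injective e.symm.toAlgHom e.symm.injective)

/-- Passing to the fraction field does not change the Gelfand-Kirillov dimension: if `s` is a common
denominator of a finite-dimensional subspace `V`, then `s ^ m V ^ m` consists of products of `m`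
numerators. -/
theorem GKdim_fractionRing [IsDomain A] : GKdim k (FractionRing A) = GKdim k A := by
  refine le_antisymm (GKdim_le_of_forall_finrank_le fun V hV _ => ?_)
    (GKdim_le_of_injective (IsScalarTower.toAlgHom k A (FractionRing A))
      (IsFractionRing.injective A _))
  obtain ⟨S, rfl⟩ := hV
  classical
  obtain ⟨s, hs⟩ := IsLocalization.exist_integer_multiples_of_finset (nonZeroDivisors A) S
  choose! p hp using hs
  let ι := IsScalarTower.toAlgHom k A (FractionRing A)
  have hι : Injective ι := IsFractionRing.injective A _
  let W : Submodule k A := Submodule.span k (insert 1 (S.image p) : Finset A)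
  have hsS : Submodule.span k {ι s} * Submodule.span k (S : Set (FractionRing A)) ≤
      W.map ι.toLinearMap := by
    rw [Submodule.span_mul_span, Submodule.span_le]
    rintro _ ⟨_, rfl, x, hx, rfl⟩
    refine ⟨p x, Submodule.subset_span (by
      simp only [Finset.coe_insert, Finset.coe_image]
      exact Or.inr ⟨x, hx, rfl⟩), ?_⟩
    refine (hp x hx).trans ?_
    rw [Algebra.smul_def]
    rfl
  refine ⟨W, ⟨_, rfl⟩, Submodule.subset_span (by simp), fun m => ?_⟩
  have hWm : (W ^ m).FG := Submodule.FG.pow ⟨_, rfl⟩ m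
  have hs0 : ι s ≠ 0 := (map_ne_zero_iff _ hι).mpr (nonZeroDivisors.ne_zero s.2)
  have h1 : (Submodule.span k (S : Set (FractionRing A)) ^ m).map
      (LinearMap.mulLeft k (ι s ^ m)) ≤ (W ^ m).map ι.toLinearMap := by
    rw [Submodule.map_pow]
    refine le_trans ?_ (pow_le_pow_left' hsS m)
    rw [mul_pow]
    rintro _ ⟨x, hx, rfl⟩
    exact Submodule.mul_mem_mul
      (Submodule.pow_mem_pow _ (Submodule.mem_span_singleton_self _) m) hx
  have h2 := finrank_le_of_le_of_fg (hWm.map _) h1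
  rwa [finrank_map_of_injective (f := ι.toLinearMap) hι,
    finrank_map_of_injective (mul_right_injective₀ (pow_ne_zero m hs0))] at h2

end GKdim

namespace NambuPoisson

open MvPolynomial

variable {k : Type u} [Field k] {n : ℕ}

variable (n k) in
/-- The polynomials of degree at most `1`. -/
noncomputable def affineForms : Submodule k (MvPolynomial (Fin (n + 1)) k) :=
  Submodule.span k (insert 1 (Set.range X))

theorem affineForms_fg : (affineForms k n).FG :=
  Submodule.fg_span ((Set.finite_range X).insert 1)

theorem one_mem_affineForms : (1 : MvPolynomial (Fin (n + 1)) k) ∈ affineForms k n :=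
  Submodule.subset_span (Set.mem_insert _ _)

theorem mem_affineForms_pow {e : ℕ} {f : MvPolynomial (Fin (n + 1)) k} :
    f ∈ affineForms k n ^ e ↔ f.totalDegree ≤ e := by
  have one_le : (1 : Submodule k (MvPolynomial (Fin (n + 1)) k)) ≤ affineForms k n :=
    Submodule.one_le.mpr one_mem_affineForms
  constructor
  · have h : affineForms k n ^ e ≤ restrictTotalDegree (Fin (n + 1)) k e := by
      induction e with
      | zero =>
        rw [pow_zero, Submodule.one_le, mem_restrictTotalDegree, totalDegree_one]
      | succ e ih =>
        rw [pow_succ, Submodule.mul_le]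
        intro f hf g hg
        have hg' : g ∈ restrictTotalDegree (Fin (n + 1)) k 1 := by
          refine Submodule.span_le.mpr ?_ hg
          rintro _ (rfl | ⟨i, rfl⟩)
          · rw [SetLike.mem_coe, mem_restrictTotalDegree, totalDegree_one]
            exact zero_le_one
          · rw [SetLike.mem_coe, mem_restrictTotalDegree, totalDegree_X]
        have hf' := ih hf
        rw [mem_restrictTotalDegree] at hf' hg' ⊢
        exact (totalDegree_mul f g).trans (add_le_add hf' hg')
    intro hf
    exact (mem_restrictTotalDegree _ _ _).mp (h hf)
  · intro hf
    have hmon : ∀ μ : Fin (n + 1) →₀ ℕ, monomial μ (1 : k) ∈ affineForms k n ^ μ.degree := by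
      intro μ
      induction μ using Finsupp.induction_linear with
      | zero =>
        rw [_root_.map_zero, pow_zero, Submodule.mem_one]
        exact ⟨1, by simp⟩
      | add μ μ' h h' =>
        have : monomial (μ + μ') (1 : k) = monomial μ 1 * monomial μ' 1 := by simp
        rw [this, map_add, pow_add]
        exact Submodule.mul_mem_mul h h'
      | single i e =>
        rw [← X_pow_eq_monomial, Finsupp.degree_single]
        have hX : X i ∈ affineForms k n := Submodule.subset_span (Or.inr ⟨i, rfl⟩)
        exact Submodule.pow_mem_pow _ hX e
    rw [f.as_sum]
    refine sum_mem fun μ hμ => ?_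
    have e : monomial μ (coeff μ f) = coeff μ f • monomial μ (1 : k) := by
      rw [smul_monomial, smul_eq_mul, mul_one]
    rw [e]
    refine Submodule.smul_mem _ _ ((pow_le_pow_right' one_le ?_ :
      affineForms k n ^ μ.degree ≤ _) (hmon μ))
    exact (le_totalDegree hμ).trans hf

/-- The dimension of the space of polynomial functions of degree at most `e` on `Ω = ξ` does not
depend on `ξ`. -/
theorem finrank_map_hypMk_affineForms_pow {Ω : MvPolynomial (Fin (n + 1)) k} {D : ℕ} (hD : D ≠ 0)
    (hΩ : Ω.IsHomogeneous D) (hΩ0 : Ω ≠ 0) (ξ : k) (e : ℕ) :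
    Module.finrank k ↥((affineForms k n ^ e).map (hypMk Ω ξ).toLinearMap) =
      Module.finrank k ↥((affineForms k n ^ e).map (hypMk Ω 0).toLinearMap) := by
  have hdeg : ∀ ξ, (Ω - C ξ).totalDegree = D := by
    intro ξ
    rw [sub_eq_add_neg, ← C_neg, totalDegree_add_eq_left_of_totalDegree_lt, hΩ.totalDegree hΩ0]
    rw [totalDegree_C, hΩ.totalDegree hΩ0]
    exact Nat.pos_of_ne_zero hD
  let M := affineForms k n ^ e
  have : Module.Finite k M := Module.Finite.iff_fg.mpr (affineForms_fg.pow e)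
  -- the kernel is the image of the polynomials of degree at most `e - D`
  have key : ∀ ξ, Module.finrank k ↥(M.map (hypMk Ω ξ).toLinearMap) +
      Module.finrank k ↥(M.comap (LinearMap.mulLeft k Ω)) = Module.finrank k M := by
    intro ξ
    have h0 : Ω - C ξ ≠ 0 := by
      intro h
      have := hdeg ξ
      rw [h, totalDegree_zero] at this
      exact hD this.symm
    have hM : M.comap (LinearMap.mulLeft k Ω) = M.comap (LinearMap.mulLeft k (Ω - C ξ)) := by
      ext g
      rw [Submodule.mem_comap, Submodule.mem_comap, LinearMap.mulLeft_apply,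
        LinearMap.mulLeft_apply, mem_affineForms_pow, mem_affineForms_pow]
      rcases eq_or_ne g 0 with rfl | hg
      · rw [mul_zero, mul_zero]
      · rw [totalDegree_mul_of_isDomain hΩ0 hg, totalDegree_mul_of_isDomain h0 hg, hdeg,
          hΩ.totalDegree hΩ0]
    have hker : (LinearMap.ker ((hypMk Ω ξ).toLinearMap.domRestrict M)).map M.subtype =
        (M.comap (LinearMap.mulLeft k Ω)).map (LinearMap.mulLeft k (Ω - C ξ)) := by
      rw [hM]
      ext f
      constructor
      · rintro ⟨f, hf, rfl⟩
        obtain ⟨g, hg⟩ := (hypMk_eq_zero_iff Ω ξ f).mp hf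
        refine ⟨g, ?_, hg.symm⟩
        change _ ∈ M
        rw [LinearMap.mulLeft_apply, ← hg]
        exact f.2
      · rintro ⟨g, hg, rfl⟩
        exact ⟨⟨_, hg⟩, (hypMk_eq_zero_iff Ω ξ _).mpr ⟨g, rfl⟩, rfl⟩
    have hinj : Injective (LinearMap.mulLeft k (Ω - C ξ)) := fun _ _ h => mul_left_cancel₀ h0 h
    rw [← LinearMap.range_domRestrict, ← finrank_map_of_injective hinj, ← hker,
      finrank_map_of_injective M.injective_subtype]
    exact LinearMap.finrank_range_add_finrank_ker _
  exact Nat.add_right_cancel ((key ξ).trans (key 0).symm)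

theorem GKdim_nambuHyp {Ω : MvPolynomial (Fin (n + 1)) k} {D : ℕ} (hD : D ≠ 0)
    (hΩ : Ω.IsHomogeneous D) (hΩ0 : Ω ≠ 0) (ξ : k) :
    GKdim k (NambuHyp Ω ξ) = GKdim k (NambuHyp Ω 0) := by
  have key : ∀ ξ ξ', GKdim k (NambuHyp Ω ξ) ≤ GKdim k (NambuHyp Ω ξ') := by
    intro ξ ξ'
    refine GKdim_le_of_forall_finrank_le fun V hV _ => ?_
    obtain ⟨S, rfl⟩ := hV
    choose p hp using hypMk_surjective Ω ξ
    let d := S.sup fun x => (p x).totalDegree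
    have hS : Submodule.span k (S : Set (NambuHyp Ω ξ)) ≤
        (affineForms k n ^ d).map (hypMk Ω ξ).toLinearMap := by
      refine Submodule.span_le.mpr fun x hx => ⟨p x, ?_, hp x⟩
      exact mem_affineForms_pow.mpr (Finset.le_sup (f := fun x => (p x).totalDegree) hx)
    refine ⟨(affineForms k n ^ d).map (hypMk Ω ξ').toLinearMap, (affineForms_fg.pow d).map _,
      ⟨1, ?_, map_one (hypMk Ω ξ')⟩, fun m => ?_⟩
    · refine mem_affineForms_pow.mpr ?_
      rw [totalDegree_one]
      exact Nat.zero_le d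
    · refine (finrank_le_of_le_of_fg (((affineForms_fg.pow d).map _).pow m)
        (pow_le_pow_left' hS m)).trans ?_
      rw [← Submodule.map_pow, ← Submodule.map_pow, ← pow_mul,
        finrank_map_hypMk_affineForms_pow hD hΩ hΩ0 ξ,
        finrank_map_hypMk_affineForms_pow hD hΩ hΩ0 ξ']
  exact le_antisymm (key _ _) (key _ _)

end NambuPoisson

/-! ### Uniqueness of the presented field -/

namespace NambuPoisson

open MvPolynomial

variable {k : Type u} [Field k] {n : ℕ} {Ω : MvPolynomial (Fin (n + 1)) k} {ξ : k}

namespace Presentation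

section
variable {M N : Type*} [Field M] [Algebra k M] [NambuPoisson k n M] [Field N] [Algebra k N]
  [NambuPoisson k n N] (P : Presentation Ω ξ M) (P' : Presentation Ω ξ N)

theorem exists_algHom : ∃ e : M →ₐ[k] N, ∀ f, e (P.toHom f) = P'.toHom f := by
  choose f g hg h using P.exists_div
  have ne : ∀ {a}, P.toHom a ≠ 0 → P'.toHom a ≠ 0 := fun ha => by
    rwa [Ne, P'.map_eq_zero_iff, ← P.map_eq_zero_iff]
  have spec : ∀ z a b, P.toHom b ≠ 0 → z * P.toHom b = P.toHom a →
      P'.toHom (f z) / P'.toHom (g z) = P'.toHom a / P'.toHom b := by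
    intro z a b hb hz
    rw [div_eq_div_iff (ne (hg z)) (ne hb), ← map_mul, ← map_mul, toHom_eq_iff,
      ← P.toHom_eq_iff, map_mul, map_mul, ← h z, ← hz]
    ring
  have spec' : ∀ a, P'.toHom (f (P.toHom a)) / P'.toHom (g (P.toHom a)) = P'.toHom a := by
    intro a
    rw [spec (P.toHom a) a 1 (by simp) (by simp), map_one, div_one]
  refine ⟨{
    toFun := fun z => P'.toHom (f z) / P'.toHom (g z)
    map_one' := by simpa using spec' 1
    map_zero' := by simpa using spec' 0
    map_mul' := fun x y => ?_
    map_add' := fun x y => ?_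
    commutes' := fun c => ?_ }, spec'⟩
  · rw [spec (x * y) (f x * f y) (g x * g y), map_mul, map_mul, div_mul_div_comm]
    · rw [map_mul]; exact mul_ne_zero (hg x) (hg y)
    · rw [map_mul, map_mul, ← h, ← h]; ring
  · rw [spec (x + y) (f x * g y + g x * f y) (g x * g y), map_mul, map_add, map_mul, map_mul,
      div_add_div _ _ (ne (hg x)) (ne (hg y))]
    · rw [map_mul]; exact mul_ne_zero (hg x) (hg y)
    · rw [map_mul, map_add, map_mul, map_mul, ← h x, ← h y]; ring
  · have := spec' (algebraMap k _ c)
    rwa [P.toHom.commutes, P'.toHom.commutes] at this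

theorem exists_algEquiv : ∃ e : M ≃ₐ[k] N, ∀ f, e (P.toHom f) = P'.toHom f := by
  obtain ⟨e, he⟩ := P.exists_algHom P'
  refine ⟨AlgEquiv.ofBijective e ⟨e.toRingHom.injective, fun z => ?_⟩, he⟩
  obtain ⟨f, g, hg, h⟩ := P'.exists_div z
  refine ⟨P.toHom f / P.toHom g, ?_⟩
  rw [map_div₀, he, he, ← h, mul_div_cancel_right₀ _ hg]

/-- A homomorphism of fields which respects the brackets on a generating subalgebra respects them. -/
theorem map_bracket_of_map_toHom (e : M →ₐ[k] N) (he : ∀ f, e (P.toHom f) = P'.toHom f)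
    (v : Fin n → M) : e (bracket (k := k) v) = bracket (k := k) fun i => e (v i) := by
  revert v
  refine slotwise _ (Set.range P.toHom) ?_ ?_
  · intro v hv
    choose f hf using hv
    obtain rfl : (fun i => P.toHom (f i)) = v := funext hf
    rw [← P.map_bracket, he, P'.map_bracket]
    simp only [he]
  · intro v i hv z
    have c : ∀ z, (fun j => e (update v i z j)) = update (fun j => e (v j)) i (e z) := fun z =>
      comp_update e v i z
    simp only [c] at hv ⊢
    obtain ⟨f, g, hg, h⟩ := P.exists_div z
    have h1 := congrArg e (leibniz (k := k) v i z (P.toHom g))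
    have h2 := leibniz (k := k) (fun j => e (v j)) i (e z) (e (P.toHom g))
    rw [h, map_add, map_mul, map_mul, hv _ ⟨f, rfl⟩, hv _ ⟨g, rfl⟩] at h1
    rw [← map_mul, h, h1] at h2
    exact mul_left_cancel₀ ((map_ne_zero_iff e e.toRingHom.injective).mpr hg)
      (add_left_cancel h2)

end

theorem iso {M N : NambuPoissonField k n} (P : Presentation Ω ξ M.carrier)
    (P' : Presentation Ω ξ N.carrier) : M.Iso N := by
  obtain ⟨e, he⟩ := P.exists_algEquiv P'
  exact ⟨e, P.map_bracket_of_map_toHom P' e.toAlgHom he⟩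

theorem nonempty_of_iso {M N : NambuPoissonField k n} (P : Presentation Ω ξ M.carrier)
    (h : M.Iso N) : Nonempty (Presentation Ω ξ N.carrier) := by
  obtain ⟨e, he⟩ := h
  refine ⟨{
    toHom := e.toAlgHom.comp P.toHom
    map_eq_zero_iff := fun f => ?_
    map_bracket := fun v => ?_
    exists_div := fun z => ?_ }⟩
  · rw [← P.map_eq_zero_iff]
    exact _root_.map_eq_zero_iff e e.injective
  · refine (congrArg e (P.map_bracket v)).trans (he _)
  · obtain ⟨f, g, hg, h⟩ := P.exists_div (e.symm z)
    refine ⟨f, g, (map_ne_zero_iff e e.injective).mpr hg, ?_⟩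
    have := congrArg e h
    rwa [map_mul, e.apply_symm_apply] at this

end Presentation

/-- Up to sign, the partial derivatives of `Ω` are the brackets of the coordinates. -/
theorem exists_nambuPolyBracket_eq_pderiv (Ω : MvPolynomial (Fin (n + 1)) k) (j : Fin (n + 1)) :
    ∃ (v : Fin n → MvPolynomial (Fin (n + 1)) k) (s : ℤˣ),
      nambuPolyBracket Ω v = (s : ℤ) • pderiv j Ω := by
  let τ : Equiv.Perm (Fin (n + 1)) := Equiv.swap (Fin.last n) j
  set y : Fin (n + 1) → MvPolynomial (Fin (n + 1)) k := fun i => X (τ i) with hy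
  refine ⟨fun i => y i.castSucc, Equiv.Perm.sign τ, ?_⟩
  have h1 : (Fin.snoc (fun i : Fin n => y i.castSucc) Ω : Fin (n + 1) → _) =
      update y (Fin.last n) Ω := by
    ext1 i
    refine Fin.lastCases ?_ (fun i => ?_) i
    · simp
    · rw [Fin.snoc_castSucc, update_of_ne (Fin.castSucc_lt_last i).ne]
  rw [nambuPolyBracket_apply, h1, jacobianDet_chain, ← Equiv.sum_comp τ,
    Finset.sum_eq_single (Fin.last n)]
  · change _ * jacobianDet k (n + 1) (update y (Fin.last n) (y (Fin.last n))) = _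
    rw [update_eq_self, hy, jacobianDet_X_comp, Equiv.swap_apply_left, zsmul_eq_mul, zsmul_eq_mul]
    ring
  · intro p _ hp
    refine mul_eq_zero_of_right _ ((jacobianDet k (n + 1)).map_eq_zero_of_eq _
      (i := Fin.last n) (j := p) ?_ (Ne.symm hp))
    rw [update_self, update_of_ne hp]
  · simp

end NambuPoisson

/-! ### Slopes and faithfulness -/

namespace ZeroValuation

open NambuPoisson MvPolynomial

section Slope

variable {k : Type u} {n : ℕ} {N : Type*} [Field k] [Field N] [Algebra k N] [NambuPoisson k n N]
  {ν ν' : ZeroValuation k n N} {Ω : MvPolynomial (Fin (n + 1)) k} {ξ : k} {P : Presentation Ω ξ N}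

/-- `ν` is `c` times the degree valuation of weight `r`: its value at the image of a polynomial that
has a leading component is `c r` times the degree of that component. -/
def HasSlope (ν : ZeroValuation k n N) (P : Presentation Ω ξ N) (c : ℕ) (r : ℤ) : Prop :=
  ∀ f d, IsLead Ω r f d → ν (P.toHom f) = ((c * r * d : ℤ) : WithTop ℤ)

/-- Every nontrivial `0`-valuation is a positive multiple of a degree valuation of weight `± 1`. -/
theorem exists_hasSlope [CharZero k] (ν : ZeroValuation k n N) (P : Presentation Ω ξ N) (hn : 2 ≤ n)
    (hΩ : Ω.IsHomogeneous (n + 1)) (hs : HasIsolatedSingularity Ω) (hν : ν.IsNontrivial) :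
    ∃ c r, 0 < c ∧ (ξ = 0 ∧ r = 1 ∨ r = -1) ∧ ν.HasSlope P c r := by
  obtain ⟨m, hsign, hm, hker⟩ := ν.exists_grMap_ker P hn hΩ hs hν
  obtain ⟨c, r, hc, hmc, hr⟩ := exists_sign hsign
  have hr0 : r ≠ 0 := by rcases hr with ⟨-, rfl⟩ | rfl <;> norm_num
  lift c to ℕ using hc.le
  refine ⟨c, r, by exact_mod_cast hc, hr, fun f d hf => ?_⟩
  rw [apply_toHom_lead hr0 hc hmc hm hker hf, hmc]

theorem nsmul_top {c : ℕ} (hc : 0 < c) : c • (⊤ : WithTop ℤ) = ⊤ := by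
  obtain ⟨c, rfl⟩ := Nat.exists_eq_succ_of_ne_zero hc.ne'
  rw [succ_nsmul, add_top]

theorem exists_eq_coe (ν : ZeroValuation k n N) {a : N} (ha : a ≠ 0) : ∃ i : ℤ, ν a = i := by
  cases h : ν a with
  | top => exact absurd ((ν.eq_top_iff a).mp h) ha
  | coe i => exact ⟨i, rfl⟩

/-- Valuations with slopes of the same sign are proportional. -/
theorem HasSlope.nsmul_eq {c c' : ℕ} {r : ℤ} (h : ν.HasSlope P c r) (h' : ν'.HasSlope P c' r)
    (hc : 0 < c) (hc' : 0 < c') (hr : ξ = 0 ∧ r ≠ 0 ∨ r < 0) (hΩ : Ω.IsHomogeneous (n + 1)) (x : N) :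
    c' • ν x = c • ν' x := by
  rcases eq_or_ne x 0 with rfl | hx
  · rw [ν.map_zero, ν'.map_zero, nsmul_top hc, nsmul_top hc']
  obtain ⟨f, g, hg, hfg⟩ := P.exists_div x
  have hf : P.toHom f ≠ 0 := by rw [← hfg]; exact mul_ne_zero hx hg
  obtain ⟨f', d, hf', hff'⟩ := P.exists_isLead hΩ hr hf
  obtain ⟨g', e, hg', hgg'⟩ := P.exists_isLead hΩ hr hg
  rw [← hff', ← hgg'] at hfg
  obtain ⟨i, hi⟩ := ν.exists_eq_coe hx
  obtain ⟨j, hj⟩ := ν'.exists_eq_coe hx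
  have h1 := congrArg ν hfg
  have h2 := congrArg ν' hfg
  rw [ν.map_mul, hi, h _ _ hf', h _ _ hg'] at h1
  rw [ν'.map_mul, hj, h' _ _ hf', h' _ _ hg'] at h2
  rw [hi, hj]
  norm_cast at h1 h2 ⊢
  rw [nsmul_eq_mul, nsmul_eq_mul]
  linear_combination (c' : ℤ) * h1 - (c : ℤ) * h2

theorem HasSlope.isEquiv {c c' : ℕ} {r : ℤ} (h : ν.HasSlope P c r) (h' : ν'.HasSlope P c' r)
    (hc : 0 < c) (hc' : 0 < c') (hr : ξ = 0 ∧ r ≠ 0 ∨ r < 0) (hΩ : Ω.IsHomogeneous (n + 1)) :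
    ν.IsEquiv ν' :=
  ⟨c', c, hc', hc, h.nsmul_eq h' hc hc' hr hΩ⟩

theorem HasSlope.eq {r : ℤ} (h : ν.HasSlope P 1 r) (h' : ν'.HasSlope P 1 r)
    (hr : ξ = 0 ∧ r ≠ 0 ∨ r < 0) (hΩ : Ω.IsHomogeneous (n + 1)) : ν = ν' := by
  have := h.nsmul_eq h' one_pos one_pos hr hΩ
  simp only [one_nsmul] at this
  cases ν
  cases ν'
  congr
  exact funext this

theorem HasSlope.apply_X {c : ℕ} {r : ℤ} (h : ν.HasSlope P c r) (hn : n ≠ 0)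
    (hΩ : Ω.IsHomogeneous (n + 1)) (i : Fin (n + 1)) :
    ν (P.toHom (X i)) = ((c * r : ℤ) : WithTop ℤ) := by
  have hX := isHomogeneous_X k i
  have := h (X i) 1 ⟨hX.mem_degGE, by
    rw [homogeneousComponent_eq_self hX]
    exact hΩ.not_dvd_of_lt hX (X_ne_zero i) (by omega)⟩
  rwa [Nat.cast_one, mul_one] at this

theorem isNontrivial_of_range_eq_univ (h : Set.range ν.toFun = Set.univ) : ν.IsNontrivial := by
  obtain ⟨x, hx⟩ := (h ▸ Set.mem_univ _ : ((1 : ℤ) : WithTop ℤ) ∈ Set.range ν.toFun)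
  refine ⟨x, ?_, ?_⟩
  · rintro rfl
    exact absurd (ν.map_zero.symm.trans hx) (by exact WithTop.top_ne_coe)
  · intro h0
    exact absurd (h0.symm.trans hx) (by norm_cast)

theorem map_pow_eq (ν : ZeroValuation k n N) {a : N} {i : ℤ} (h : ν a = i) (j : ℕ) :
    ν (a ^ j) = ((i * j : ℤ) : WithTop ℤ) := by
  induction j with
  | zero => rw [pow_zero, ν.map_one]; simp
  | succ j ih =>
    rw [pow_succ, ν.map_mul, ih, h]
    norm_cast
    push_cast
    ring

theorem range_eq_univ_of_apply_eq {a : N} {r : ℤ} (h : ν a = r) (hr : r = 1 ∨ r = -1) :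
    Set.range ν.toFun = Set.univ := by
  refine Set.eq_univ_of_forall fun z => ?_
  cases z with
  | top => exact ⟨0, ν.map_zero⟩
  | coe z =>
    have ha : a ≠ 0 := by
      rintro rfl
      rw [ν.map_zero] at h
      exact absurd h (by exact WithTop.top_ne_coe)
    have hinv : ν a⁻¹ = ((-r : ℤ) : WithTop ℤ) := by
      obtain ⟨i, hi⟩ := ν.exists_eq_coe (inv_ne_zero ha)
      have h1 := ν.map_mul a a⁻¹
      rw [mul_inv_cancel₀ ha, ν.map_one, h, hi] at h1
      rw [hi]
      norm_cast at h1 ⊢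
      omega
    rcases le_total 0 (r * z) with hz | hz
    · refine ⟨a ^ z.natAbs, (ν.map_pow_eq h _).trans ?_⟩
      rcases hr with rfl | rfl <;> congr 1 <;> omega
    · refine ⟨a⁻¹ ^ z.natAbs, (ν.map_pow_eq hinv _).trans ?_⟩
      rcases hr with rfl | rfl <;> congr 1 <;> omega

theorem HasSlope.eq_one {c : ℕ} {r : ℤ} (h : ν.HasSlope P c r) (hr : ξ = 0 ∧ r ≠ 0 ∨ r < 0)
    (hΩ : Ω.IsHomogeneous (n + 1)) (hν : Set.range ν.toFun = Set.univ) : c = 1 := by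
  obtain ⟨x, hx⟩ := (hν ▸ Set.mem_univ _ : ((1 : ℤ) : WithTop ℤ) ∈ Set.range ν.toFun)
  have hx0 : x ≠ 0 := by
    rintro rfl
    exact absurd (ν.map_zero.symm.trans hx) (by exact WithTop.top_ne_coe)
  obtain ⟨f, g, hg, hfg⟩ := P.exists_div x
  have hf : P.toHom f ≠ 0 := by rw [← hfg]; exact mul_ne_zero hx0 hg
  obtain ⟨f', d, hf', hff'⟩ := P.exists_isLead hΩ hr hf
  obtain ⟨g', e, hg', hgg'⟩ := P.exists_isLead hΩ hr hg
  rw [← hff', ← hgg'] at hfg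
  have h1 := congrArg ν hfg
  rw [ν.map_mul, show ν x = ((1 : ℤ) : WithTop ℤ) from hx, h _ _ hf', h _ _ hg'] at h1
  have h2 : 1 + (c * r * e : ℤ) = c * r * d := by exact_mod_cast h1
  have h3 : (c : ℤ) ∣ 1 := ⟨r * d - r * e, by linear_combination h2⟩
  exact Nat.dvd_one.mp (by exact_mod_cast h3)

end Slope

section Faithful

variable {k : Type u} [Field k] [CharZero k] {n : ℕ} {Ω : MvPolynomial (Fin (n + 1)) k} {ξ : k}

theorem hypValuation_hasSlope [IsDomain (NambuHyp Ω ξ)] (hΩ : Ω.IsHomogeneous (n + 1))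
    (hp : Prime Ω) {r : ℤ} (hr : ξ = 0 ∧ r ≠ 0 ∨ r < 0) :
    (hypValuation hΩ hp hr).HasSlope (hypPresentation Ω ξ) 1 r := by
  intro f d hf
  rw [Nat.cast_one, one_mul]
  exact hypValuation_isLead hΩ hp hr hf

variable {N : Type u} [Field N] [Algebra k N] [NambuPoisson k n N]
  (ν : ZeroValuation k n N)

theorem exists_grBracket_ne_zero (P : Presentation Ω ξ N) (hn : 2 ≤ n) (hΩ : Ω.IsHomogeneous (n + 1))
    (hs : HasIsolatedSingularity Ω) (hν : ν.IsNontrivial) :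
    ∃ v : Fin n → ν.Gr, bracket (k := k) v ≠ 0 := by
  obtain ⟨m, -, hm, hker⟩ := ν.exists_grMap_ker P hn hΩ hs hν
  obtain ⟨j, hj⟩ : ∃ j, pderiv j Ω ≠ 0 := by
    by_contra! h
    obtain ⟨M, hM⟩ := hs.exists_X_pow_mem hΩ 0
    have hJ : jacobianIdeal Ω = ⊥ := by
      refine le_bot_iff.mp (Ideal.span_le.mpr ?_)
      rintro _ ⟨j, rfl⟩
      exact h j
    rw [hJ] at hM
    exact pow_ne_zero M (X_ne_zero (R := k) 0) hM
  obtain ⟨v, s, hv⟩ := exists_nambuPolyBracket_eq_pderiv Ω j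
  refine ⟨fun i => ν.grMap P m (v i), ?_⟩
  rw [← ν.grMap_bracket P hm hΩ, Ne, hker, hv]
  intro h
  refine hΩ.not_dvd_of_lt (hΩ.pderiv (i := j)) hj (by omega) ?_
  rcases Int.units_eq_one_or s with rfl | rfl <;> simpa using h

theorem GKdim_gr (P : Presentation Ω ξ N) (hn : 2 ≤ n) (hΩ : Ω.IsHomogeneous (n + 1))
    (hs : HasIsolatedSingularity Ω) (hν : ν.IsNontrivial) : GKdim k ν.Gr = GKdim k N := by
  have hp := hs.prime hn n.succ_ne_zero hΩ
  have hdom : ∀ ξ, IsDomain (NambuHyp Ω ξ) := fun ξ =>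
    isDomain_nambuHyp (prime_sub_C n.succ_ne_zero hΩ hp ξ)
  obtain ⟨P'⟩ := ν.nonempty_gr_presentation P hn hΩ hs hν
  obtain ⟨e, -⟩ := P'.exists_algEquiv (hypPresentation Ω 0)
  obtain ⟨e', -⟩ := P.exists_algEquiv (hypPresentation Ω ξ)
  rw [GKdim_eq_of_algEquiv e', ← GKdim_fractionRing (A := ν.Gr), GKdim_eq_of_algEquiv e,
    GKdim_fractionRing, GKdim_fractionRing, GKdim_nambuHyp n.succ_ne_zero hΩ hp.ne_zero ξ]

theorem isFaithful_iff (P : Presentation Ω ξ N) (hn : 2 ≤ n) (hΩ : Ω.IsHomogeneous (n + 1))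
    (hs : HasIsolatedSingularity Ω) : ν.IsFaithful ↔ Set.range ν.toFun = Set.univ :=
  ⟨fun h => h.1, fun h => ⟨h,
    ν.exists_grBracket_ne_zero P hn hΩ hs (isNontrivial_of_range_eq_univ h),
    ν.GKdim_gr P hn hΩ hs (isNontrivial_of_range_eq_univ h)⟩⟩

end Faithful

end ZeroValuation

/-! ### Depth and width -/

namespace NambuPoissonField

open NambuPoisson MvPolynomial ZeroValuation

variable {k : Type u} [Field k] [CharZero k] {n : ℕ} {Ω : MvPolynomial (Fin (n + 1)) k} {ξ : k}
  {N N' : NambuPoissonField k n}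

/-- Every step `N →_ν N'` with nontrivial `ν` leads to a field presented by `Ω` itself. -/
theorem Arrow.nonempty_presentation {ν : ZeroValuation k n N.carrier} (h : N.Arrow ν N')
    (P : Presentation Ω ξ N.carrier) (hn : 2 ≤ n) (hΩ : Ω.IsHomogeneous (n + 1))
    (hs : HasIsolatedSingularity Ω) (hν : ν.IsNontrivial) :
    Nonempty (Presentation Ω 0 N'.carrier) := by
  obtain ⟨P'⟩ := ν.nonempty_gr_presentation P hn hΩ hs hν
  exact Presentation.nonempty_of_iso (M := Q k n ν.Gr) P' ((isoSetoid k n).symm h)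

theorem arrow_of_presentation {ν : ZeroValuation k n N.carrier} (P : Presentation Ω ξ N.carrier)
    (P' : Presentation Ω 0 N'.carrier) (hn : 2 ≤ n) (hΩ : Ω.IsHomogeneous (n + 1))
    (hs : HasIsolatedSingularity Ω) (hν : ν.IsNontrivial) : N.Arrow ν N' := by
  obtain ⟨P''⟩ := ν.nonempty_gr_presentation P hn hΩ hs hν
  exact Presentation.iso (N := Q k n ν.Gr) P' P''

theorem width_eq_one (P : Presentation Ω ξ N.carrier) (P' : Presentation Ω 0 N'.carrier)
    (hn : 2 ≤ n) (hΩ : Ω.IsHomogeneous (n + 1)) (hs : HasIsolatedSingularity Ω)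
    {ν : ZeroValuation k n N.carrier} (hν : ν.IsFaithful) : N.width = 1 := by
  rw [width, Set.encard_eq_one]
  refine ⟨Quotient.mk _ N', Set.Subset.antisymm ?_ ?_⟩
  · rintro _ ⟨M, ⟨ν', hν', h⟩, rfl⟩
    obtain ⟨P''⟩ := h.nonempty_presentation P hn hΩ hs (isNontrivial_of_range_eq_univ hν'.1)
    exact Quotient.sound (Presentation.iso P'' P')
  · rintro _ rfl
    exact ⟨N', ⟨ν, hν, arrow_of_presentation P P' hn hΩ hs (isNontrivial_of_range_eq_univ hν.1)⟩,
      rfl⟩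

theorem depth_eq_zero (P : Presentation Ω 0 N.carrier) (hn : 2 ≤ n) (hΩ : Ω.IsHomogeneous (n + 1))
    (hs : HasIsolatedSingularity Ω) : N.depth = 0 := by
  refine le_antisymm (iSup₂_le ?_) (zero_le)
  rintro (_ | l) ⟨C, rfl, hC, hne⟩
  · exact le_rfl
  · obtain ⟨ν, hν, h⟩ := hC 0
    obtain ⟨P'⟩ := h.nonempty_presentation P hn hΩ hs (isNontrivial_of_range_eq_univ hν.1)
    exact absurd (Presentation.iso P P') (hne 0 (Fin.succ 0) (Fin.succ_ne_zero 0).symm)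

/-- In a chain, all fields but the first one are presented by `Ω`, hence isomorphic. -/
theorem depth_le_one (P : Presentation Ω ξ N.carrier) (hn : 2 ≤ n) (hΩ : Ω.IsHomogeneous (n + 1))
    (hs : HasIsolatedSingularity Ω) : N.depth ≤ 1 := by
  refine iSup₂_le ?_
  rintro (_ | _ | l) ⟨C, rfl, hC, hne⟩
  · exact zero_le
  · exact le_rfl
  · obtain ⟨ν, hν, h⟩ := hC 0
    obtain ⟨P'⟩ := h.nonempty_presentation P hn hΩ hs (isNontrivial_of_range_eq_univ hν.1)
    obtain ⟨ν', hν', h'⟩ := hC 1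
    obtain ⟨P''⟩ := h'.nonempty_presentation (Ω := Ω) (ξ := 0) P' hn hΩ hs
      (isNontrivial_of_range_eq_univ hν'.1)
    exact absurd (Presentation.iso P' P'') (hne (Fin.succ 0) (Fin.succ 1)
      fun h => Fin.zero_ne_one (Fin.succ_injective _ h))

theorem one_le_depth {ν : ZeroValuation k n N.carrier} (hν : ν.IsFaithful) (h : N.Arrow ν N')
    (hne : ¬ N.Iso N') : 1 ≤ N.depth := by
  refine le_iSup_of_le 1 (le_iSup_of_le ⟨![N, N'], rfl, ?_, ?_⟩ Nat.cast_one.ge)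
  · intro i
    obtain rfl := Subsingleton.elim i 0
    exact ⟨ν, hν, h⟩
  · have hne' : ¬ N'.Iso N := fun h => hne ((isoSetoid k n).symm h)
    intro i j hij
    fin_cases i <;> fin_cases j <;> first | exact absurd rfl hij | exact hne | exact hne'

end NambuPoissonField

namespace ZeroValuation

open NambuPoisson MvPolynomial

section
variable {k : Type u} {n : ℕ} {N : Type*} [Field k] [Field N] [Algebra k N] [NambuPoisson k n N]
  {ν ν' : ZeroValuation k n N} {Ω : MvPolynomial (Fin (n + 1)) k} {ξ : k} {P : Presentation Ω ξ N}

theorem HasSlope.not_isEquiv (h : ν.HasSlope P 1 1) (h' : ν'.HasSlope P 1 (-1)) (hn : n ≠ 0)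
    (hΩ : Ω.IsHomogeneous (n + 1)) : ¬ ν.IsEquiv ν' := by
  rintro ⟨a, b, ha, hb, hab⟩
  have := hab (P.toHom (X 0))
  rw [h.apply_X hn hΩ, h'.apply_X hn hΩ] at this
  norm_cast at this
  simp only [Nat.cast_one, one_mul, nsmul_eq_mul, mul_one] at this
  omega

/-- On a field presented by `Ω - ξ` with `ξ ≠ 0` all nontrivial `0`-valuations are equivalent. -/
theorem isEquiv_of_ne_zero [CharZero k] (P : Presentation Ω ξ N) (hξ : ξ ≠ 0) (hn : 2 ≤ n)
    (hΩ : Ω.IsHomogeneous (n + 1)) (hs : HasIsolatedSingularity Ω) (hν : ν.IsNontrivial)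
    (hν' : ν'.IsNontrivial) : ν.IsEquiv ν' := by
  obtain ⟨c, r, hc, hr, h⟩ := ν.exists_hasSlope P hn hΩ hs hν
  obtain ⟨c', r', hc', hr', h'⟩ := ν'.exists_hasSlope P hn hΩ hs hν'
  obtain rfl := hr.resolve_left fun h => hξ h.1
  obtain rfl := hr'.resolve_left fun h => hξ h.1
  exact h.isEquiv h' hc hc' (Or.inr (by norm_num)) hΩ

end

theorem HasSlope.isFaithful {k : Type u} [Field k] [CharZero k] {n : ℕ} {N : Type u} [Field N]
    [Algebra k N] [NambuPoisson k n N] {ν : ZeroValuation k n N}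
    {Ω : MvPolynomial (Fin (n + 1)) k} {ξ : k} {P : Presentation Ω ξ N} {r : ℤ}
    (h : ν.HasSlope P 1 r) (hr : r = 1 ∨ r = -1) (hn : 2 ≤ n)
    (hΩ : Ω.IsHomogeneous (n + 1)) (hs : HasIsolatedSingularity Ω) : ν.IsFaithful := by
  rw [ν.isFaithful_iff P hn hΩ hs]
  refine range_eq_univ_of_apply_eq (a := P.toHom (X 0)) (r := r) ?_ hr
  simpa using h.apply_X (by omega) hΩ 0

end ZeroValuation

theorem theorem0p6 {k : Type u} [Field k] [CharZero k] (n : ℕ) (hn : 3 ≤ n)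
    (Ω : MvPolynomial (Fin (n + 1)) k) (hdeg : Ω.IsHomogeneous (n + 1))
    (hΩ : NambuPoisson.HasIsolatedSingularity Ω) :
    -- `P_Ω` and `P_{Ω-1}` are domains, so that their fraction fields make sense
    ∃ (_ : IsDomain (NambuPoisson.NambuHyp Ω 0)) (_ : IsDomain (NambuPoisson.NambuHyp Ω 1)),
    -- `N = Q(P_Ω)`; `ν₁ = ν^{Id}` and `ν₂ = ν^{-Id}`
    (∃ ν₁ ν₂ : ZeroValuation k n (FractionRing (NambuPoisson.NambuHyp Ω 0)),
      ν₁.IsGivenBy (NambuPoisson.degFiltration Ω 0 1) ∧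
      ν₂.IsGivenBy (NambuPoisson.degFiltration Ω 0 (-1)) ∧
      ν₁.IsNontrivial ∧ ν₂.IsNontrivial ∧ ¬ ν₁.IsEquiv ν₂ ∧
      (∀ ν : ZeroValuation k n (FractionRing (NambuPoisson.NambuHyp Ω 0)),
        ν.IsNontrivial → ν.IsEquiv ν₁ ∨ ν.IsEquiv ν₂) ∧
      (∀ ν : ZeroValuation k n (FractionRing (NambuPoisson.NambuHyp Ω 0)),
        ν.IsFaithful ↔ ν = ν₁ ∨ ν = ν₂) ∧
      (∀ ν : ZeroValuation k n (FractionRing (NambuPoisson.NambuHyp Ω 0)), ν.IsNontrivial →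
        (NambuPoissonField.Q k n (NambuPoisson.NambuHyp Ω 0)).Arrow ν
          (NambuPoissonField.Q k n (NambuPoisson.NambuHyp Ω 0))) ∧
      (NambuPoissonField.Q k n (NambuPoisson.NambuHyp Ω 0)).depth = 0 ∧
      (NambuPoissonField.Q k n (NambuPoisson.NambuHyp Ω 0)).width = 1) ∧
    -- `N = Q(P_{Ω-1})`
    (∃ ν₀ : ZeroValuation k n (FractionRing (NambuPoisson.NambuHyp Ω 1)),
      ν₀.IsGivenBy (NambuPoisson.degFiltration Ω 1 (-1)) ∧
      ν₀.IsNontrivial ∧ ν₀.IsFaithful ∧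
      (∀ ν : ZeroValuation k n (FractionRing (NambuPoisson.NambuHyp Ω 1)),
        ν.IsNontrivial → ν.IsEquiv ν₀) ∧
      (∀ ν : ZeroValuation k n (FractionRing (NambuPoisson.NambuHyp Ω 1)), ν.IsNontrivial →
        (NambuPoissonField.Q k n (NambuPoisson.NambuHyp Ω 1)).Arrow ν
          (NambuPoissonField.Q k n (NambuPoisson.NambuHyp Ω 0))) ∧
      (NambuPoissonField.Q k n (NambuPoisson.NambuHyp Ω 1)).depth = 1 ∧
      (NambuPoissonField.Q k n (NambuPoisson.NambuHyp Ω 1)).width = 1) := by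
  open NambuPoisson ZeroValuation NambuPoissonField in
  have hn2 : 2 ≤ n := by omega
  have hn0 : n ≠ 0 := by omega
  have hp := hΩ.prime hn2 n.succ_ne_zero hdeg
  have hdom : ∀ ξ, IsDomain (NambuHyp Ω ξ) := fun ξ =>
    isDomain_nambuHyp (prime_sub_C n.succ_ne_zero hdeg hp ξ)
  have i0 := hdom 0
  have i1 := hdom 1
  let P₀ := hypPresentation Ω (0 : k)
  let P₁ := hypPresentation Ω (1 : k)
  have a₁ : (0 : k) = 0 ∧ (1 : ℤ) ≠ 0 ∨ (1 : ℤ) < 0 := Or.inl ⟨rfl, one_ne_zero⟩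
  have a₂ : ∀ {ξ : k}, ξ = 0 ∧ (-1 : ℤ) ≠ 0 ∨ (-1 : ℤ) < 0 := Or.inr (by norm_num)
  have s₁ : (hypValuation hdeg hp a₁).HasSlope P₀ 1 1 := hypValuation_hasSlope hdeg hp a₁
  have s₂ : (hypValuation hdeg hp a₂).HasSlope P₀ 1 (-1) := hypValuation_hasSlope hdeg hp a₂
  have s₀ : (hypValuation hdeg hp a₂).HasSlope P₁ 1 (-1) := hypValuation_hasSlope hdeg hp a₂
  have f₁ := s₁.isFaithful (Or.inl rfl) hn2 hdeg hΩ
  have f₂ := s₂.isFaithful (Or.inr rfl) hn2 hdeg hΩ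
  have f₀ := s₀.isFaithful (Or.inr rfl) hn2 hdeg hΩ
  have t₁ := isNontrivial_of_range_eq_univ f₁.1
  have t₂ := isNontrivial_of_range_eq_univ f₂.1
  have t₀ := isNontrivial_of_range_eq_univ f₀.1
  have ne := s₁.not_isEquiv s₂ hn0 hdeg
  refine ⟨i0, i1, ⟨hypValuation hdeg hp a₁, hypValuation hdeg hp a₂,
    hypValuation_isGivenBy hdeg hp a₁, hypValuation_isGivenBy hdeg hp a₂, t₁, t₂, ne, ?_, ?_, ?_,
    ?_, ?_⟩, ⟨hypValuation hdeg hp a₂, hypValuation_isGivenBy hdeg hp a₂, t₀, f₀, ?_, ?_, ?_, ?_⟩⟩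
  · intro ν hν
    obtain ⟨c, r, hc, ⟨-, rfl⟩ | rfl, h⟩ := ν.exists_hasSlope P₀ hn2 hdeg hΩ hν
    · exact Or.inl (h.isEquiv s₁ hc one_pos a₁ hdeg)
    · exact Or.inr (h.isEquiv s₂ hc one_pos a₂ hdeg)
  · intro ν
    refine ⟨fun hν => ?_, ?_⟩
    · obtain ⟨c, r, hc, ⟨-, rfl⟩ | rfl, h⟩ := ν.exists_hasSlope P₀ hn2 hdeg hΩ
        (isNontrivial_of_range_eq_univ hν.1)
      · obtain rfl := h.eq_one a₁ hdeg hν.1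
        exact Or.inl (h.eq s₁ a₁ hdeg)
      · obtain rfl := h.eq_one a₂ hdeg hν.1
        exact Or.inr (h.eq s₂ a₂ hdeg)
    · rintro (rfl | rfl)
      · exact f₁
      · exact f₂
  · exact fun ν hν => arrow_of_presentation (N := Q k n (NambuHyp Ω 0))
      (N' := Q k n (NambuHyp Ω 0)) P₀ P₀ hn2 hdeg hΩ hν
  · exact depth_eq_zero (N := Q k n (NambuHyp Ω 0)) P₀ hn2 hdeg hΩ
  · exact width_eq_one (N := Q k n (NambuHyp Ω 0)) (N' := Q k n (NambuHyp Ω 0)) P₀ P₀ hn2 hdeg hΩ f₁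
  · exact fun ν hν => isEquiv_of_ne_zero P₁ one_ne_zero hn2 hdeg hΩ hν t₀
  · exact fun ν hν => arrow_of_presentation (N := Q k n (NambuHyp Ω 1))
      (N' := Q k n (NambuHyp Ω 0)) P₁ P₀ hn2 hdeg hΩ hν
  · refine le_antisymm (depth_le_one (N := Q k n (NambuHyp Ω 1)) P₁ hn2 hdeg hΩ)
      (one_le_depth (N' := Q k n (NambuHyp Ω 0)) f₀
        (arrow_of_presentation (N := Q k n (NambuHyp Ω 1)) P₁ P₀ hn2 hdeg hΩ t₀) fun h => ?_)
    -- the number of classes of nontrivial valuations distinguishes the two fields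
    obtain ⟨P⟩ := Presentation.nonempty_of_iso (M := Q k n (NambuHyp Ω 1)) P₁ h
    exact ne (isEquiv_of_ne_zero (N := FractionRing (NambuHyp Ω 0)) P one_ne_zero hn2 hdeg hΩ t₁ t₂)
  · exact width_eq_one (N := Q k n (NambuHyp Ω 1)) (N' := Q k n (NambuHyp Ω 0)) P₁ P₀ hn2 hdeg hΩ f₀
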